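/- **Setting.** Let $\Omega\subset\mathbb R^3$ be an open set of finite volume, $\Omega=\Omega_+\cup\Omega_-\cup\Gamma$, where $\Omega_\pm$ are disjoint open sets and $\Gamma$ is a $C^1$ interface between them: every $x\in\Gamma$ has an open neighbourhood $V$ with a $C^1$ function $g:V\to\mathbb R$, $\nabla g(x)\neq0$, such that $\Gamma\cap V=\{g=0\}$, $\Omega_+\cap V=\{g>0\}$, $\Omega_-\cap V=\{g<0\}$. On $\Gamma$ let $\mathbf n=\nabla g/|\nabla g|$ be the unit normal pointing to the $+$ side; off $\Gamma$ let $\mathbf n$ denote any extension that is continuous at the points of $\Gamma$ (e.g. the normal at a nearest point of $\Gamma$). Let $\lambda=\lambda_+$, $\mu=\mu_+$ on $\Omega_+\cup\Gamma$ and $\lambda=\lambda_-$, $\mu=\mu_-$ on $\Omega_-$, with constants $\lambda_\pm\in\mathbb R$, $\mu_\pm>0$. For a displacement $u$ put $$\sigma=\lambda(\nabla\cdot u)I+\mu(\nabla u+\nabla u^T),\qquad \mathcal N u=\nabla\cdot\sigma\ \text{ on }\Omega\setminus\Gamma,$$ and $[\sigma]=\sigma(x^+)-\sigma(x^-)$ for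 $x\in\Gamma$, where $\sigma(x^\pm)$ is the limit of $\sigma(y)$ as $y\to x$, $y\in\Omega_\pm$. For $\delta>0$ let $\Gamma_\delta=\{x\in\Omega:\operatorname{dist}(x,\Gamma)<\delta\}$, $\Omega^{2\delta}=\{x\in\Omega:\operatorname{dist}(x,\partial\Omega)\ge2\delta\}$, and for $x\in\Omega^{2\delta}$ (writing $(a\otimes b)c=(b\cdot c)a$) let $\mathcal L^\delta=\mathcal L^\delta_s+\mathcal L^\delta_d$ with $$\mathcal L^\delta_su(x)=\frac{15}{|B_\delta|}\int_{B_\delta(x)}(\mu(x)+\mu(y))\frac{(y-x)\otimes(y-x)}{|y-x|^4}(u(y)-u(x))\,dy,$$ $$\mathcal L^\delta_du(x)=\frac{9}{|B_\delta|^2}\int_{B_\delta(x)}\int_{B_\delta(y)}(\lambda(y)-\mu(y))\frac{y-x}{|y-x|^2}\otimes\frac{z-y}{|z-y|^2}\,u(z)\,dz\,dy,$$ and $\mathcal L^\delta_*u=\mathcal L^\delta u+1_{\Gamma_\delta}\mathcal L^\delta_{\Gamma_\delta}u$ with $$\mathcal L^\delta_{\Gamma_\delta}u(x)=-\frac{15}{|B_\delta|}\int_{B_\delta(x)}\mu(x)\frac{(y-x)\otimes(y-x)}{|y-x|^4}(u(y)-u(x))\,dy+\frac14\mathcal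 L^\delta_du(x)$$ $$\qquad+\frac54\,\frac{9}{|B_\delta|^2}\left(\int_{B_\delta(x)}\int_{B_\delta(y)}\mu(y)\,\frac{y-x}{|y-x|^2}\cdot\frac{z-y}{|z-y|^2}\,u(z)\,dz\,dy\cdot\mathbf n(x)\right)\mathbf n(x).$$ **Theorem.** Let $u:\Omega\to\mathbb R^3$ be continuous on $\Omega$ and $C^3$ on each side of $\Gamma$ up to $\Gamma$ (that is, on each of $\Omega_\pm$ it agrees with a $C^3$ map on $\Omega$), with derivatives of order $\le3$ bounded on $\Omega\setminus\Gamma$. Suppose that for all sufficiently small $\delta>0$ $$\mathcal L^\delta_*u(x)=0\qquad\text{for all }x\in\Gamma_\delta\cap\Omega^{2\delta}.$$ Then: 1. for every $1\le p<\infty$, $\mathcal Nu\in L^p(\Omega)^3$ and, as $\delta\to0$, $\mathcal L^\delta_*u\to\mathcal Nu$ in $L^p(\Omega)^3$, where $\mathcal L^\delta_*u$, defined on $\Omega^{2\delta}$, is extended by $0$ to $\Omega$ (and belongs to $L^p(\Omega)^3$ for all small $\delta$); 2. for every $x\in\Gamma$ the one-sided limits $\sigma(x^\pm)$ exist, $\delta\,\mathcal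 L^\delta_*u(x)\to\frac{45}{32}[\sigma]\mathbf n$ as $\delta\to0$, and $[\sigma]\mathbf n=0$. -/

import Mathlib

open Filter Topology MeasureTheory

namespace Peridynamics

/-- Three-dimensional Euclidean space. -/
abbrev E3 : Type := EuclideanSpace ℝ (Fin 3)

/-! ### Geometry of a two-phase composite -/

/-- `Ω = Ω₊ ∪ Ω₋ ∪ Γ` is a two-phase composite with phases the disjoint open sets `Ωp`, `Ωm` and
with a `C¹` interface `Γ`; `n` restricted to `Γ` is the unit normal pointing from the minus side
to the plus side.  Near each point of `Γ` the interface is the zero set of a `C¹` function `g`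
with nonvanishing gradient, and the two phases are `{0 < g}` and `{g < 0}`.
The vector field `n` is also evaluated near `Γ`, where it only has to be an extension of the
unit normal that is continuous at the points of `Γ` (for example, the normal at a nearest point
of the interface). -/
structure IsTwoPhaseComposite (Ω Ωp Ωm Γ : Set E3) (n : E3 → E3) : Prop where
  isOpen_domain : IsOpen Ω
  isOpen_plus : IsOpen Ωp
  isOpen_minus : IsOpen Ωm
  disjoint_phases : Disjoint Ωp Ωm
  domain_eq : Ω = Ωp ∪ Ωm ∪ Γ
  interface : ∀ x ∈ Γ, ∃ V : Set E3, IsOpen V ∧ x ∈ V ∧ ∃ g : E3 → ℝ,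
    ContDiffOn ℝ 1 g V ∧ gradient g x ≠ 0 ∧
    (∀ y ∈ V, (y ∈ Γ ↔ g y = 0) ∧ (y ∈ Ωp ↔ 0 < g y) ∧ (y ∈ Ωm ↔ g y < 0)) ∧
    n x = ‖gradient g x‖⁻¹ • gradient g x
  normal_continuousAt : ∀ x ∈ Γ, ContinuousAt n x

open Classical in
/-- The piecewise constant coefficient equal to `cm` on `Ω₋` and to `cp` on `Ω₊ ∪ Γ`. -/
noncomputable def twoPhase (Ωm : Set E3) (cp cm : ℝ) (x : E3) : ℝ :=
  if x ∈ Ωm then cm else cp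

/-- The extended interface `Γ_δ = {x ∈ Ω : dist(x, Γ) < δ}`. -/
def extendedInterface (Ω Γ : Set E3) (δ : ℝ) : Set E3 :=
  Ω ∩ Metric.thickening δ Γ

/-- The points of `Ω` at distance at least `r` from the boundary of `Ω` (for `0 < r`), expressed
by the inclusion of a ball so that it is also correct when the boundary is empty. -/
def innerPart (Ω : Set E3) (r : ℝ) : Set E3 :=
  {x | Metric.ball x r ⊆ Ω}

/-- `u` is continuous on `Ω` and `C³` on each side of the interface: on each phase it agrees with
a map that is `C³` across the interface, and its derivatives up to order three are bounded
away from `Γ`. -/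
structure IsPiecewiseSmooth (Ω Ωp Ωm : Set E3) (u : E3 → E3) : Prop where
  continuousOn : ContinuousOn u Ω
  smooth_plus : ∃ U : E3 → E3, ContDiffOn ℝ 3 U Ω ∧ Set.EqOn u U Ωp
  smooth_minus : ∃ U : E3 → E3, ContDiffOn ℝ 3 U Ω ∧ Set.EqOn u U Ωm
  bounded : ∀ k : ℕ, k ≤ 3 → ∃ M : ℝ, ∀ x ∈ Ωp ∪ Ωm, ‖iteratedFDeriv ℝ k u x‖ ≤ M

/-! ### Linear elasticity -/

/-- The partial derivative `∂f/∂xⱼ`. -/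
noncomputable def pderiv (j : Fin 3) (f : E3 → ℝ) (x : E3) : ℝ :=
  fderiv ℝ f x (EuclideanSpace.single j 1)

/-- The displacement gradient, `(∇u)ᵢⱼ = ∂uᵢ/∂xⱼ`. -/
noncomputable def grad (u : E3 → E3) (x : E3) : Matrix (Fin 3) (Fin 3) ℝ :=
  Matrix.of fun i j => pderiv j (fun y => u y i) x

/-- The stress tensor `σ = λ (∇·u) I + μ (∇u + ∇uᵀ)`. -/
noncomputable def stress (lam mu : E3 → ℝ) (u : E3 → E3) (x : E3) : Matrix (Fin 3) (Fin 3) ℝ :=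
  (lam x * (grad u x).trace) • (1 : Matrix (Fin 3) (Fin 3) ℝ)
    + mu x • (grad u x + (grad u x).transpose)

/-- The Navier operator `𝒩u = ∇·σ`. -/
noncomputable def navier (lam mu : E3 → ℝ) (u : E3 → E3) (x : E3) : E3 :=
  WithLp.toLp 2 fun i => ∑ j, pderiv j (fun y => stress lam mu u y i j) x

/-! ### Peridynamic operators

The tensor product acts by `(a ⊗ b) c = (b · c) a`. -/

/-- The volume `|B_δ|` of a ball of radius `δ`. -/
noncomputable def ballVol (δ : ℝ) : ℝ :=
  volume.real (Metric.ball (0 : E3) δ)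

/-- The operator `ℒ^δ_s`. -/
noncomputable def opS (δ : ℝ) (mu : E3 → ℝ) (v : E3 → E3) (x : E3) : E3 :=
  (15 / ballVol δ) • ∫ y in Metric.ball x δ,
    ((mu x + mu y) * inner ℝ (y - x) (v y - v x) / ‖y - x‖ ^ 4) • (y - x)

/-- The operator `ℒ^δ_d`, in the form valid at distance at least `2δ` from the boundary. -/
noncomputable def opD (δ : ℝ) (lam mu : E3 → ℝ) (v : E3 → E3) (x : E3) : E3 :=
  (9 / ballVol δ ^ 2) • ∫ y in Metric.ball x δ, ∫ z in Metric.ball y δ,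
    ((lam y - mu y) * inner ℝ (z - y) (v z) / (‖y - x‖ ^ 2 * ‖z - y‖ ^ 2)) • (y - x)

/-- The linear peridynamic operator `ℒ^δ = ℒ^δ_s + ℒ^δ_d`. -/
noncomputable def opL (δ : ℝ) (lam mu : E3 → ℝ) (v : E3 → E3) (x : E3) : E3 :=
  opS δ mu v x + opD δ lam mu v x

/-- The operator `ℒ^δ_{Γ_δ}` acting at points of the extended interface. -/
noncomputable def opInterface (δ : ℝ) (lam mu : E3 → ℝ) (n : E3 → E3) (u : E3 → E3) (x : E3) : E3 :=
  -((15 / ballVol δ) • ∫ y in Metric.ball x δ,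
      (mu x * inner ℝ (y - x) (u y - u x) / ‖y - x‖ ^ 4) • (y - x))
  + ((1 / 4 : ℝ) * (9 / ballVol δ ^ 2)) • (∫ y in Metric.ball x δ, ∫ z in Metric.ball y δ,
      ((lam y - mu y) * inner ℝ (z - y) (u z) / (‖y - x‖ ^ 2 * ‖z - y‖ ^ 2)) • (y - x))
  + ((5 / 4 : ℝ) * (9 / ballVol δ ^ 2) *
      inner ℝ (∫ y in Metric.ball x δ, ∫ z in Metric.ball y δ,
        (mu y * inner ℝ (y - x) (z - y) / (‖y - x‖ ^ 2 * ‖z - y‖ ^ 2)) • u z) (n x)) • n x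

/-- The modified operator `ℒ^δ_* = ℒ^δ + 1_{Γ_δ} ℒ^δ_{Γ_δ}`. -/
noncomputable def opStar (δ : ℝ) (Ω Γ : Set E3) (lam mu : E3 → ℝ) (n : E3 → E3) (u : E3 → E3)
    (x : E3) : E3 :=
  opL δ lam mu u x + (extendedInterface Ω Γ δ).indicator (opInterface δ lam mu n u) x

end Peridynamics

namespace Peridynamics
open Set Metric

/-! ### Moments of homogeneous functions over the unit ball -/

section Polar

/-! The heart of the matter is that the vanishing of the modified operator near `Γ` forbids a jump
of `∇u`. Both conclusions follow from this.

Fix `x ∈ Γ` with normal `ν`. Continuity of `u` makes the gradient jump rank one: it is `a ⊗ ν`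
(`IsGlued.fderiv_jump`). Rescaling by `δ` around `x` turns `δ ℒ^δ_* u(x + δp)` into the fixed
operator `unitStar` applied to difference quotients of `u` (`opStar_scale`). By dominated
convergence the limit is `unitStar` at `p` of a piecewise linear map `kinked A a ν`, with moduli
that jump across the plane orthogonal to `ν` (`IsGlued.opStar_tendsto`). The hypothesis therefore
gives zero at every `p = sν` with `|s| < 1`.

Now compare the values at `s`, `-s` and `0` through a centred second difference divided by `s`.
Nearly all the terms are integrals of a function of the normal coordinate against a kernel. They
contribute nothing in the limit, either because the function has no jump, or because the kernel,
symmetrised by the half-turn about `ν`, vanishes on the plane of the jump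
(`slabInt_secondDiff_posPart`, `slabInt_secondDiff_niceJump`). The exception comes from the value of
the kink at the evaluation point, `max s 0 • a`, which has a corner at `s = 0`. What survives is `∫
μ(w) ‖w‖⁻⁴ ⟪w, a⟫ w dw = 0`, and since `μ` is positive this forces `a = 0`
(`eq_zero_of_unitStar_kinked_eq_zero`).

With `a = 0`, the blow-up limit at `p = 0` is `unitStar` of a linear map, and half-ball moments
evaluate it to `45/32` times the traction jump (`unitStar_linear`). The same limit is zero by
hypothesis, so the traction does not jump.

For the `Lᵖ` statement, `a = 0` makes `∇u` locally Lipschitz across `Γ`. Off `Γ_δ` the moduli are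
constant on the `δ`-ball and `ℒ^δ` annihilates affine maps there, so it acts on a second-order
Taylor remainder that is uniformly Lipschitz (`opL_eq_unitL`, `lipOn_taylorRem`). This bounds `ℒ^δ
u` uniformly, and its pointwise limit is `𝒩u` by the exact value on quadratic maps
(`unitL_quadratic`). On `Γ_δ` the operator is zero by hypothesis, `Γ` is a null set
(`IsTwoPhaseComposite.volume_interface`), and dominated convergence on the finite-volume domain
concludes. -/

lemma integral_homogeneous_mul_radial (f : E3 → ℝ) (d : ℕ)
    (hf : ∀ (r : ℝ) (w : E3), 0 < r → f (r • w) = r ^ d * f w) (g : ℝ → ℝ) :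
    ∫ w, f w * g ‖w‖ = (∫ θ : sphere (0 : E3) 1, f θ ∂(volume : Measure E3).toSphere) *
      ∫ r in Ioi (0 : ℝ), r ^ (d + 2) * g r := by
  have h := (volume : Measure E3).measurePreserving_homeomorphUnitSphereProd.integral_comp
    (Homeomorph.measurableEmbedding _)
    (g := fun p : sphere (0 : E3) 1 × Ioi (0 : ℝ) => f p.1 * ((p.2 : ℝ) ^ d * g p.2))
  have hl : ∀ w : ({0}ᶜ : Set E3), (fun p : sphere (0 : E3) 1 × Ioi (0 : ℝ) =>
      f p.1 * ((p.2 : ℝ) ^ d * g p.2)) (homeomorphUnitSphereProd E3 w) = f w * g ‖(w : E3)‖ := by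
    intro w
    have hw : 0 < ‖(w : E3)‖ := norm_pos_iff.2 w.2
    have := hf ‖(w : E3)‖ ((homeomorphUnitSphereProd E3 w).1) hw
    simp only [homeomorphUnitSphereProd_apply_snd_coe, homeomorphUnitSphereProd_apply_fst_coe] at this ⊢
    rw [smul_smul, mul_inv_cancel₀ hw.ne', one_smul] at this
    rw [this]; ring
  simp only [hl] at h
  rw [integral_subtype_comap (measurableSet_singleton _).compl (fun w : E3 => f w * g ‖w‖),
    restrict_compl_singleton] at h
  rw [h, integral_prod_mul (fun θ : sphere (0 : E3) 1 => f θ)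
    (fun r : Ioi (0 : ℝ) => (r : ℝ) ^ d * g r)]
  congr 1
  have hfr : Module.finrank ℝ E3 - 1 = 2 := by simp
  rw [Measure.volumeIoiPow, integral_withDensity_eq_integral_toReal_smul
    (by fun_prop) (by simp), hfr, ← integral_subtype_comap measurableSet_Ioi]
  refine integral_congr_ae (.of_forall fun r => ?_)
  have : (0 : ℝ) ≤ (r : ℝ) ^ 2 := by positivity
  simp only [ENNReal.toReal_ofReal this, smul_eq_mul]; ring

lemma integral_gauss_radial (d : ℕ) :
    ∫ r in Ioi (0 : ℝ), r ^ d * Real.exp (-r ^ 2) = 1 / 2 * Real.Gamma ((d + 1) / 2) := by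
  have := integral_rpow_mul_exp_neg_rpow (p := 2) (q := d) (by norm_num)
    (by have : (0 : ℝ) ≤ d := by positivity
        linarith)
  simpa using this

lemma integral_ball_radial (d k : ℕ) (h : k < d + 1) :
    ∫ r in Ioi (0 : ℝ), r ^ d * (Iio (1 : ℝ)).indicator (fun r => (r ^ k)⁻¹) r
      = 1 / (d + 1 - k : ℝ) := by
  have h1 : ∀ r ∈ Ioi (0 : ℝ), r ^ d * (Iio (1 : ℝ)).indicator (fun r => (r ^ k)⁻¹) r
      = (Iio (1 : ℝ)).indicator (fun r => r ^ (d - k : ℝ)) r := by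
    intro r hr
    by_cases h1 : r ∈ Iio (1 : ℝ)
    · simp only [h1, indicator_of_mem]
      rw [Real.rpow_sub hr, Real.rpow_natCast, Real.rpow_natCast]; rfl
    · simp [h1]
  rw [setIntegral_congr_fun measurableSet_Ioi h1, setIntegral_indicator measurableSet_Iio,
    Ioi_inter_Iio, ← integral_Ioc_eq_integral_Ioo, ← intervalIntegral.integral_of_le zero_le_one,
    integral_rpow]
  · have : (d - k + 1 : ℝ) ≠ 0 := by
      have : (k : ℝ) < d + 1 := by exact_mod_cast h
      linarith
    rw [Real.zero_rpow this, Real.one_rpow]; ring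
  · left
    have : (k : ℝ) < d + 1 := by exact_mod_cast h
    linarith

/-- Both sides are the same spherical integral times a radial one, namely `1/(d+3-k)` against
`Γ((d+3)/2)/2`. Trading the ball for a Gaussian pays off because Gaussian moments of monomials
factor into integrals on the line. -/
lemma setIntegral_ball_homogeneous (f : E3 → ℝ) (d k : ℕ) (hk : k < d + 3)
    (hf : ∀ (r : ℝ) (w : E3), 0 < r → f (r • w) = r ^ d * f w) :
    ∫ w in ball (0 : E3) 1, f w / ‖w‖ ^ k =
      2 / ((d + 3 - k : ℝ) * Real.Gamma ((d + 3) / 2)) * ∫ w, f w * Real.exp (-‖w‖ ^ 2) := by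
  have h1 := integral_homogeneous_mul_radial f d hf (fun r => Real.exp (-r ^ 2))
  have h2 := integral_homogeneous_mul_radial f d hf ((Iio (1 : ℝ)).indicator (fun r => (r ^ k)⁻¹))
  rw [integral_gauss_radial] at h1
  rw [integral_ball_radial _ _ (by omega)] at h2
  have h3 : ∀ w : E3, f w * (Iio (1 : ℝ)).indicator (fun r => (r ^ k)⁻¹) ‖w‖ =
      (ball (0 : E3) 1).indicator (fun w => f w / ‖w‖ ^ k) w := by
    intro w
    by_cases hw : ‖w‖ < 1 <;> simp [hw, div_eq_mul_inv]
  simp only [h3] at h2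
  rw [integral_indicator measurableSet_ball] at h2
  rw [h1, h2]
  have hG : 0 < Real.Gamma (((d + 2 : ℕ) + 1 : ℝ) / 2) := Real.Gamma_pos_of_pos (by positivity)
  have e1 : (((d + 2 : ℕ) : ℝ) + 1) / 2 = (d + 3) / 2 := by push_cast; ring
  rw [e1] at hG ⊢
  have e2 : (((d + 2 : ℕ) : ℝ) + 1 - k) = (d + 3 - k) := by push_cast; ring
  rw [e2]
  have e3 : (d + 3 - k : ℝ) ≠ 0 := by
    have : (k : ℝ) < d + 3 := by exact_mod_cast hk
    linarith
  field_simp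

end Polar

/-- The two-valued function equal to `p` on positive and to `q` on nonpositive numbers. -/
noncomputable def step (p q : ℝ) (t : ℝ) : ℝ := if 0 < t then p else q

@[simp] lemma step_self (p t : ℝ) : step p p t = p := by simp [step]

lemma measurable_step (p q : ℝ) : Measurable (step p q) :=
  Measurable.ite measurableSet_Ioi measurable_const measurable_const

lemma abs_step_le (p q t : ℝ) : |step p q t| ≤ |p| + |q| := by
  unfold step; split_ifs <;> linarith [abs_nonneg p, abs_nonneg q]

lemma step_mul_pos (p q : ℝ) {r : ℝ} (hr : 0 < r) (t : ℝ) : step p q (r * t) = step p q t := by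
  simp [step, hr]

lemma integrable_pow_mul_gauss (a : ℕ) : Integrable fun t : ℝ => t ^ a * Real.exp (-t ^ 2) := by
  simpa using integrable_rpow_mul_exp_neg_mul_sq (b := 1) one_pos (s := a)
    (by have : (0 : ℝ) ≤ a := by positivity
        linarith)

lemma integral_step_mul_gauss (p q : ℝ) (a : ℕ) :
    ∫ t, step p q t * (t ^ a * Real.exp (-t ^ 2)) =
      (p + (-1) ^ a * q) * (1 / 2 * Real.Gamma ((a + 1) / 2)) := by
  have hi : Integrable fun t : ℝ => step p q t * (t ^ a * Real.exp (-t ^ 2)) :=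
    (integrable_pow_mul_gauss a).bdd_mul (measurable_step p q).aestronglyMeasurable
      (.of_forall fun t => abs_step_le p q t)
  rw [← integral_gauss_radial, ← intervalIntegral.integral_Iic_add_Ioi hi.integrableOn
    hi.integrableOn (b := 0)]
  have e1 : ∫ t in Ioi (0 : ℝ), step p q t * (t ^ a * Real.exp (-t ^ 2)) =
      p * ∫ t in Ioi (0 : ℝ), t ^ a * Real.exp (-t ^ 2) := by
    rw [← integral_const_mul]
    refine setIntegral_congr_fun measurableSet_Ioi fun t ht => ?_
    simp only [step, mem_Ioi.1 ht, if_true]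
  have e2 : ∫ t in Iic (0 : ℝ), step p q t * (t ^ a * Real.exp (-t ^ 2)) =
      (-1) ^ a * q * ∫ t in Ioi (0 : ℝ), t ^ a * Real.exp (-t ^ 2) := by
    rw [← integral_const_mul, ← neg_zero, ← integral_comp_neg_Ioi, neg_zero]
    refine setIntegral_congr_fun measurableSet_Ioi fun t ht => ?_
    have : ¬ t < 0 := not_lt.2 (le_of_lt ht)
    simp only [step, Left.neg_pos_iff, this, if_false]
    rw [neg_sq, neg_pow t a]; ring
  rw [e1, e2]; ring

/-- The Gaussian moment of order `a` on the line, weighted by `step p q`. -/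
noncomputable def gaussMoment (p q : ℝ) (a : ℕ) : ℝ :=
  (p + (-1) ^ a * q) * (1 / 2 * Real.Gamma ((a + 1) / 2))

lemma integral_gauss_moment (p q : ℝ) (a : Fin 3 → ℕ) :
    ∫ w : E3, (step p q (w 2) * ∏ m, w m ^ a m) * Real.exp (-‖w‖ ^ 2) =
      gaussMoment 1 1 (a 0) * gaussMoment 1 1 (a 1) * gaussMoment p q (a 2) := by
  rw [← (PiLp.volume_preserving_toLp (Fin 3)).integral_comp
    (MeasurableEquiv.toLp 2 _).measurableEmbedding]
  have h := integral_fintype_prod_volume_eq_prod (ι := Fin 3) (E := fun _ => ℝ)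
    (f := ![fun t => step 1 1 t * (t ^ a 0 * Real.exp (-t ^ 2)),
      fun t => step 1 1 t * (t ^ a 1 * Real.exp (-t ^ 2)),
      fun t => step p q t * (t ^ a 2 * Real.exp (-t ^ 2))])
  simp only [Fin.prod_univ_three, Matrix.cons_val_zero, Matrix.cons_val_one, Matrix.cons_val] at h
  rw [integral_step_mul_gauss, integral_step_mul_gauss, integral_step_mul_gauss] at h
  simp only [Fin.prod_univ_three]
  refine Eq.trans (integral_congr_ae (.of_forall fun x => ?_)) h
  simp only [step_self, EuclideanSpace.norm_sq_eq, Fin.sum_univ_three, Real.norm_eq_abs, sq_abs,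
    neg_add, Real.exp_add]
  ring

/-- Moments of the unit ball, with a weight that is constant on the two half balls. -/
lemma setIntegral_ball_moment (p q : ℝ) (a : Fin 3 → ℕ) (k : ℕ) (hk : k < (∑ m, a m) + 3) :
    ∫ w in ball (0 : E3) 1, (step p q (w 2) * ∏ m, w m ^ a m) / ‖w‖ ^ k =
      2 / (((∑ m, a m : ℕ) + 3 - k : ℝ) * Real.Gamma (((∑ m, a m : ℕ) + 3) / 2)) *
      (gaussMoment 1 1 (a 0) * gaussMoment 1 1 (a 1) * gaussMoment p q (a 2)) := by
  rw [setIntegral_ball_homogeneous _ (∑ m, a m) k hk, integral_gauss_moment]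
  intro r w hr
  simp only [PiLp.smul_apply, smul_eq_mul, step_mul_pos p q hr, mul_pow, Finset.prod_mul_distrib,
    Finset.prod_pow_eq_pow_sum]
  ring

lemma ballVol_one : ballVol 1 = 4 * Real.pi / 3 := by
  simp [ballVol, Measure.real, EuclideanSpace.volume_ball_fin_three,
    ENNReal.toReal_ofReal (by positivity : (0 : ℝ) ≤ Real.pi * 4 / 3)]
  ring

lemma ballVol_pos {δ : ℝ} (hδ : 0 < δ) : 0 < ballVol δ :=
  ENNReal.toReal_pos (measure_ball_pos _ _ hδ).ne' measure_ball_lt_top.ne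

lemma ballVol_eq {δ : ℝ} (hδ : 0 < δ) : ballVol δ = δ ^ 3 * ballVol 1 := by
  simp [ballVol, Measure.real, Measure.addHaar_ball_of_pos (volume : Measure E3) _ hδ,
    ENNReal.toReal_ofReal (pow_nonneg hδ.le 3)]

/-- The factor `r²` of polar coordinates in dimension three cancels the singularity. This function
is the common majorant in the dominated-convergence arguments at unit scale. -/
lemma integrableOn_ball_inv_sq : IntegrableOn (fun w : E3 => (‖w‖ ^ 2)⁻¹) (ball 0 1) := by
  rw [integrableOn_fun_norm_addHaar volume (f := fun r => (r ^ 2)⁻¹)]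
  have : IntegrableOn (fun _ : ℝ => (1 : ℝ)) (Ioo 0 1) := by simp
  refine this.congr_fun (fun r hr => ?_) measurableSet_Ioo
  have : r ≠ 0 := hr.1.ne'
  simp [this]

section bounded_kernels
variable {F : Type*} [NormedAddCommGroup F]

lemma integrableOn_ball_of_le_inv_sq {f : E3 → F}
    (hf : AEStronglyMeasurable f (volume.restrict (ball 0 1))) {C : ℝ}
    (h : ∀ w ∈ ball (0 : E3) 1, ‖f w‖ ≤ C * (‖w‖ ^ 2)⁻¹) : IntegrableOn f (ball 0 1) :=
  (integrableOn_ball_inv_sq.const_mul C).mono' hf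
    ((ae_restrict_iff' measurableSet_ball).2 (.of_forall h))

lemma inv_norm_le_inv_sq {w : E3} (hw : w ∈ ball (0 : E3) 1) : ‖w‖⁻¹ ≤ (‖w‖ ^ 2)⁻¹ := by
  rcases eq_or_ne w 0 with rfl | h0
  · simp
  · have h1 : 0 < ‖w‖ := norm_pos_iff.2 h0
    have h2 : ‖w‖ < 1 := by simpa using hw
    gcongr
    nlinarith

lemma one_le_inv_sq {w : E3} (hw : w ∈ ball (0 : E3) 1) (h0 : w ≠ 0) : 1 ≤ (‖w‖ ^ 2)⁻¹ := by
  have h1 : 0 < ‖w‖ := norm_pos_iff.2 h0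
  have h2 : ‖w‖ < 1 := by simpa using hw
  exact (one_le_inv₀ (by positivity)).2 (by nlinarith)

end bounded_kernels

lemma setIntegral_ball_comp_isometry {F : Type*} [NormedAddCommGroup F] [NormedSpace ℝ F]
    (e : E3 ≃ₗᵢ[ℝ] E3) (f : E3 → F) (r : ℝ) :
    ∫ w in ball (0 : E3) r, f (e w) = ∫ w in ball (0 : E3) r, f w := by
  rw [← (e.measurePreserving).setIntegral_preimage_emb e.toHomeomorph.measurableEmbedding f]
  congr 2
  ext w; simp

lemma setIntegral_ball_comp_neg {F : Type*} [NormedAddCommGroup F] [NormedSpace ℝ F]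
    (f : E3 → F) (r : ℝ) :
    ∫ w in ball (0 : E3) r, f (-w) = ∫ w in ball (0 : E3) r, f w :=
  setIntegral_ball_comp_isometry (LinearIsometryEquiv.neg ℝ) f r

lemma setIntegral_ball_odd {F : Type*} [NormedAddCommGroup F] [NormedSpace ℝ F]
    (f : E3 → F) (hf : ∀ w, f (-w) = -f w) (r : ℝ) : ∫ w in ball (0 : E3) r, f w = 0 := by
  have h := setIntegral_ball_comp_neg f r
  simp only [hf, integral_neg] at h
  have h2 : (2 : ℝ) • ∫ w in ball (0 : E3) r, f w = 0 := by
    rw [two_smul]; nth_rewrite 1 [← h]; exact neg_add_cancel _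
  exact (smul_eq_zero.1 h2).resolve_left two_ne_zero

/-! ### Explicit ball and half-ball moments in an orthonormal frame -/

section basis
variable (b : OrthonormalBasis (Fin 3) ℝ E3)

lemma setIntegral_ball_basis_moment (p q : ℝ) (a : Fin 3 → ℕ) (k : ℕ) (hk : k < (∑ m, a m) + 3) :
    ∫ w in ball (0 : E3) 1, (step p q (inner ℝ (b 2) w) * ∏ m, inner ℝ (b m) w ^ a m) / ‖w‖ ^ k =
      2 / (((∑ m, a m : ℕ) + 3 - k : ℝ) * Real.Gamma (((∑ m, a m : ℕ) + 3) / 2)) *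
      (gaussMoment 1 1 (a 0) * gaussMoment 1 1 (a 1) * gaussMoment p q (a 2)) := by
  rw [← setIntegral_ball_moment p q a k hk, ← setIntegral_ball_comp_isometry b.repr
    (fun w => (step p q (w 2) * ∏ m, w m ^ a m) / ‖w‖ ^ k)]
  simp [OrthonormalBasis.repr_apply_apply]

lemma Gamma_three_half : Real.Gamma (3 / 2) = Real.sqrt Real.pi / 2 := by
  rw [show (3 / 2 : ℝ) = 1 / 2 + 1 by norm_num, Real.Gamma_add_one (by norm_num),
    Real.Gamma_one_half_eq]; ring

lemma Gamma_five_half : Real.Gamma (5 / 2) = 3 * Real.sqrt Real.pi / 4 := by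
  rw [show (5 / 2 : ℝ) = 3 / 2 + 1 by norm_num, Real.Gamma_add_one (by norm_num),
    Gamma_three_half]; ring

lemma Gamma_seven_half : Real.Gamma (7 / 2) = 15 * Real.sqrt Real.pi / 8 := by
  rw [show (7 / 2 : ℝ) = 5 / 2 + 1 by norm_num, Real.Gamma_add_one (by norm_num),
    Gamma_five_half]; ring

lemma Gamma_three : Real.Gamma 3 = 2 := by
  rw [show (3 : ℝ) = 2 + 1 by norm_num, Real.Gamma_add_one two_ne_zero, Real.Gamma_two, mul_one]

lemma gaussMoment_zero (p q : ℝ) : gaussMoment p q 0 = (p + q) * Real.sqrt Real.pi / 2 := by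
  norm_num [gaussMoment, Real.Gamma_one_half_eq]; ring

lemma gaussMoment_one (p q : ℝ) : gaussMoment p q 1 = (p - q) / 2 := by
  norm_num [gaussMoment]; ring

lemma gaussMoment_two (p q : ℝ) : gaussMoment p q 2 = (p + q) * Real.sqrt Real.pi / 4 := by
  norm_num [gaussMoment, Gamma_three_half]; ring

lemma gaussMoment_three (p q : ℝ) : gaussMoment p q 3 = (p - q) / 2 := by
  norm_num [gaussMoment]; ring

lemma gaussMoment_four (p q : ℝ) : gaussMoment p q 4 = 3 * (p + q) * Real.sqrt Real.pi / 8 := by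
  norm_num [gaussMoment, Gamma_five_half]; ring

lemma prod_pow_single (i : Fin 3) (f : Fin 3 → ℝ) :
    ∏ m, f m ^ (Pi.single i 1 : Fin 3 → ℕ) m = f i := by
  simp [Pi.single_apply, Finset.prod_ite_eq']

lemma fin_three_cases (i : Fin 3) : i = 0 ∨ i = 1 ∨ i = 2 := by fin_cases i <;> simp

lemma setIntegral_ball_quadratic (i j : Fin 3) :
    ∫ w in ball (0 : E3) 1, (inner ℝ (b i) w * inner ℝ (b j) w) / ‖w‖ ^ 2 =
      ballVol 1 / 3 * (if i = j then 1 else 0) := by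
  have h := setIntegral_ball_basis_moment b 1 1 (Pi.single i 1 + Pi.single j 1) 2
    (by simp [Finset.sum_add_distrib])
  have hs : (∑ m, (Pi.single i 1 + Pi.single j 1 : Fin 3 → ℕ) m) = 2 := by
    simp [Finset.sum_add_distrib]
  have hπ : 0 < Real.sqrt Real.pi := Real.sqrt_pos.2 Real.pi_pos
  have hπ2 : Real.sqrt Real.pi ^ 2 = Real.pi := Real.sq_sqrt Real.pi_pos.le
  rw [hs] at h
  simp only [step_self, Pi.add_apply, pow_add, Finset.prod_mul_distrib, prod_pow_single,
    one_mul] at h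
  rw [h, ballVol_one, show ((2 : ℕ) + 3 : ℝ) / 2 = 5 / 2 by norm_num, Gamma_five_half, ← hπ2]
  obtain rfl | rfl | rfl := fin_three_cases i <;> obtain rfl | rfl | rfl := fin_three_cases j <;>
    simp [gaussMoment_zero, gaussMoment_one, gaussMoment_two] <;>
    field_simp <;> norm_num

lemma setIntegral_halfBall_linear (p q : ℝ) (i : Fin 3) :
    ∫ w in ball (0 : E3) 1, (step p q (inner ℝ (b 2) w) * inner ℝ (b i) w) / ‖w‖ ^ 2 =
      (p - q) * (Real.pi / 2) * (if i = 2 then 1 else 0) := by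
  have h := setIntegral_ball_basis_moment b p q (Pi.single i 1) 2 (by simp)
  have hs : (∑ m, (Pi.single i 1 : Fin 3 → ℕ) m) = 1 := by simp
  have hπ2 : Real.sqrt Real.pi ^ 2 = Real.pi := Real.sq_sqrt Real.pi_pos.le
  rw [hs] at h
  simp only [prod_pow_single] at h
  rw [h, show ((1 : ℕ) + 3 : ℝ) / 2 = 2 by norm_num, Real.Gamma_two, ← hπ2]
  obtain rfl | rfl | rfl := fin_three_cases i
  · simp [gaussMoment_one]
  · simp [gaussMoment_one]
  · simp [gaussMoment_zero, gaussMoment_one]; ring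

/-- Only triples in which the normal index `2` occurs an odd number of times survive. The three
Kronecker terms count `3` for the triple `(2,2,2)`, whose moment is only twice that of `(2,j,j)`
with `j ≠ 2`; the subtracted term makes up the difference. -/
lemma setIntegral_halfBall_cubic (p q : ℝ) (i j k : Fin 3) :
    ∫ w in ball (0 : E3) 1, (step p q (inner ℝ (b 2) w) *
        (inner ℝ (b i) w * inner ℝ (b j) w * inner ℝ (b k) w)) / ‖w‖ ^ 4 =
      (p - q) * (Real.pi / 8) * ((if i = 2 then if j = k then 1 else 0 else 0)
        + (if j = 2 then if i = k then 1 else 0 else 0) + (if k = 2 then if i = j then 1 else 0 else 0)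
        - (if i = 2 then if j = 2 then if k = 2 then 1 else 0 else 0 else 0)) := by
  have h := setIntegral_ball_basis_moment b p q (Pi.single i 1 + Pi.single j 1 + Pi.single k 1) 4
    (by simp [Finset.sum_add_distrib])
  have hs : (∑ m, (Pi.single i 1 + Pi.single j 1 + Pi.single k 1 : Fin 3 → ℕ) m) = 3 := by
    simp [Finset.sum_add_distrib]
  have hπ2 : Real.sqrt Real.pi ^ 2 = Real.pi := Real.sq_sqrt Real.pi_pos.le
  rw [hs] at h
  simp only [Pi.add_apply, pow_add, Finset.prod_mul_distrib, prod_pow_single] at h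
  rw [h, show ((3 : ℕ) + 3 : ℝ) / 2 = 3 by norm_num, Gamma_three, ← hπ2]
  obtain rfl | rfl | rfl := fin_three_cases i <;> obtain rfl | rfl | rfl := fin_three_cases j <;>
    obtain rfl | rfl | rfl := fin_three_cases k <;>
    simp [gaussMoment_zero, gaussMoment_one, gaussMoment_two,
      gaussMoment_three] <;> ring

lemma setIntegral_ball_quartic (i j k l : Fin 3) :
    ∫ w in ball (0 : E3) 1, (inner ℝ (b i) w * inner ℝ (b j) w * inner ℝ (b k) w *
        inner ℝ (b l) w) / ‖w‖ ^ 4 =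
      ballVol 1 / 15 * ((if i = j then if k = l then 1 else 0 else 0)
        + (if i = k then if j = l then 1 else 0 else 0)
        + (if i = l then if j = k then 1 else 0 else 0)) := by
  have h := setIntegral_ball_basis_moment b 1 1
    (Pi.single i 1 + Pi.single j 1 + Pi.single k 1 + Pi.single l 1) 4
    (by simp [Finset.sum_add_distrib])
  have hs : (∑ m, (Pi.single i 1 + Pi.single j 1 + Pi.single k 1 + Pi.single l 1 :
      Fin 3 → ℕ) m) = 4 := by
    simp [Finset.sum_add_distrib]
  have hπ : 0 < Real.sqrt Real.pi := Real.sqrt_pos.2 Real.pi_pos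
  have hπ2 : Real.sqrt Real.pi ^ 2 = Real.pi := Real.sq_sqrt Real.pi_pos.le
  have hπ3 : ballVol 1 = 4 * Real.sqrt Real.pi ^ 2 / 3 := by rw [hπ2, ballVol_one]
  rw [hs] at h
  simp only [Pi.add_apply, pow_add, Finset.prod_mul_distrib, step_self, one_mul,
    prod_pow_single] at h
  rw [h, hπ3, show ((4 : ℕ) + 3 : ℝ) / 2 = 7 / 2 by norm_num, Gamma_seven_half]
  clear h hs hπ3
  set r := Real.sqrt Real.pi with hr
  have h0 := gaussMoment_zero 1 1
  have h1 := gaussMoment_one 1 1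
  have h2 := gaussMoment_two 1 1
  have h3 := gaussMoment_three 1 1
  have h4 := gaussMoment_four 1 1
  rw [← hr] at h0 h2 h4
  -- From here only the five values `h0` to `h4` matter; the 81 index cases need nothing else about
  -- the moments.
  generalize gaussMoment 1 1 = g at *
  obtain rfl | rfl | rfl := fin_three_cases i <;> obtain rfl | rfl | rfl := fin_three_cases j <;>
    obtain rfl | rfl | rfl := fin_three_cases k <;> obtain rfl | rfl | rfl := fin_three_cases l <;>
    simp [h0, h1, h2, h3, h4] <;>
    field_simp <;> norm_num

end basis

lemma integrableOn_inv_pow_smul {F : Type*} [NormedAddCommGroup F] [NormedSpace ℝ F] {f : E3 → F}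
    (hf : AEStronglyMeasurable f (volume.restrict (ball 0 1))) {C : ℝ} (d : ℕ) {k : ℕ}
    (hk : k ≤ d + 2) (h : ∀ w ∈ ball (0 : E3) 1, ‖f w‖ ≤ C * ‖w‖ ^ d) :
    IntegrableOn (fun w => (‖w‖ ^ k)⁻¹ • f w) (ball 0 1) := by
  have hm : Measurable fun w : E3 => (‖w‖ ^ k)⁻¹ := by fun_prop
  have := integrableOn_ball_inv_sq.const_mul |C|
  refine this.mono' (hm.aestronglyMeasurable.smul hf) ?_
  filter_upwards [ae_restrict_mem measurableSet_ball,
    ae_restrict_of_ae (Measure.ae_ne volume (0 : E3))] with w hw h0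
  have h1 : 0 < ‖w‖ := norm_pos_iff.2 h0
  have h2 : ‖w‖ ≤ 1 := by simpa using (mem_ball_zero_iff.1 hw).le
  rw [norm_smul, norm_inv, norm_pow, norm_norm]
  calc (‖w‖ ^ k)⁻¹ * ‖f w‖ ≤ (‖w‖ ^ k)⁻¹ * (|C| * ‖w‖ ^ d) := by
        gcongr; exact (h w hw).trans (by gcongr; exact le_abs_self C)
    _ ≤ (‖w‖ ^ (d + 2))⁻¹ * (|C| * ‖w‖ ^ d) := by
        have := pow_le_pow_of_le_one h1.le h2 hk
        gcongr
    _ = |C| * (‖w‖ ^ 2)⁻¹ := by rw [pow_add]; field_simp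

/-- The trace as a continuous linear functional on endomorphisms of `E3`. -/
noncomputable def traceCLM : (E3 →L[ℝ] E3) →L[ℝ] ℝ :=
  LinearMap.toContinuousLinearMap (LinearMap.trace ℝ E3 ∘ₗ ContinuousLinearMap.coeLM ℝ)

lemma traceCLM_apply (b : OrthonormalBasis (Fin 3) ℝ E3) (A : E3 →L[ℝ] E3) :
    traceCLM A = ∑ i, inner ℝ (b i) (A (b i)) := by
  simpa [traceCLM] using LinearMap.trace_eq_sum_inner (A : E3 →ₗ[ℝ] E3) b

lemma traceCLM_smulRight (v x : E3) : traceCLM ((innerSL ℝ v).smulRight x) = inner ℝ v x := by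
  rw [traceCLM_apply (EuclideanSpace.basisFun (Fin 3) ℝ)]
  simp only [ContinuousLinearMap.smulRight_apply, innerSL_apply_apply, inner_smul_right]
  rw [← OrthonormalBasis.sum_inner_mul_inner (EuclideanSpace.basisFun (Fin 3) ℝ) v x]

lemma exists_basis_of_unit (n : E3) (hn : ‖n‖ = 1) :
    ∃ b : OrthonormalBasis (Fin 3) ℝ E3, b 2 = n := by
  have hv : Orthonormal ℝ (({2} : Set (Fin 3)).domRestrict fun _ => n) := by
    constructor
    · intro i; exact hn
    · intro i j hij; exact absurd (Subsingleton.elim i j) hij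
  obtain ⟨b, hb⟩ := hv.exists_orthonormalBasis_extension_of_card_eq (by simp)
  exact ⟨b, hb 2 (by simp)⟩

/-! ### Vector and tensor moments -/

section vector_moments

lemma inner_expand (b : OrthonormalBasis (Fin 3) ℝ E3) (A : E3 →L[ℝ] E3) (w : E3) :
    inner ℝ w (A w) = ∑ j, ∑ k, inner ℝ (b j) w * inner ℝ (b k) w * inner ℝ (b j) (A (b k)) := by
  have h : A w = ∑ k, inner ℝ (b k) w • A (b k) := by
    conv_lhs => rw [← b.sum_repr' w]
    simp
  rw [← b.sum_inner_mul_inner w (A w)]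
  refine Finset.sum_congr rfl fun j _ => ?_
  rw [h, inner_sum, Finset.mul_sum]
  refine Finset.sum_congr rfl fun k _ => ?_
  rw [inner_smul_right, real_inner_comm]; ring

lemma ext_inner_basis (b : OrthonormalBasis (Fin 3) ℝ E3) {x y : E3}
    (h : ∀ i, inner ℝ (b i) x = inner ℝ (b i) y) : x = y := by
  rw [← b.sum_repr' x, ← b.sum_repr' y]; simp only [h]

lemma abs_inner_basis_le (b : OrthonormalBasis (Fin 3) ℝ E3) (i : Fin 3) (w : E3) :
    |inner ℝ (b i) w| ≤ ‖w‖ := by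
  simpa using abs_real_inner_le_norm (b i) w

lemma setIntegral_inv_sq_inner_smul (e : E3) :
    ∫ w in ball (0 : E3) 1, (‖w‖ ^ 2)⁻¹ • (inner ℝ e w) • w = (ballVol 1 / 3) • e := by
  set b := EuclideanSpace.basisFun (Fin 3) ℝ
  refine ext_inner_basis b fun i => ?_
  have hi : IntegrableOn (fun w : E3 => (‖w‖ ^ 2)⁻¹ • (inner ℝ e w) • w) (ball 0 1) :=
    integrableOn_inv_pow_smul (by fun_prop) (C := ‖e‖) 2 (by norm_num) fun w _ => by
      rw [norm_smul]; nlinarith [norm_inner_le_norm (𝕜 := ℝ) e w, norm_nonneg w]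
  rw [← integral_inner hi]
  have : ∀ w : E3, inner ℝ (b i) ((‖w‖ ^ 2)⁻¹ • (inner ℝ e w) • w) =
      ∑ j, inner ℝ e (b j) * ((inner ℝ (b i) w * inner ℝ (b j) w) / ‖w‖ ^ 2) := by
    intro w
    rw [inner_smul_right, inner_smul_right, ← b.sum_inner_mul_inner e w, Finset.sum_mul,
      Finset.mul_sum]
    exact Finset.sum_congr rfl fun j _ => by ring
  simp only [this]
  rw [integral_finsetSum]
  · simp only [integral_const_mul, setIntegral_ball_quadratic b]
    simp [inner_smul_right, real_inner_comm]; ring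
  · intro j _
    refine Integrable.const_mul ?_ _
    have := integrableOn_inv_pow_smul (f := fun w : E3 => inner ℝ (b i) w * inner ℝ (b j) w)
      (by fun_prop) (C := 1) 2 (k := 2) (by norm_num) fun w _ => by
      rw [norm_mul, one_mul, pow_two]
      exact mul_le_mul (abs_inner_basis_le b i w) (abs_inner_basis_le b j w) (norm_nonneg _)
        (norm_nonneg _)
    simpa [div_eq_inv_mul] using! this

lemma setIntegral_inv_sq_smulRight (A : E3 →L[ℝ] E3) :
    ∫ v in ball (0 : E3) 1, (‖v‖ ^ 2)⁻¹ • (innerSL ℝ v).smulRight (A v) = (ballVol 1 / 3) • A := by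
  have hi : IntegrableOn (fun v : E3 => (‖v‖ ^ 2)⁻¹ • (innerSL ℝ v).smulRight (A v)) (ball 0 1) :=
    integrableOn_inv_pow_smul (Continuous.aestronglyMeasurable (by fun_prop)) (C := ‖A‖) 2
      (by norm_num) fun w _ => by
      rw [ContinuousLinearMap.norm_smulRight_apply, innerSL_apply_norm]
      nlinarith [A.le_opNorm w, norm_nonneg w]
  ext1 e
  rw [ContinuousLinearMap.integral_apply hi]
  have h := congrArg A (setIntegral_inv_sq_inner_smul e)
  rw [← ContinuousLinearMap.integral_comp_comm] at h
  · simpa [real_inner_comm] using h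
  · exact integrableOn_inv_pow_smul (by fun_prop) (C := ‖e‖) 2 (by norm_num) fun w _ => by
      rw [norm_smul]; nlinarith [norm_inner_le_norm (𝕜 := ℝ) e w, norm_nonneg w]

lemma measurable_step_inner (p q : ℝ) (n : E3) : Measurable fun w : E3 => step p q (inner ℝ n w) :=
  (measurable_step p q).comp (by fun_prop)

lemma setIntegral_step_inv_sq_smul (p q : ℝ) (n : E3) (hn : ‖n‖ = 1) :
    ∫ w in ball (0 : E3) 1, (‖w‖ ^ 2)⁻¹ • step p q (inner ℝ n w) • w =
      ((p - q) * (Real.pi / 2)) • n := by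
  obtain ⟨b, rfl⟩ := exists_basis_of_unit n hn
  refine ext_inner_basis b fun i => ?_
  have hi : IntegrableOn (fun w : E3 => (‖w‖ ^ 2)⁻¹ • step p q (inner ℝ (b 2) w) • w) (ball 0 1) :=
    integrableOn_inv_pow_smul (Measurable.aestronglyMeasurable
        (by have := measurable_step_inner p q (b 2); fun_prop))
      (C := |p| + |q|) 1 (by norm_num) fun w _ => by
      rw [norm_smul, pow_one]; gcongr; exact abs_step_le _ _ _
  rw [← integral_inner hi, inner_smul_right,
    orthonormal_iff_ite.1 b.orthonormal, ← setIntegral_halfBall_linear b p q i]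
  refine integral_congr_ae (.of_forall fun w => ?_)
  simp only [inner_smul_right]; ring

/-- The bond part of the traction. The unwanted purely normal term `inner ℝ n (A n) • n` stems from
the correction in the cubic half-ball moment; the full-gradient term of the modified operator
cancels it in `unitStar_linear`. -/
lemma setIntegral_step_quartic (p q : ℝ) (n : E3) (hn : ‖n‖ = 1) (A : E3 →L[ℝ] E3) :
    ∫ w in ball (0 : E3) 1, (‖w‖ ^ 4)⁻¹ • (step p q (inner ℝ n w) * inner ℝ w (A w)) • w =
      ((p - q) * (Real.pi / 8)) •
        (traceCLM A • n + A n + A.adjoint n - inner ℝ n (A n) • n) := by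
  obtain ⟨b, rfl⟩ := exists_basis_of_unit n hn
  refine ext_inner_basis b fun i => ?_
  have hi : IntegrableOn (fun w : E3 => (‖w‖ ^ 4)⁻¹ •
      (step p q (inner ℝ (b 2) w) * inner ℝ w (A w)) • w) (ball 0 1) :=
    integrableOn_inv_pow_smul (Measurable.aestronglyMeasurable
        (by have := measurable_step_inner p q (b 2); fun_prop))
      (C := (|p| + |q|) * ‖A‖) 3 (by norm_num) fun w _ => by
      rw [norm_smul, norm_mul]
      calc _ ≤ (|p| + |q|) * (‖w‖ * (‖A‖ * ‖w‖)) * ‖w‖ := by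
            gcongr
            · exact abs_step_le _ _ _
            · exact (norm_inner_le_norm _ _).trans (by gcongr; exact A.le_opNorm w)
        _ = _ := by ring
  rw [← integral_inner hi]
  have : ∀ w : E3, inner ℝ (b i) ((‖w‖ ^ 4)⁻¹ •
      (step p q (inner ℝ (b 2) w) * inner ℝ w (A w)) • w) =
      ∑ j, ∑ k, inner ℝ (b j) (A (b k)) * ((step p q (inner ℝ (b 2) w) *
        (inner ℝ (b i) w * inner ℝ (b j) w * inner ℝ (b k) w)) / ‖w‖ ^ 4) := by
    intro w
    rw [inner_smul_right, inner_smul_right, inner_expand b]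
    simp only [Finset.sum_mul, Finset.mul_sum]
    exact Finset.sum_congr rfl fun j _ => Finset.sum_congr rfl fun k _ => by ring
  have hint : ∀ j k, IntegrableOn (fun w => inner ℝ (b j) (A (b k)) *
      ((step p q (inner ℝ (b 2) w) * (inner ℝ (b i) w * inner ℝ (b j) w * inner ℝ (b k) w))
        / ‖w‖ ^ 4)) (ball 0 1) := by
    intro j k
    refine Integrable.const_mul ?_ _
    have := integrableOn_inv_pow_smul (f := fun w : E3 => step p q (inner ℝ (b 2) w) *
      (inner ℝ (b i) w * inner ℝ (b j) w * inner ℝ (b k) w))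
      ((measurable_step_inner p q _).mul (by fun_prop)).aestronglyMeasurable
      (C := |p| + |q|) 3 (k := 4) (by norm_num) fun w _ => by
      rw [norm_mul, norm_mul, norm_mul]
      calc _ ≤ (|p| + |q|) * (‖w‖ * ‖w‖ * ‖w‖) := by
            gcongr
            · exact abs_step_le _ _ _
            all_goals exact abs_inner_basis_le b _ w
        _ = _ := by ring
    simpa [div_eq_inv_mul] using! this
  simp only [this]
  rw [integral_finsetSum _ fun j _ => integrable_finsetSum _ fun k _ => hint j k]
  simp only [integral_finsetSum _ fun k _ => hint _ k, integral_const_mul,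
    setIntegral_halfBall_cubic b]
  rw [inner_smul_right, inner_sub_right, inner_add_right, inner_add_right, inner_smul_right,
    inner_smul_right, A.adjoint_inner_right, real_inner_comm (b 2) (A (b i)),
    orthonormal_iff_ite.1 b.orthonormal, traceCLM_apply b]
  obtain rfl | rfl | rfl := fin_three_cases i <;>
    simp [Fin.sum_univ_three] <;> ring

/-- The fourth moment is an isotropic tensor, a sum of three pairings of the indices. For `Q` a
second derivative they become one Laplacian and two copies of the gradient of the divergence. -/
lemma inner_setIntegral_quartic (b : OrthonormalBasis (Fin 3) ℝ E3) (Q : E3 →L[ℝ] E3 →L[ℝ] E3)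
    (i : Fin 3) :
    inner ℝ (b i) (∫ w in ball (0 : E3) 1, (‖w‖ ^ 4)⁻¹ • inner ℝ w (Q w w) • w) =
      ballVol 1 / 15 * ∑ j, (inner ℝ (b i) (Q (b j) (b j)) + inner ℝ (b j) (Q (b i) (b j))
        + inner ℝ (b j) (Q (b j) (b i))) := by
  have hi : IntegrableOn (fun w : E3 => (‖w‖ ^ 4)⁻¹ • inner ℝ w (Q w w) • w) (ball 0 1) :=
    integrableOn_inv_pow_smul (by fun_prop) (C := ‖Q‖) 4 (by norm_num) fun w _ => by
      rw [norm_smul]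
      calc _ ≤ (‖w‖ * (‖Q‖ * ‖w‖ * ‖w‖)) * ‖w‖ := by
            gcongr
            exact (norm_inner_le_norm _ _).trans (by gcongr; exact Q.le_opNorm₂ w w)
        _ = _ := by ring
  rw [← integral_inner hi]
  have : ∀ w : E3, inner ℝ (b i) ((‖w‖ ^ 4)⁻¹ • inner ℝ w (Q w w) • w) =
      ∑ l, ∑ j, ∑ k, inner ℝ (b j) (Q (b l) (b k)) *
        ((inner ℝ (b i) w * inner ℝ (b l) w * inner ℝ (b j) w * inner ℝ (b k) w) / ‖w‖ ^ 4) := by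
    intro w
    rw [inner_smul_right, inner_smul_right]
    have e : inner ℝ w (Q w w) = ∑ l, inner ℝ (b l) w * inner ℝ w (Q (b l) w) := by
      have hQ : Q w = ∑ l, inner ℝ (b l) w • Q (b l) := by
        conv_lhs => rw [← b.sum_repr' w]
        simp
      rw [hQ]
      simp [sum_apply, inner_sum, inner_smul_right]
    rw [e]
    simp only [inner_expand b (Q (b _)), Finset.sum_mul, Finset.mul_sum]
    exact Finset.sum_congr rfl fun j _ => Finset.sum_congr rfl fun k _ =>
      Finset.sum_congr rfl fun k _ => by ring
  have hint : ∀ l j k, IntegrableOn (fun w => inner ℝ (b j) (Q (b l) (b k)) *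
      ((inner ℝ (b i) w * inner ℝ (b l) w * inner ℝ (b j) w * inner ℝ (b k) w)
        / ‖w‖ ^ 4)) (ball 0 1) := by
    intro l j k
    refine Integrable.const_mul ?_ _
    have := integrableOn_inv_pow_smul (f := fun w : E3 =>
      inner ℝ (b i) w * inner ℝ (b l) w * inner ℝ (b j) w * inner ℝ (b k) w)
      (by fun_prop) (C := 1) 4 (k := 4) (by norm_num) fun w _ => by
      rw [norm_mul, norm_mul, norm_mul]
      calc _ ≤ ‖w‖ * ‖w‖ * ‖w‖ * ‖w‖ := by
            gcongr
            all_goals exact abs_inner_basis_le b _ w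
        _ = _ := by ring
    simpa [div_eq_inv_mul] using! this
  simp only [this]
  rw [integral_finsetSum _ fun l _ => integrable_finsetSum _ fun j _ =>
    integrable_finsetSum _ fun k _ => hint l j k]
  simp only [integral_finsetSum _ fun j _ => integrable_finsetSum _ fun k _ => hint _ j k,
    integral_finsetSum _ fun k _ => hint _ _ k, integral_const_mul, setIntegral_ball_quartic b]
  obtain rfl | rfl | rfl := fin_three_cases i <;>
    simp [Fin.sum_univ_three] <;> ring

end vector_moments

/-- The integral of `‖w‖⁻²` over the unit ball. -/
noncomputable def invSqMass : ℝ := ∫ w in ball (0 : E3) 1, (‖w‖ ^ 2)⁻¹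

lemma invSqMass_nonneg : 0 ≤ invSqMass := integral_nonneg fun _ => by positivity

/-! ### Domination and rescaling for integrals over balls -/

section ball_integrals
variable {F : Type*} [NormedAddCommGroup F] [NormedSpace ℝ F]

lemma norm_setIntegral_ball_le {g : E3 → F} {C : ℝ}
    (h : ∀ w ∈ ball (0 : E3) 1, w ≠ 0 → ‖g w‖ ≤ C * (‖w‖ ^ 2)⁻¹) :
    ‖∫ w in ball (0 : E3) 1, g w‖ ≤ C * invSqMass := by
  rw [invSqMass, ← integral_const_mul]
  refine norm_integral_le_of_norm_le (integrableOn_ball_inv_sq.const_mul C) ?_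
  filter_upwards [ae_restrict_mem measurableSet_ball,
    ae_restrict_of_ae (Measure.ae_ne volume (0 : E3))] with w hw h0 using h w hw h0

lemma tendsto_setIntegral_ball {l : Filter ℝ} [l.IsCountablyGenerated] {G : ℝ → E3 → F}
    {g : E3 → F} {C : ℝ}
    (hm : ∀ᶠ s in l, AEStronglyMeasurable (G s) (volume.restrict (ball 0 1)))
    (hb : ∀ᶠ s in l, ∀ w ∈ ball (0 : E3) 1, w ≠ 0 → ‖G s w‖ ≤ C * (‖w‖ ^ 2)⁻¹)
    (ht : ∀ᵐ w, w ∈ ball (0 : E3) 1 → Tendsto (fun s => G s w) l (𝓝 (g w))) :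
    Tendsto (fun s => ∫ w in ball (0 : E3) 1, G s w) l (𝓝 (∫ w in ball (0 : E3) 1, g w)) := by
  refine tendsto_integral_filter_of_dominated_convergence (fun w => C * (‖w‖ ^ 2)⁻¹) hm ?_
    (integrableOn_ball_inv_sq.const_mul C) ((ae_restrict_iff' measurableSet_ball).2 ht)
  filter_upwards [hb] with s hs
  filter_upwards [ae_restrict_mem measurableSet_ball,
    ae_restrict_of_ae (Measure.ae_ne volume (0 : E3))] with w hw h0 using hs w hw h0

lemma setIntegral_ball_scale (f : E3 → F) (x : E3) {δ : ℝ} (hδ : 0 < δ) :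
    ∫ y in ball x δ, f y = δ ^ 3 • ∫ w in ball (0 : E3) 1, f (x + δ • w) := by
  have h1 : ∫ y in ball x δ, f y = ∫ y in ball (0 : E3) δ, f (x + y) := by
    rw [← (measurePreserving_add_left volume x).setIntegral_preimage_emb
      (measurableEmbedding_addLeft x)]
    congr 2
    ext y; simp [dist_eq_norm]
  rw [h1, Measure.setIntegral_comp_smul_of_pos volume (fun y => f (x + y)) _ hδ,
    _root_.smul_ball hδ.ne']
  simp only [smul_zero, Real.norm_eq_abs, abs_of_pos hδ, mul_one, finrank_euclideanSpace,
    Fintype.card_fin]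
  rw [smul_smul, mul_inv_cancel₀ (by positivity), one_smul]

end ball_integrals

/-- `f` is Lipschitz on `s` with real constant `M`. -/
def LipOn {F : Type*} [NormedAddCommGroup F] (M : ℝ) (f : E3 → F) (s : Set E3) : Prop :=
  ∀ x ∈ s, ∀ y ∈ s, ‖f x - f y‖ ≤ M * ‖x - y‖

section LipOn
variable {F : Type*} [NormedAddCommGroup F] {M : ℝ} {f : E3 → F} {s t : Set E3}

lemma LipOn.mono (h : LipOn M f t) (hst : s ⊆ t) : LipOn M f s :=
  fun x hx y hy => h x (hst hx) y (hst hy)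

lemma LipOn.continuousOn (h : LipOn M f s) : ContinuousOn f s := by
  have : LipschitzOnWith M.toNNReal f s := by
    refine LipschitzOnWith.of_dist_le_mul fun x hx y hy => ?_
    rw [dist_eq_norm, dist_eq_norm]
    refine (h x hx y hy).trans ?_
    gcongr
    exact Real.le_coe_toNNReal M
  exact this.continuousOn

lemma ball_add_subset {p w : E3} (hw : w ∈ ball (0 : E3) 1) : ball (p + w) 1 ⊆ ball p 2 := by
  refine ball_subset_ball' ?_
  have : dist (p + w) p < 1 := by simpa using hw
  linarith

lemma LipOn.aestronglyMeasurable [SecondCountableTopologyEither E3 F] {y : E3}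
    (h : LipOn M f (ball y 1)) :
    AEStronglyMeasurable (fun v => f (y + v)) (volume.restrict (ball 0 1)) := by
  refine ContinuousOn.aestronglyMeasurable ?_ measurableSet_ball
  exact h.continuousOn.comp (by fun_prop) fun v hv => by simpa using hv

end LipOn

/-- The nonlocal gradient of `f` at `y`, at unit scale. -/
noncomputable def nlGrad (f : E3 → E3) (y : E3) : E3 →L[ℝ] E3 :=
  ∫ v in ball (0 : E3) 1, (‖v‖ ^ 2)⁻¹ • (innerSL ℝ v).smulRight (f (y + v))

/-! ### The nonlocal gradient -/

section nlGrad
variable {f : E3 → E3} {M : ℝ}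

lemma measurable_inv_norm_pow (k : ℕ) : Measurable fun w : E3 => (‖w‖ ^ k)⁻¹ := by fun_prop

lemma norm_smulRight_kernel (v x : E3) :
    ‖(‖v‖ ^ 2)⁻¹ • (innerSL ℝ v).smulRight x‖ = (‖v‖ ^ 2)⁻¹ * (‖v‖ * ‖x‖) := by
  rw [norm_smul, ContinuousLinearMap.norm_smulRight_apply, innerSL_apply_norm, norm_inv, norm_pow,
    norm_norm]

lemma aestronglyMeasurable_smulRight_kernel {g : E3 → E3}
    (hg : AEStronglyMeasurable g (volume.restrict (ball 0 1))) :
    AEStronglyMeasurable (fun v => (‖v‖ ^ 2)⁻¹ • (innerSL ℝ v).smulRight (g v))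
      (volume.restrict (ball 0 1)) := by
  have h1 : AEStronglyMeasurable (fun v : E3 => (innerSL ℝ v).smulRight (g v))
      (volume.restrict (ball 0 1)) := by
    exact ContinuousLinearMap.aestronglyMeasurable_comp₂
      ((ContinuousLinearMap.smulRightL ℝ E3 E3).comp (innerSL ℝ)) aestronglyMeasurable_id hg
  exact (measurable_inv_norm_pow 2).aestronglyMeasurable.smul h1

lemma integrableOn_nlGrad {y : E3} (hf : LipOn M f (ball y 1)) :
    IntegrableOn (fun v => (‖v‖ ^ 2)⁻¹ • (innerSL ℝ v).smulRight (f (y + v))) (ball 0 1) := by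
  refine integrableOn_ball_of_le_inv_sq
    (aestronglyMeasurable_smulRight_kernel hf.aestronglyMeasurable) (C := |M| + ‖f y‖) fun v hv => ?_
  rw [norm_smulRight_kernel]
  have h1 : ‖v‖ < 1 := by simpa using hv
  have h2 : ‖f (y + v)‖ ≤ |M| + ‖f y‖ := by
    have := hf (y + v) (by simpa using hv) y (by simp)
    rw [add_sub_cancel_left] at this
    calc ‖f (y + v)‖ = ‖(f (y + v) - f y) + f y‖ := by simp
      _ ≤ M * ‖v‖ + ‖f y‖ := (norm_add_le _ _).trans (by gcongr)
      _ ≤ |M| * 1 + ‖f y‖ := by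
          gcongr
          exact le_abs_self M
      _ = _ := by ring
  calc (‖v‖ ^ 2)⁻¹ * (‖v‖ * ‖f (y + v)‖) ≤ (‖v‖ ^ 2)⁻¹ * (1 * (|M| + ‖f y‖)) := by gcongr
    _ = _ := by ring

lemma setIntegral_smulRight_const (a : E3) :
    ∫ v in ball (0 : E3) 1, (‖v‖ ^ 2)⁻¹ • (innerSL ℝ v).smulRight a = 0 :=
  setIntegral_ball_odd _ (fun v => by ext; simp) 1

lemma lipOn_const (a : E3) (s : Set E3) : LipOn 0 (fun _ => a) s := fun _ _ _ _ => by simp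

lemma LipOn.sub_const {s : Set E3} (hf : LipOn M f s) (a : E3) : LipOn M (fun q => f q - a) s :=
  fun x hx y hy => by simpa using hf x hx y hy

lemma nlGrad_sub_const {y : E3} (hf : LipOn M f (ball y 1)) (a : E3) :
    nlGrad (fun q => f q - a) y = nlGrad f y := by
  have h : ∀ v : E3, (‖v‖ ^ 2)⁻¹ • (innerSL ℝ v).smulRight (f (y + v) - a) =
      (‖v‖ ^ 2)⁻¹ • (innerSL ℝ v).smulRight (f (y + v)) - (‖v‖ ^ 2)⁻¹ • (innerSL ℝ v).smulRight a := by
    intro v; ext; simp [smul_sub]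
  simp only [nlGrad, h]
  rw [integral_sub (integrableOn_nlGrad hf) (integrableOn_nlGrad (y := y) (lipOn_const a _)),
    setIntegral_smulRight_const, sub_zero]

lemma nlGrad_smul (r : ℝ) (f : E3 → E3) (y : E3) :
    nlGrad (fun q => r • f q) y = r • nlGrad f y := by
  rw [nlGrad, nlGrad, ← integral_smul]
  congr 1; ext v; simp; ring

/-- The kernel is odd, so `f` may be replaced by `f - f y`; the bound then depends on the Lipschitz
constant alone and not on the size of `f`. -/
lemma norm_nlGrad_le (hM : 0 ≤ M) {y : E3} (hf : LipOn M f (ball y 1)) :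
    ‖nlGrad f y‖ ≤ M * invSqMass := by
  rw [← nlGrad_sub_const hf (f y)]
  refine norm_setIntegral_ball_le fun v hv h0 => ?_
  rw [norm_smulRight_kernel, mul_comm M]
  have h1 : ‖v‖ < 1 := by simpa using hv
  have := hf (y + v) (by simpa using hv) y (by simp)
  rw [add_sub_cancel_left] at this
  gcongr
  nlinarith [norm_nonneg v, norm_nonneg (f (y + v) - f y), mul_nonneg hM (norm_nonneg v)]

lemma norm_nlGrad_sub_le {y y' : E3} {s : Set E3} (hf : LipOn M f s)
    (hy : ball y 1 ⊆ s) (hy' : ball y' 1 ⊆ s) :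
    ‖nlGrad f y - nlGrad f y'‖ ≤ M * invSqMass * ‖y - y'‖ := by
  rw [nlGrad, nlGrad, ← integral_sub (integrableOn_nlGrad (hf.mono hy))
    (integrableOn_nlGrad (hf.mono hy'))]
  have : M * invSqMass * ‖y - y'‖ = (M * ‖y - y'‖) * invSqMass := by ring
  rw [this]
  refine norm_setIntegral_ball_le fun v hv h0 => ?_
  have e : (‖v‖ ^ 2)⁻¹ • (innerSL ℝ v).smulRight (f (y + v)) -
      (‖v‖ ^ 2)⁻¹ • (innerSL ℝ v).smulRight (f (y' + v)) =
      (‖v‖ ^ 2)⁻¹ • (innerSL ℝ v).smulRight (f (y + v) - f (y' + v)) := by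
    ext; simp [smul_sub]
  rw [e, norm_smulRight_kernel, mul_comm (M * _) (_⁻¹)]
  have h1 : ‖v‖ < 1 := by simpa using hv
  have := hf (y + v) (hy (by simpa using hv)) (y' + v) (hy' (by simpa using hv))
  rw [add_sub_add_right_eq_sub] at this
  refine mul_le_mul_of_nonneg_left ?_ (by positivity)
  nlinarith [norm_nonneg v, norm_nonneg (f (y + v) - f (y' + v))]

lemma lipOn_nlGrad {p : E3} (hf : LipOn M f (ball p 2)) :
    LipOn (M * invSqMass) (nlGrad f) (ball p 1) := by
  have h : ∀ y ∈ ball p 1, ball y 1 ⊆ ball p 2 := fun y hy => by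
    refine ball_subset_ball' ?_
    have := mem_ball.1 hy; linarith
  exact fun y hy y' hy' => norm_nlGrad_sub_le hf (h y hy) (h y' hy')

lemma nlGrad_tendsto {l : Filter ℝ} [l.IsCountablyGenerated] {F : ℝ → E3 → E3} {y : E3}
    (hM : 0 ≤ M) (hF : ∀ᶠ s in l, LipOn M (F s) (ball y 1)) (hf : LipOn M f (ball y 1))
    (ht : ∀ q ∈ ball y 1, Tendsto (fun s => F s q) l (𝓝 (f q))) :
    Tendsto (fun s => nlGrad (F s) y) l (𝓝 (nlGrad f y)) := by
  rw [← nlGrad_sub_const hf (f y)]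
  have : (fun s => nlGrad (F s) y) =ᶠ[l] fun s => nlGrad (fun q => F s q - F s y) y := by
    filter_upwards [hF] with s hs using (nlGrad_sub_const hs _).symm
  refine Tendsto.congr' this.symm ?_
  refine tendsto_setIntegral_ball (C := M) ?_ ?_ ?_
  · filter_upwards [hF] with s hs
    exact aestronglyMeasurable_smulRight_kernel (hs.sub_const _).aestronglyMeasurable
  · filter_upwards [hF] with s hs v hv h0
    rw [norm_smulRight_kernel, mul_comm M]
    have h1 : ‖v‖ < 1 := by simpa using hv
    have := hs (y + v) (by simpa using hv) y (by simp)
    rw [add_sub_cancel_left] at this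
    gcongr
    nlinarith [norm_nonneg v, norm_nonneg (F s (y + v) - F s y), mul_nonneg hM (norm_nonneg v)]
  · refine .of_forall fun v hv => ?_
    have h1 := (ht (y + v) (by simpa using hv)).sub (ht y (by simp))
    have hc : Continuous fun x : E3 => (‖v‖ ^ 2)⁻¹ • (innerSL ℝ v).smulRight x := by fun_prop
    exact (hc.tendsto _).comp h1

lemma traceCLM_nlGrad {y : E3} (hf : LipOn M f (ball y 1)) :
    traceCLM (nlGrad f y) = ∫ v in ball (0 : E3) 1, (‖v‖ ^ 2)⁻¹ * inner ℝ v (f (y + v)) := by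
  rw [nlGrad, ← ContinuousLinearMap.integral_comp_comm _ (integrableOn_nlGrad hf)]
  simp only [map_smul, traceCLM_smulRight, smul_eq_mul]

lemma nlGrad_apply {y : E3} (hf : LipOn M f (ball y 1)) (e : E3) :
    nlGrad f y e = ∫ v in ball (0 : E3) 1, ((‖v‖ ^ 2)⁻¹ * inner ℝ e v) • f (y + v) := by
  rw [nlGrad, ContinuousLinearMap.integral_apply (integrableOn_nlGrad hf)]
  simp only [smul_apply, ContinuousLinearMap.smulRight_apply, innerSL_apply_apply, smul_smul,
    real_inner_comm]

end nlGrad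

/-- The bond operator at unit scale. -/
noncomputable def bondS (c : E3 → ℝ) (f : E3 → E3) (p : E3) : E3 :=
  ∫ w in ball (0 : E3) 1, (‖w‖ ^ 4)⁻¹ • (c (p + w) * inner ℝ w (f (p + w) - f p)) • w

/-- The dilatation operator at unit scale. -/
noncomputable def dilT (c : E3 → ℝ) (f : E3 → E3) (p : E3) : E3 :=
  ∫ w in ball (0 : E3) 1, (‖w‖ ^ 2)⁻¹ • (c (p + w) * traceCLM (nlGrad f (p + w))) • w

/-- The operator built from the full nonlocal gradient at unit scale. -/
noncomputable def gradT (c : E3 → ℝ) (f : E3 → E3) (p : E3) : E3 :=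
  ∫ w in ball (0 : E3) 1, (‖w‖ ^ 2)⁻¹ • c (p + w) • nlGrad f (p + w) w

/-! ### The unit-scale operators: bounds and limits -/

section unit_scale
variable {f : E3 → E3} {c : E3 → ℝ} {M K : ℝ} {p : E3}

lemma norm_bondS_kernel_le (hM : 0 ≤ M) (hK : ∀ q, |c q| ≤ K) (hf : LipOn M f (ball p 1))
    {w : E3} (hw : w ∈ ball (0 : E3) 1) (h0 : w ≠ 0) :
    ‖(‖w‖ ^ 4)⁻¹ • (c (p + w) * inner ℝ w (f (p + w) - f p)) • w‖ ≤ K * M * (‖w‖ ^ 2)⁻¹ := by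
  have hK0 : 0 ≤ K := (abs_nonneg _).trans (hK 0)
  have h1 : 0 < ‖w‖ := norm_pos_iff.2 h0
  have h2 : ‖w‖ < 1 := by simpa using hw
  have := hf (p + w) (by simpa using hw) p (by simp)
  rw [add_sub_cancel_left] at this
  rw [norm_smul, norm_smul, norm_mul, norm_inv, norm_pow, norm_norm]
  calc (‖w‖ ^ 4)⁻¹ * (‖c (p + w)‖ * ‖inner ℝ w (f (p + w) - f p)‖ * ‖w‖)
      ≤ (‖w‖ ^ 4)⁻¹ * (K * (‖w‖ * (M * ‖w‖)) * ‖w‖) := by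
        gcongr
        · exact hK _
        · exact (norm_inner_le_norm _ _).trans (by gcongr)
    _ = K * M * ‖w‖⁻¹ := by field_simp
    _ ≤ _ := mul_le_mul_of_nonneg_left (inv_norm_le_inv_sq hw) (by positivity)

lemma aestronglyMeasurable_bondS
    (hc : AEStronglyMeasurable (fun w => c (p + w)) (volume.restrict (ball 0 1)))
    (hf : LipOn M f (ball p 1)) :
    AEStronglyMeasurable (fun w => (‖w‖ ^ 4)⁻¹ • (c (p + w) * inner ℝ w (f (p + w) - f p)) • w)
      (volume.restrict (ball 0 1)) := by
  refine (measurable_inv_norm_pow 4).aestronglyMeasurable.smul ((hc.mul ?_).smul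
    aestronglyMeasurable_id)
  exact aestronglyMeasurable_id.inner (hf.aestronglyMeasurable.sub aestronglyMeasurable_const)

lemma integrableOn_bondS (hM : 0 ≤ M) (hK : ∀ q, |c q| ≤ K)
    (hc : AEStronglyMeasurable (fun w => c (p + w)) (volume.restrict (ball 0 1)))
    (hf : LipOn M f (ball p 1)) :
    IntegrableOn (fun w => (‖w‖ ^ 4)⁻¹ • (c (p + w) * inner ℝ w (f (p + w) - f p)) • w)
      (ball 0 1) := by
  refine integrableOn_ball_of_le_inv_sq (aestronglyMeasurable_bondS hc hf) (C := K * M) fun w hw => ?_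
  rcases eq_or_ne w 0 with rfl | h0
  · simp
  · exact norm_bondS_kernel_le hM hK hf hw h0

lemma bondS_sub {c₁ c₂ : E3 → ℝ} (hM : 0 ≤ M) (hK₁ : ∀ q, |c₁ q| ≤ K) (hK₂ : ∀ q, |c₂ q| ≤ K)
    (hc₁ : AEStronglyMeasurable (fun w => c₁ (p + w)) (volume.restrict (ball 0 1)))
    (hc₂ : AEStronglyMeasurable (fun w => c₂ (p + w)) (volume.restrict (ball 0 1)))
    (hf : LipOn M f (ball p 1)) :
    bondS (fun q => c₁ q - c₂ q) f p = bondS c₁ f p - bondS c₂ f p := by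
  rw [bondS, bondS, bondS, ← integral_sub (integrableOn_bondS hM hK₁ hc₁ hf)
    (integrableOn_bondS hM hK₂ hc₂ hf)]
  congr 1; ext1 w
  rw [← smul_sub, ← sub_smul, sub_mul]

lemma norm_dilT_kernel_le (hM : 0 ≤ M) (hK : ∀ q, |c q| ≤ K) (hf : LipOn M f (ball p 2))
    {w : E3} (hw : w ∈ ball (0 : E3) 1) :
    ‖(‖w‖ ^ 2)⁻¹ • (c (p + w) * traceCLM (nlGrad f (p + w))) • w‖ ≤
      K * (‖traceCLM‖ * (M * invSqMass)) * (‖w‖ ^ 2)⁻¹ := by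
  have hK0 : 0 ≤ K := (abs_nonneg _).trans (hK 0)
  have h2 : ‖w‖ < 1 := by simpa using hw
  have hI := invSqMass_nonneg
  have := norm_nlGrad_le hM (hf.mono (ball_add_subset (p := p) hw))
  rw [norm_smul, norm_smul, norm_mul, norm_inv, norm_pow, norm_norm]
  calc (‖w‖ ^ 2)⁻¹ * (‖c (p + w)‖ * ‖traceCLM (nlGrad f (p + w))‖ * ‖w‖)
      ≤ (‖w‖ ^ 2)⁻¹ * (K * (‖traceCLM‖ * (M * invSqMass)) * 1) := by
        gcongr
        · exact hK _
        · exact (traceCLM.le_opNorm _).trans (by gcongr)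
    _ = _ := by ring

lemma aestronglyMeasurable_nlGrad (hf : LipOn M f (ball p 2)) :
    AEStronglyMeasurable (fun w => nlGrad f (p + w)) (volume.restrict (ball 0 1)) :=
  (lipOn_nlGrad hf).aestronglyMeasurable

lemma aestronglyMeasurable_dilT
    (hc : AEStronglyMeasurable (fun w => c (p + w)) (volume.restrict (ball 0 1)))
    (hf : LipOn M f (ball p 2)) :
    AEStronglyMeasurable (fun w => (‖w‖ ^ 2)⁻¹ • (c (p + w) * traceCLM (nlGrad f (p + w))) • w)
      (volume.restrict (ball 0 1)) :=
  (measurable_inv_norm_pow 2).aestronglyMeasurable.smul ((hc.mul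
    (traceCLM.continuous.comp_aestronglyMeasurable (aestronglyMeasurable_nlGrad hf))).smul
    aestronglyMeasurable_id)

lemma norm_gradT_kernel_le (hM : 0 ≤ M) (hK : ∀ q, |c q| ≤ K) (hf : LipOn M f (ball p 2))
    {w : E3} (hw : w ∈ ball (0 : E3) 1) :
    ‖(‖w‖ ^ 2)⁻¹ • c (p + w) • nlGrad f (p + w) w‖ ≤ K * (M * invSqMass) * (‖w‖ ^ 2)⁻¹ := by
  have hK0 : 0 ≤ K := (abs_nonneg _).trans (hK 0)
  have h2 : ‖w‖ < 1 := by simpa using hw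
  have hI := invSqMass_nonneg
  have := norm_nlGrad_le hM (hf.mono (ball_add_subset (p := p) hw))
  rw [norm_smul, norm_smul, norm_inv, norm_pow, norm_norm]
  calc (‖w‖ ^ 2)⁻¹ * (‖c (p + w)‖ * ‖nlGrad f (p + w) w‖)
      ≤ (‖w‖ ^ 2)⁻¹ * (K * ((M * invSqMass) * 1)) := by
        gcongr
        · exact hK _
        · exact (ContinuousLinearMap.le_opNorm _ _).trans (by gcongr)
    _ = _ := by ring

lemma aestronglyMeasurable_gradT
    (hc : AEStronglyMeasurable (fun w => c (p + w)) (volume.restrict (ball 0 1)))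
    (hf : LipOn M f (ball p 2)) :
    AEStronglyMeasurable (fun w => (‖w‖ ^ 2)⁻¹ • c (p + w) • nlGrad f (p + w) w)
      (volume.restrict (ball 0 1)) := by
  refine (measurable_inv_norm_pow 2).aestronglyMeasurable.smul (hc.smul ?_)
  have hcont : Continuous fun q : (E3 →L[ℝ] E3) × E3 => q.1 q.2 := by fun_prop
  exact hcont.comp_aestronglyMeasurable
    ((aestronglyMeasurable_nlGrad hf).prodMk aestronglyMeasurable_id)

section limits
variable {l : Filter ℝ} [l.IsCountablyGenerated] {G : ℝ → E3 → E3} {k : ℝ → E3 → ℝ}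

/-- Dominated convergence, with the majorant given by a Lipschitz constant common to the maps `G s`.
The coefficients are only asked to converge almost everywhere, because in the blow-up their limit
jumps across a plane. -/
lemma bondS_tendsto (hM : 0 ≤ M) (hK : ∀ s q, |k s q| ≤ K)
    (hk : ∀ s, Measurable (k s))
    (hG : ∀ᶠ s in l, LipOn M (G s) (ball p 1))
    (htk : ∀ᵐ w, w ∈ ball (0 : E3) 1 → Tendsto (fun s => k s (p + w)) l (𝓝 (c (p + w))))
    (htG : ∀ q ∈ ball p 1, Tendsto (fun s => G s q) l (𝓝 (f q))) :
    Tendsto (fun s => bondS (k s) (G s) p) l (𝓝 (bondS c f p)) := by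
  refine tendsto_setIntegral_ball (C := K * M) ?_ ?_ ?_
  · filter_upwards [hG] with s hs
    exact aestronglyMeasurable_bondS
      (((hk s).comp (measurable_const_add p)).aestronglyMeasurable) hs
  · filter_upwards [hG] with s hs w hw h0
    exact norm_bondS_kernel_le hM (hK s) hs hw h0
  · filter_upwards [htk] with w hk' hw
    have h1 := (htG (p + w) (by simpa using hw)).sub (htG p (by simp))
    exact (((hk' hw).mul (tendsto_const_nhds.inner h1)).smul_const _).const_smul _

lemma dilT_tendsto (hM : 0 ≤ M) (hK : ∀ s q, |k s q| ≤ K)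
    (hk : ∀ s, Measurable (k s))
    (hG : ∀ᶠ s in l, LipOn M (G s) (ball p 2)) (hf : LipOn M f (ball p 2))
    (htk : ∀ᵐ w, w ∈ ball (0 : E3) 1 → Tendsto (fun s => k s (p + w)) l (𝓝 (c (p + w))))
    (htG : ∀ q ∈ ball p 2, Tendsto (fun s => G s q) l (𝓝 (f q))) :
    Tendsto (fun s => dilT (k s) (G s) p) l (𝓝 (dilT c f p)) := by
  refine tendsto_setIntegral_ball (C := K * (‖traceCLM‖ * (M * invSqMass))) ?_ ?_ ?_
  · filter_upwards [hG] with s hs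
    exact aestronglyMeasurable_dilT
      (((hk s).comp (measurable_const_add p)).aestronglyMeasurable) hs
  · filter_upwards [hG] with s hs w hw h0
    exact norm_dilT_kernel_le hM (hK s) hs hw
  · filter_upwards [htk] with w hk' hw
    have hsub := ball_add_subset (p := p) hw
    have h1 := nlGrad_tendsto hM (hG.mono fun s hs => hs.mono hsub) (hf.mono hsub)
      fun q hq => htG q (hsub hq)
    exact (((hk' hw).mul ((traceCLM.continuous.tendsto _).comp h1)).smul_const _).const_smul _

lemma gradT_tendsto (hM : 0 ≤ M) (hK : ∀ s q, |k s q| ≤ K)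
    (hk : ∀ s, Measurable (k s))
    (hG : ∀ᶠ s in l, LipOn M (G s) (ball p 2)) (hf : LipOn M f (ball p 2))
    (htk : ∀ᵐ w, w ∈ ball (0 : E3) 1 → Tendsto (fun s => k s (p + w)) l (𝓝 (c (p + w))))
    (htG : ∀ q ∈ ball p 2, Tendsto (fun s => G s q) l (𝓝 (f q))) :
    Tendsto (fun s => gradT (k s) (G s) p) l (𝓝 (gradT c f p)) := by
  refine tendsto_setIntegral_ball (C := K * (M * invSqMass)) ?_ ?_ ?_
  · filter_upwards [hG] with s hs
    exact aestronglyMeasurable_gradT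
      (((hk s).comp (measurable_const_add p)).aestronglyMeasurable) hs
  · filter_upwards [hG] with s hs w hw h0
    exact norm_gradT_kernel_le hM (hK s) hs hw
  · filter_upwards [htk] with w hk' hw
    have hsub := ball_add_subset (p := p) hw
    have h1 := nlGrad_tendsto hM (hG.mono fun s hs => hs.mono hsub) (hf.mono hsub)
      fun q hq => htG q (hsub hq)
    have hcont : Continuous fun A : E3 →L[ℝ] E3 => A w := by fun_prop
    exact ((hk' hw).smul ((hcont.tendsto _).comp h1)).const_smul _

end limits

end unit_scale

/-- The rescaled increment of `u` at `x₀`. -/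
noncomputable def blow (u : E3 → E3) (x₀ : E3) (δ : ℝ) (q : E3) : E3 :=
  δ⁻¹ • (u (x₀ + δ • q) - u x₀)

/-! ### Rescaling the peridynamic integrals -/

section scaling
variable {u : E3 → E3} {x₀ p : E3} {δ M : ℝ}

lemma blow_sub (q q' : E3) :
    blow u x₀ δ q - blow u x₀ δ q' = δ⁻¹ • (u (x₀ + δ • q) - u (x₀ + δ • q')) := by
  rw [blow, blow, ← smul_sub, sub_sub_sub_cancel_right]

lemma lipOn_blow (hδ : 0 < δ) {s : Set E3} {t : Set E3} (hu : LipOn M u t)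
    (hst : ∀ q ∈ s, x₀ + δ • q ∈ t) : LipOn M (blow u x₀ δ) s := by
  intro q hq q' hq'
  rw [blow_sub, norm_smul, Real.norm_eq_abs, abs_of_pos (inv_pos.2 hδ)]
  calc δ⁻¹ * ‖u (x₀ + δ • q) - u (x₀ + δ • q')‖ ≤ δ⁻¹ * (M * ‖(x₀ + δ • q) - (x₀ + δ • q')‖) := by
        gcongr; exact hu _ (hst q hq) _ (hst q' hq')
    _ = M * ‖q - q'‖ := by
        rw [add_sub_add_left_eq_sub, ← smul_sub, norm_smul, Real.norm_eq_abs, abs_of_pos hδ]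
        field_simp

/-- Powers of `δ`: three from the volume element, three from the numerator (two increments of
position and one of `u`), minus four from the kernel. -/
lemma bond_integral_scale (hδ : 0 < δ) (c : E3 → ℝ) :
    ∫ y in ball (x₀ + δ • p) δ, (c y * inner ℝ (y - (x₀ + δ • p)) (u y - u (x₀ + δ • p)) /
      ‖y - (x₀ + δ • p)‖ ^ 4) • (y - (x₀ + δ • p)) =
    δ ^ 2 • bondS (fun q => c (x₀ + δ • q)) (blow u x₀ δ) p := by
  rw [setIntegral_ball_scale _ _ hδ, bondS, ← integral_smul, ← integral_smul]
  congr 1; ext1 w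
  have e : x₀ + δ • p + δ • w = x₀ + δ • (p + w) := by rw [smul_add, add_assoc]
  rw [blow_sub, e, ← e, add_sub_cancel_left, e, norm_smul, Real.norm_eq_abs, abs_of_pos hδ,
    inner_smul_left, inner_smul_right]
  simp only [smul_smul]
  congr 1
  simp only [conj_trivial]
  rcases eq_or_ne ‖w‖ 0 with h0 | h0
  · simp [h0]
  · field_simp

lemma lipOn_comp_scale (hδ : 0 < δ) (hf : LipOn M (blow u x₀ δ) (ball p 2)) :
    LipOn (δ * M) (fun q => u (x₀ + δ • q)) (ball p 2) := by
  intro q hq q' hq'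
  have := hf q hq q' hq'
  rw [blow_sub, norm_smul, Real.norm_eq_abs, abs_of_pos (inv_pos.2 hδ)] at this
  rw [mul_assoc]
  exact (inv_mul_le_iff₀ hδ).1 this

lemma nlGrad_comp_scale (hδ : 0 < δ) (hf : LipOn M (blow u x₀ δ) (ball p 2)) {w : E3}
    (hw : w ∈ ball (0 : E3) 1) :
    nlGrad (fun q => u (x₀ + δ • q)) (p + w) = δ • nlGrad (blow u x₀ δ) (p + w) := by
  have h := nlGrad_sub_const ((lipOn_comp_scale hδ hf).mono (ball_add_subset hw)) (u x₀)
  rw [← h, ← nlGrad_smul]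
  congr 1; ext1 q
  rw [blow, smul_smul, mul_inv_cancel₀ hδ.ne', one_smul]

/-- Powers of `δ`: six from the two volume elements, three from the numerator, minus four from the
kernels. Although `u z` appears without a difference, the constant `u x₀` can be subtracted because
the inner kernel is odd, and this supplies one of the three. -/
lemma dil_integral_scale (hδ : 0 < δ) (c : E3 → ℝ) (hf : LipOn M (blow u x₀ δ) (ball p 2)) :
    ∫ y in ball (x₀ + δ • p) δ, ∫ z in ball y δ, (c y * inner ℝ (z - y) (u z) /
      (‖y - (x₀ + δ • p)‖ ^ 2 * ‖z - y‖ ^ 2)) • (y - (x₀ + δ • p)) =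
    δ ^ 5 • dilT (fun q => c (x₀ + δ • q)) (blow u x₀ δ) p := by
  rw [setIntegral_ball_scale _ _ hδ, dilT, ← integral_smul, ← integral_smul]
  refine setIntegral_congr_fun measurableSet_ball fun w hw => ?_
  have e : x₀ + δ • p + δ • w = x₀ + δ • (p + w) := by rw [smul_add, add_assoc]
  have h1 : δ * traceCLM (nlGrad (blow u x₀ δ) (p + w)) =
      ∫ v in ball (0 : E3) 1, (‖v‖ ^ 2)⁻¹ * inner ℝ v (u (x₀ + δ • (p + w + v))) := by
    rw [← traceCLM_nlGrad ((lipOn_comp_scale hδ hf).mono (ball_add_subset hw)),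
      nlGrad_comp_scale hδ hf hw, map_smul, smul_eq_mul]
  have h2 : δ ^ 5 • (‖w‖ ^ 2)⁻¹ • (c (x₀ + δ • (p + w)) * traceCLM (nlGrad (blow u x₀ δ) (p + w))) • w
      = (δ ^ 4 * (‖w‖ ^ 2)⁻¹ * c (x₀ + δ • (p + w))) •
        (∫ v in ball (0 : E3) 1, (‖v‖ ^ 2)⁻¹ * inner ℝ v (u (x₀ + δ • (p + w + v)))) • w := by
    rw [← h1]; simp only [smul_smul]; congr 1; ring
  simp only [h2, e]
  rw [setIntegral_ball_scale _ _ hδ, ← integral_smul_const, ← integral_smul, ← integral_smul,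
    ← integral_smul]
  congr 1; ext1 v
  have e2 : x₀ + δ • (p + w) + δ • v = x₀ + δ • (p + w + v) := by
    rw [smul_add δ (p + w), add_assoc]
  have e3 : x₀ + δ • (p + w) - (x₀ + δ • p) = δ • w := by rw [smul_add]; abel
  rw [e3, e2, ← e2, add_sub_cancel_left, e2, norm_smul, norm_smul, Real.norm_eq_abs,
    abs_of_pos hδ, inner_smul_left]
  simp only [smul_smul]
  congr 1
  simp only [conj_trivial]
  rcases eq_or_ne ‖w‖ 0 with h0 | h0
  · simp [h0]
  rcases eq_or_ne ‖v‖ 0 with h0' | h0'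
  · simp [h0']
  field_simp

lemma grad_integral_scale (hδ : 0 < δ) (c : E3 → ℝ) (hf : LipOn M (blow u x₀ δ) (ball p 2)) :
    ∫ y in ball (x₀ + δ • p) δ, ∫ z in ball y δ, (c y * inner ℝ (y - (x₀ + δ • p)) (z - y) /
      (‖y - (x₀ + δ • p)‖ ^ 2 * ‖z - y‖ ^ 2)) • u z =
    δ ^ 5 • gradT (fun q => c (x₀ + δ • q)) (blow u x₀ δ) p := by
  rw [setIntegral_ball_scale _ _ hδ, gradT, ← integral_smul, ← integral_smul]
  refine setIntegral_congr_fun measurableSet_ball fun w hw => ?_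
  have e : x₀ + δ • p + δ • w = x₀ + δ • (p + w) := by rw [smul_add, add_assoc]
  have h1 : δ • nlGrad (blow u x₀ δ) (p + w) w =
      ∫ v in ball (0 : E3) 1, ((‖v‖ ^ 2)⁻¹ * inner ℝ w v) • (u (x₀ + δ • (p + w + v))) := by
    rw [← nlGrad_apply ((lipOn_comp_scale hδ hf).mono (ball_add_subset hw)),
      nlGrad_comp_scale hδ hf hw, smul_apply]
  have h2 : δ ^ 5 • (‖w‖ ^ 2)⁻¹ • c (x₀ + δ • (p + w)) • nlGrad (blow u x₀ δ) (p + w) w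
      = (δ ^ 4 * (‖w‖ ^ 2)⁻¹ * c (x₀ + δ • (p + w))) •
        ∫ v in ball (0 : E3) 1, ((‖v‖ ^ 2)⁻¹ * inner ℝ w v) • (u (x₀ + δ • (p + w + v))) := by
    rw [← h1]; simp only [smul_smul]; congr 1; ring
  simp only [h2, e]
  rw [setIntegral_ball_scale _ _ hδ, ← integral_smul, ← integral_smul, ← integral_smul]
  congr 1; ext1 v
  have e2 : x₀ + δ • (p + w) + δ • v = x₀ + δ • (p + w + v) := by
    rw [smul_add δ (p + w), add_assoc]
  have e3 : x₀ + δ • (p + w) - (x₀ + δ • p) = δ • w := by rw [smul_add]; abel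
  rw [e3, e2, ← e2, add_sub_cancel_left, e2, norm_smul, norm_smul, Real.norm_eq_abs,
    abs_of_pos hδ, inner_smul_left, inner_smul_right]
  simp only [smul_smul]
  congr 1
  simp only [conj_trivial]
  rcases eq_or_ne ‖w‖ 0 with h0 | h0
  · simp [h0]
  rcases eq_or_ne ‖v‖ 0 with h0' | h0'
  · simp [h0']
  field_simp

lemma opS_scale (hδ : 0 < δ) (mu : E3 → ℝ) :
    opS δ mu u (x₀ + δ • p) = (δ⁻¹ * (15 / ballVol 1)) •
      bondS (fun q => mu (x₀ + δ • p) + mu (x₀ + δ • q)) (blow u x₀ δ) p := by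
  rw [opS, bond_integral_scale hδ (fun y => mu (x₀ + δ • p) + mu y), ballVol_eq hδ, smul_smul]
  have := ballVol_pos one_pos
  congr 1; field_simp

lemma opD_scale (hδ : 0 < δ) (lam mu : E3 → ℝ) (hf : LipOn M (blow u x₀ δ) (ball p 2)) :
    opD δ lam mu u (x₀ + δ • p) = (δ⁻¹ * (9 / ballVol 1 ^ 2)) •
      dilT (fun q => lam (x₀ + δ • q) - mu (x₀ + δ • q)) (blow u x₀ δ) p := by
  rw [opD, dil_integral_scale hδ (fun y => lam y - mu y) hf, ballVol_eq hδ, smul_smul]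
  have := ballVol_pos one_pos
  congr 1; field_simp

/-- The modified operator on the extended interface at unit scale; `c` and `d` play the roles of
`μ` and `λ - μ`, and `ν` that of the normal. -/
noncomputable def unitStar (c d : E3 → ℝ) (f : E3 → E3) (ν p : E3) : E3 :=
  (15 / ballVol 1) • bondS c f p +
    (45 / (4 * ballVol 1 ^ 2)) • (dilT d f p + inner ℝ (gradT c f p) ν • ν)

lemma opStar_scale {Ω Γ : Set E3} {lam mu : E3 → ℝ} {n : E3 → E3} {K : ℝ} (hδ : 0 < δ) (hM : 0 ≤ M)
    (hmu : Measurable mu) (hK : ∀ q, |mu q| ≤ K)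
    (hx : x₀ + δ • p ∈ extendedInterface Ω Γ δ) (hf : LipOn M (blow u x₀ δ) (ball p 2)) :
    δ • opStar δ Ω Γ lam mu n u (x₀ + δ • p) =
      unitStar (fun q => mu (x₀ + δ • q)) (fun q => lam (x₀ + δ • q) - mu (x₀ + δ • q))
        (blow u x₀ δ) (n (x₀ + δ • p)) p := by
  have hβ := ballVol_pos one_pos
  have hD := opD_scale hδ lam mu hf
  have hf1 : LipOn M (blow u x₀ δ) (ball p 1) := hf.mono (ball_subset_ball (by norm_num))
  have hm : ∀ a : ℝ, AEStronglyMeasurable (fun w => a + mu (x₀ + δ • (p + w)))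
      (volume.restrict (ball 0 1)) := fun a =>
    Measurable.aestronglyMeasurable (by fun_prop)
  -- The first term of `opInterface` removes the share `μ(x)` of the bond coefficient `μ(x) + μ(y)`,
  -- leaving `μ(y)`. Likewise the dilatation coefficient becomes `9 (1 + 1/4) = 45/4`.
  have hsub := bondS_sub (c₁ := fun q => mu (x₀ + δ • p) + mu (x₀ + δ • q))
    (c₂ := fun _ => mu (x₀ + δ • p)) hM (K := K + K)
    (fun q => (abs_add_le _ _).trans (add_le_add (hK _) (hK _)))
    (fun q => (hK _).trans (by linarith [(abs_nonneg _).trans (hK 0)])) (hm _)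
    aestronglyMeasurable_const hf1
  simp only [add_sub_cancel_left] at hsub
  rw [opStar, indicator_of_mem hx, opL, opInterface, unitStar, hsub, opS_scale hδ, hD,
    bond_integral_scale hδ (fun _ => mu (x₀ + δ • p)),
    dil_integral_scale hδ (fun y => lam y - mu y) hf, grad_integral_scale hδ mu hf, ballVol_eq hδ,
    real_inner_smul_left]
  have hne := hβ.ne'
  have hδ' := hδ.ne'
  simp only [smul_add, smul_sub, smul_neg, smul_smul]
  match_scalars <;> field_simp <;> ring

end scaling

lemma ae_inner_add_ne_zero {n : E3} (hn : n ≠ 0) (p : E3) : ∀ᵐ w : E3, inner ℝ n (p + w) ≠ 0 := by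
  have h0 : ∀ᵐ w : E3, inner ℝ n w ≠ 0 := by
    have hs : LinearMap.ker (innerSL ℝ n : E3 →ₗ[ℝ] ℝ) ≠ ⊤ := by
      intro h
      have : n ∈ LinearMap.ker (innerSL ℝ n : E3 →ₗ[ℝ] ℝ) := h ▸ Submodule.mem_top
      simp [hn] at this
    have := Measure.addHaar_submodule (volume : Measure E3) _ hs
    rw [ae_iff]
    convert! this using 2
    ext w; simp
  exact (measurePreserving_add_left volume p).quasiMeasurePreserving.ae h0

/-! ### Lipschitz bounds from pointwise ones -/

section local_lipschitz
variable {F : Type*} [NormedAddCommGroup F]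

/-- A mean value inequality without differentiability, needed because `u` may have a kink on `Γ`.
Along a segment every right slope is at most about `M`, a fencing argument integrates this, and then
`ε → 0`. -/
lemma lipOn_of_local {f : E3 → F} {s : Set E3} (hs : Convex ℝ s) {M : ℝ}
    (h : ∀ x ∈ s, ∀ ε > 0, ∀ᶠ y in 𝓝 x, ‖f y - f x‖ ≤ (M + ε) * ‖y - x‖) : LipOn M f s := by
  have hcont : ∀ x ∈ s, ContinuousAt f x := by
    intro x hx
    rw [ContinuousAt, tendsto_iff_norm_sub_tendsto_zero]
    have : Tendsto (fun y : E3 => (M + 1) * ‖y - x‖) (𝓝 x) (𝓝 0) := by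
      have : Continuous fun y : E3 => (M + 1) * ‖y - x‖ := by fun_prop
      simpa using this.tendsto x
    exact squeeze_zero' (.of_forall fun _ => norm_nonneg _) (h x hx 1 one_pos) this
  intro y hy x hx
  rcases eq_or_ne y x with rfl | hne
  · simp
  have hd : 0 < ‖y - x‖ := norm_pos_iff.2 (sub_ne_zero.2 hne)
  have hseg : ∀ t ∈ Icc (0 : ℝ) 1, x + t • (y - x) ∈ s := fun t ht =>
    hs.add_smul_sub_mem hx hy ht
  have key : ∀ ε > 0, ‖f y - f x‖ ≤ (M + ε) * ‖y - x‖ := by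
    intro ε hε
    have := image_norm_le_of_liminf_right_slope_norm_lt_deriv_boundary
      (f := fun t : ℝ => f (x + t • (y - x)) - f x) (f' := fun _ => (M + ε / 2) * ‖y - x‖)
      (a := 0) (b := 1) (B := fun t => (M + ε) * ‖y - x‖ * t) (B' := fun _ => (M + ε) * ‖y - x‖)
      ?_ ?_ (by simp) (by fun_prop) ?_ ?_ (x := 1) (by simp)
    · simpa using this
    · intro t ht
      refine ContinuousAt.continuousWithinAt ?_
      have h1 : ContinuousAt (fun t : ℝ => x + t • (y - x)) t := by fun_prop
      exact (ContinuousAt.comp (f := fun t : ℝ => x + t • (y - x)) (hcont _ (hseg t ht)) h1).sub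
        continuousAt_const
    · intro t ht r hr
      have h1 : Tendsto (fun z : ℝ => x + z • (y - x)) (𝓝[>] t) (𝓝 (x + t • (y - x))) := by
        have : Continuous fun z : ℝ => x + z • (y - x) := by fun_prop
        exact (this.tendsto t).mono_left nhdsWithin_le_nhds
      have h2 := h1.eventually (h _ (hseg t ⟨ht.1, ht.2.le⟩) (ε / 2) (by positivity))
      refine Eventually.frequently ?_
      filter_upwards [h2, self_mem_nhdsWithin] with z hz hzt
      have hzt' : 0 < z - t := sub_pos.2 hzt
      refine lt_of_le_of_lt ?_ hr
      rw [slope_def_field, div_le_iff₀ hzt']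
      have e : x + z • (y - x) - (x + t • (y - x)) = (z - t) • (y - x) := by
        rw [sub_smul]; abel
      rw [e, norm_smul, Real.norm_eq_abs, abs_of_pos hzt'] at hz
      calc _ ≤ ‖(f (x + z • (y - x)) - f x) - (f (x + t • (y - x)) - f x)‖ := norm_sub_norm_le _ _
        _ = ‖f (x + z • (y - x)) - f (x + t • (y - x))‖ := by rw [sub_sub_sub_cancel_right]
        _ ≤ _ := hz
        _ = _ := by ring
    · intro t _
      have := ((hasDerivAt_id t).const_mul ((M + ε) * ‖y - x‖)).hasDerivWithinAt (s := Ici t)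
      simpa using this
    · intro t _ _
      gcongr; linarith
  refine le_of_forall_pos_le_add fun ε hε => ?_
  have := key (ε / ‖y - x‖) (by positivity)
  rwa [add_mul, div_mul_cancel₀ _ hd.ne'] at this

lemma eventually_norm_sub_le [NormedSpace ℝ F] {f : E3 → F} {f' : E3 →L[ℝ] F} {x : E3} (hf : HasFDerivAt f f' x)
    {M ε : ℝ} (hM : ‖f'‖ ≤ M) (hε : 0 < ε) : ∀ᶠ y in 𝓝 x, ‖f y - f x‖ ≤ (M + ε) * ‖y - x‖ := by
  filter_upwards [hf.isLittleO.def hε] with y hy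
  calc ‖f y - f x‖ = ‖(f y - f x - f' (y - x)) + f' (y - x)‖ := by simp
    _ ≤ ε * ‖y - x‖ + M * ‖y - x‖ := (norm_add_le _ _).trans
        (add_le_add hy ((f'.le_opNorm _).trans (by gcongr)))
    _ = _ := by ring

end local_lipschitz

section twoPhase
variable {Ωm : Set E3}

lemma measurable_twoPhase (h : IsOpen Ωm) (cp cm : ℝ) : Measurable (twoPhase Ωm cp cm) := by
  classical
  exact Measurable.ite h.measurableSet measurable_const measurable_const

lemma abs_twoPhase_le (cp cm : ℝ) (x : E3) : |twoPhase Ωm cp cm x| ≤ |cp| + |cm| := by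
  unfold twoPhase; split_ifs <;> linarith [abs_nonneg cp, abs_nonneg cm]

end twoPhase


/-! ### Geometry of the interface -/

section composite
variable {Ω Ωp Ωm Γ : Set E3} {n : E3 → E3}

lemma IsTwoPhaseComposite.notMem_plus (hΩ : IsTwoPhaseComposite Ω Ωp Ωm Γ n) {x : E3}
    (hx : x ∈ Γ) : x ∉ Ωp := by
  obtain ⟨V, -, hxV, g, -, -, hV, -⟩ := hΩ.interface x hx
  intro h
  exact ((hV x hxV).2.1.1 h).ne' ((hV x hxV).1.1 hx)

lemma IsTwoPhaseComposite.notMem_minus (hΩ : IsTwoPhaseComposite Ω Ωp Ωm Γ n) {x : E3}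
    (hx : x ∈ Γ) : x ∉ Ωm := by
  obtain ⟨V, -, hxV, g, -, -, hV, -⟩ := hΩ.interface x hx
  intro h
  exact ((hV x hxV).2.2.1 h).ne ((hV x hxV).1.1 hx)

lemma IsTwoPhaseComposite.norm_normal (hΩ : IsTwoPhaseComposite Ω Ωp Ωm Γ n) {x : E3}
    (hx : x ∈ Γ) : ‖n x‖ = 1 := by
  obtain ⟨V, -, hxV, g, -, hg, -, hn⟩ := hΩ.interface x hx
  rw [hn, norm_smul, norm_inv, norm_norm, inv_mul_cancel₀ (norm_ne_zero_iff.2 hg)]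

lemma IsTwoPhaseComposite.mem_domain (hΩ : IsTwoPhaseComposite Ω Ωp Ωm Γ n) {x : E3}
    (hx : x ∈ Γ) : x ∈ Ω := by rw [hΩ.domain_eq]; exact Or.inr hx

lemma IsTwoPhaseComposite.plus_subset (hΩ : IsTwoPhaseComposite Ω Ωp Ωm Γ n) : Ωp ⊆ Ω := by
  rw [hΩ.domain_eq]; exact fun x hx => Or.inl (Or.inl hx)

lemma IsTwoPhaseComposite.minus_subset (hΩ : IsTwoPhaseComposite Ω Ωp Ωm Γ n) : Ωm ⊆ Ω := by
  rw [hΩ.domain_eq]; exact fun x hx => Or.inl (Or.inr hx)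

lemma IsTwoPhaseComposite.interface_eq (hΩ : IsTwoPhaseComposite Ω Ωp Ωm Γ n) :
    Γ = Ω \ (Ωp ∪ Ωm) := by
  ext x
  constructor
  · exact fun hx => ⟨hΩ.mem_domain hx, fun h => h.elim (hΩ.notMem_plus hx) (hΩ.notMem_minus hx)⟩
  · rintro ⟨h1, h2⟩
    rw [hΩ.domain_eq] at h1
    exact h1.resolve_left h2

lemma IsTwoPhaseComposite.measurableSet_interface (hΩ : IsTwoPhaseComposite Ω Ωp Ωm Γ n) :
    MeasurableSet Γ := by
  rw [hΩ.interface_eq]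
  exact hΩ.isOpen_domain.measurableSet.diff
    (hΩ.isOpen_plus.union hΩ.isOpen_minus).measurableSet

lemma tendsto_add_smul (x y : E3) : Tendsto (fun δ : ℝ => x + δ • y) (𝓝[>] 0) (𝓝 x) := by
  have : Continuous fun δ : ℝ => x + δ • y := by fun_prop
  have := this.tendsto 0
  rw [zero_smul, add_zero] at this
  exact this.mono_left nhdsWithin_le_nhds

lemma tendsto_slope_line {F : Type*} [NormedAddCommGroup F] [NormedSpace ℝ F] {f : E3 → F} {x : E3}
    {f' : E3 →L[ℝ] F} (hf : HasFDerivAt f f' x) (y : E3) :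
    Tendsto (fun δ : ℝ => δ⁻¹ • (f (x + δ • y) - f x)) (𝓝[>] 0) (𝓝 (f' y)) := by
  have h1 : HasDerivAt (fun δ : ℝ => x + δ • y) y 0 := by
    simpa using ((hasDerivAt_id (0 : ℝ)).smul_const y).const_add x
  have h2 : HasDerivAt (fun δ : ℝ => f (x + δ • y)) (f' y) 0 := by
    refine HasFDerivAt.comp_hasDerivAt (f := fun δ : ℝ => x + δ • y) 0 ?_ h1
    simpa using hf
  simpa using h2.tendsto_slope_zero_right

/-- The defining function `g` vanishes at `x` and has derivative `‖∇g‖ ⟪n x, y⟫ > 0` in the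
direction `y`, so it is positive shortly after leaving `x`. -/
lemma IsTwoPhaseComposite.eventually_plus (hΩ : IsTwoPhaseComposite Ω Ωp Ωm Γ n) {x y : E3}
    (hx : x ∈ Γ) (hy : 0 < inner ℝ (n x) y) : ∀ᶠ δ in 𝓝[>] (0 : ℝ), x + δ • y ∈ Ωp := by
  obtain ⟨V, hVo, hxV, g, hg, hg0, hV, hn⟩ := hΩ.interface x hx
  have hd : HasFDerivAt g (fderiv ℝ g x) x :=
    ((hg.contDiffAt (hVo.mem_nhds hxV)).differentiableAt one_ne_zero).hasFDerivAt
  have hpos : 0 < fderiv ℝ g x y := by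
    rw [hn, inner_smul_left, inner_gradient_left] at hy
    exact pos_of_mul_pos_right hy (by simp)
  have hgx : g x = 0 := (hV x hxV).1.1 hx
  filter_upwards [(tendsto_slope_line hd y).eventually (lt_mem_nhds hpos), self_mem_nhdsWithin,
    (tendsto_add_smul x y).eventually (hVo.mem_nhds hxV)] with δ h1 h2 h3
  rw [hgx, sub_zero, smul_eq_mul] at h1
  exact (hV _ h3).2.1.2 (pos_of_mul_pos_right h1 (inv_pos.2 h2).le)

lemma IsTwoPhaseComposite.eventually_minus (hΩ : IsTwoPhaseComposite Ω Ωp Ωm Γ n) {x y : E3}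
    (hx : x ∈ Γ) (hy : inner ℝ (n x) y < 0) : ∀ᶠ δ in 𝓝[>] (0 : ℝ), x + δ • y ∈ Ωm := by
  obtain ⟨V, hVo, hxV, g, hg, hg0, hV, hn⟩ := hΩ.interface x hx
  have hd : HasFDerivAt g (fderiv ℝ g x) x :=
    ((hg.contDiffAt (hVo.mem_nhds hxV)).differentiableAt one_ne_zero).hasFDerivAt
  have hneg : fderiv ℝ g x y < 0 := by
    rw [hn, inner_smul_left, inner_gradient_left] at hy
    exact neg_of_mul_neg_right hy (by simp)
  have hgx : g x = 0 := (hV x hxV).1.1 hx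
  filter_upwards [(tendsto_slope_line hd y).eventually (gt_mem_nhds hneg), self_mem_nhdsWithin,
    (tendsto_add_smul x y).eventually (hVo.mem_nhds hxV)] with δ h1 h2 h3
  rw [hgx, sub_zero, smul_eq_mul] at h1
  exact (hV _ h3).2.2.2 (neg_of_mul_neg_right h1 (inv_pos.2 h2).le)

lemma IsTwoPhaseComposite.normal_ne_zero (hΩ : IsTwoPhaseComposite Ω Ωp Ωm Γ n) {x : E3}
    (hx : x ∈ Γ) : n x ≠ 0 := norm_ne_zero_iff.1 (by rw [hΩ.norm_normal hx]; exact one_ne_zero)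

lemma IsTwoPhaseComposite.tendsto_twoPhase (hΩ : IsTwoPhaseComposite Ω Ωp Ωm Γ n) {x q : E3}
    (hx : x ∈ Γ) (hq : inner ℝ (n x) q ≠ 0) (cp cm : ℝ) :
    Tendsto (fun δ : ℝ => twoPhase Ωm cp cm (x + δ • q)) (𝓝[>] 0)
      (𝓝 (step cp cm (inner ℝ (n x) q))) := by
  rcases hq.lt_or_gt with h | h
  · refine tendsto_const_nhds.congr' ?_
    filter_upwards [hΩ.eventually_minus hx h] with δ hδ
    simp [twoPhase, hδ, step, h.not_gt]
  · refine tendsto_const_nhds.congr' ?_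
    filter_upwards [hΩ.eventually_plus hx h] with δ hδ
    simp [twoPhase, hΩ.disjoint_phases.notMem_of_mem_left hδ, step, h]

/-- By Lebesgue's density theorem almost every point of `Γ` has density one in `Γ`. But rays
transversal to the tangent plane leave `Γ` at once, so the rescaled indicators tend to zero almost
everywhere and the density at every point of `Γ` is zero. -/
lemma IsTwoPhaseComposite.volume_interface (hΩ : IsTwoPhaseComposite Ω Ωp Ωm Γ n) :
    volume Γ = 0 := by
  classical
  have hΓ := hΩ.measurableSet_interface
  have hlim : ∀ x ∈ Γ, Tendsto (fun r : ℝ => ∫ w in ball (0 : E3) 1,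
      Γ.indicator (fun _ => (1 : ℝ)) (x + r • w)) (𝓝[>] 0) (𝓝 0) := by
    intro x hx
    suffices h : Tendsto (fun r : ℝ => ∫ w in ball (0 : E3) 1,
      Γ.indicator (fun _ => (1 : ℝ)) (x + r • w)) (𝓝[>] 0) (𝓝 (∫ w in ball (0 : E3) 1, (0 : ℝ))) by
      simpa using h
    refine tendsto_setIntegral_ball (C := 1) (.of_forall fun r => ?_) (.of_forall fun r w hw h0 => ?_) ?_
    · exact ((measurable_const.indicator hΓ).comp (by fun_prop)).aestronglyMeasurable
    · have := one_le_inv_sq hw h0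
      rw [one_mul]
      refine le_trans ?_ this
      by_cases h : x + r • w ∈ Γ <;> simp [h]
    · filter_upwards [ae_inner_add_ne_zero (hΩ.normal_ne_zero hx) 0] with w hw _
      rw [zero_add] at hw
      refine tendsto_const_nhds.congr' ?_
      rcases hw.lt_or_gt with h | h
      · filter_upwards [hΩ.eventually_minus hx h] with r hr
        exact (indicator_of_notMem (fun h' => hΩ.notMem_minus h' hr) _).symm
      · filter_upwards [hΩ.eventually_plus hx h] with r hr
        exact (indicator_of_notMem (fun h' => hΩ.notMem_plus h' hr) _).symm
  -- The density theorem speaks of closed balls. Each is contained in the open ball of twice the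
  -- radius, at the price of the volume ratio `8`.
  have hball : ∀ x : E3, ∀ r > 0, (volume (Γ ∩ closedBall x r) / volume (closedBall x r)).toReal ≤
      8 / ballVol 1 * ∫ w in ball (0 : E3) 1, Γ.indicator (fun _ => (1 : ℝ)) (x + (2 * r) • w) := by
    intro x r hr
    have h1 := setIntegral_ball_scale (Γ.indicator fun _ => (1 : ℝ)) x (δ := 2 * r) (by positivity)
    rw [setIntegral_indicator hΓ, setIntegral_const, smul_eq_mul, mul_one, smul_eq_mul] at h1
    have h2 : volume.real (Γ ∩ closedBall x r) ≤ volume.real (ball x (2 * r) ∩ Γ) := by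
      refine measureReal_mono ?_ ((measure_mono inter_subset_left).trans_lt measure_ball_lt_top).ne
      rintro y ⟨hy, hy'⟩
      refine ⟨mem_ball.2 ((mem_closedBall.1 hy').trans_lt (by linarith)), hy⟩
    have h3 : (volume (closedBall x r)).toReal = r ^ 3 * ballVol 1 := by
      simp [ballVol, Measure.real, Measure.addHaar_closedBall (volume : Measure E3) x hr.le,
        ENNReal.toReal_ofReal (pow_nonneg hr.le 3)]
    have hβ := ballVol_pos one_pos
    rw [ENNReal.toReal_div, h3, div_le_iff₀ (by positivity)]
    refine h2.trans (h1.le.trans (le_of_eq ?_))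
    field_simp; ring
  have hae := Besicovitch.ae_tendsto_measure_inter_div (volume : Measure E3) Γ
  have hfalse : ∀ᵐ x ∂(volume.restrict Γ), False := by
    filter_upwards [hae, ae_restrict_mem hΓ] with x hx hxΓ
    have h1 := (ENNReal.tendsto_toReal ENNReal.one_ne_top).comp hx
    have h2 : Tendsto (fun r : ℝ => 8 / ballVol 1 * ∫ w in ball (0 : E3) 1,
        Γ.indicator (fun _ => (1 : ℝ)) (x + (2 * r) • w)) (𝓝[>] 0) (𝓝 (8 / ballVol 1 * 0)) := by
      refine Tendsto.const_mul _ ((hlim x hxΓ).comp ?_)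
      refine tendsto_nhdsWithin_iff.2 ⟨?_, ?_⟩
      · have : Continuous fun r : ℝ => 2 * r := by fun_prop
        simpa using (this.tendsto 0).mono_left nhdsWithin_le_nhds
      · filter_upwards [self_mem_nhdsWithin] with r hr
        exact mul_pos two_pos (mem_Ioi.1 hr)
    have h3 := le_of_tendsto_of_tendsto h1 h2 (by
      filter_upwards [self_mem_nhdsWithin] with r hr using hball x r hr)
    simp at h3
    linarith
  rw [ae_iff] at hfalse
  simpa using hfalse

end composite

/-- `f` is glued along the interface from the maps `Fp` and `Fm`. -/
structure IsGlued {F : Type*} (Ωp Ωm Γ : Set E3) (f Fp Fm : E3 → F) : Prop where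
  plus : EqOn f Fp (Ωp ∪ Γ)
  minus : EqOn f Fm (Ωm ∪ Γ)

/-! ### Maps glued along the interface -/

section glued
variable {Ω Ωp Ωm Γ : Set E3} {n : E3 → E3}

lemma IsTwoPhaseComposite.normal_direction_plus (hΩ : IsTwoPhaseComposite Ω Ωp Ωm Γ n) {x : E3}
    (hx : x ∈ Γ) : ∀ᶠ δ in 𝓝[>] (0 : ℝ), x + δ • n x ∈ Ωp :=
  hΩ.eventually_plus hx (by
    have := real_inner_self_eq_norm_sq (n x)
    rw [hΩ.norm_normal hx] at this
    linarith)

lemma IsTwoPhaseComposite.normal_direction_minus (hΩ : IsTwoPhaseComposite Ω Ωp Ωm Γ n) {x : E3}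
    (hx : x ∈ Γ) : ∀ᶠ δ in 𝓝[>] (0 : ℝ), x + δ • (-n x) ∈ Ωm :=
  hΩ.eventually_minus hx (by
    have := real_inner_self_eq_norm_sq (n x)
    rw [hΩ.norm_normal hx] at this
    rw [inner_neg_right]
    linarith)

lemma IsTwoPhaseComposite.mem_cases (hΩ : IsTwoPhaseComposite Ω Ωp Ωm Γ n) {x : E3}
    (hx : x ∈ Ω) : x ∈ Ωp ∨ x ∈ Ωm ∨ x ∈ Γ := by
  rw [hΩ.domain_eq] at hx
  rcases hx with (h | h) | h
  exacts [Or.inl h, Or.inr (Or.inl h), Or.inr (Or.inr h)]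

/-- Each point of `Γ` is reached from within either phase by moving along `n` or `-n`, so agreement
on the phases passes to `Γ` by continuity. -/
lemma isGlued_of_continuousOn (hΩ : IsTwoPhaseComposite Ω Ωp Ωm Γ n) {F : Type*}
    [TopologicalSpace F] [T2Space F] {f Fp Fm : E3 → F} (hf : ContinuousOn f Ω)
    (hFp : ContinuousOn Fp Ω) (hFm : ContinuousOn Fm Ω)
    (hp : EqOn f Fp Ωp) (hm : EqOn f Fm Ωm) : IsGlued Ωp Ωm Γ f Fp Fm := by
  have ho := hΩ.isOpen_domain
  have hlim : ∀ {g : E3 → F}, ContinuousOn g Ω → ∀ x ∈ Γ, ∀ v : E3,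
      Tendsto (fun δ : ℝ => g (x + δ • v)) (𝓝[>] 0) (𝓝 (g x)) := fun hg x hx v =>
    (hg.continuousAt (ho.mem_nhds (hΩ.mem_domain hx))).tendsto.comp (tendsto_add_smul x v)
  constructor
  · rintro x (hx | hx)
    · exact hp hx
    · refine tendsto_nhds_unique_of_eventuallyEq (hlim hf x hx (n x)) (hlim hFp x hx (n x)) ?_
      filter_upwards [hΩ.normal_direction_plus hx] with δ hδ using hp hδ
  · rintro x (hx | hx)
    · exact hm hx
    · refine tendsto_nhds_unique_of_eventuallyEq (hlim hf x hx (-n x)) (hlim hFm x hx (-n x)) ?_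
      filter_upwards [hΩ.normal_direction_minus hx] with δ hδ using hm hδ

lemma IsGlued.eventually_plus {F : Type*} {f Fp Fm : E3 → F} (h : IsGlued Ωp Ωm Γ f Fp Fm)
    (hΩ : IsTwoPhaseComposite Ω Ωp Ωm Γ n) {x : E3} (hx : x ∈ Ωp) : f =ᶠ[𝓝 x] Fp := by
  filter_upwards [hΩ.isOpen_plus.mem_nhds hx] with y hy using h.plus (Or.inl hy)

lemma IsGlued.eventually_minus {F : Type*} {f Fp Fm : E3 → F} (h : IsGlued Ωp Ωm Γ f Fp Fm)
    (hΩ : IsTwoPhaseComposite Ω Ωp Ωm Γ n) {x : E3} (hx : x ∈ Ωm) : f =ᶠ[𝓝 x] Fm := by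
  filter_upwards [hΩ.isOpen_minus.mem_nhds hx] with y hy using h.minus (Or.inl hy)

variable {F : Type*} [NormedAddCommGroup F] [NormedSpace ℝ F] {f Fp Fm : E3 → F}

lemma IsGlued.norm_fderiv_plus_le (h : IsGlued Ωp Ωm Γ f Fp Fm)
    (hΩ : IsTwoPhaseComposite Ω Ωp Ωm Γ n) (hFp : ContDiffOn ℝ 1 Fp Ω) {M : ℝ}
    (hM : ∀ x ∈ Ωp ∪ Ωm, ‖fderiv ℝ f x‖ ≤ M) {x : E3} (hx : x ∈ Ωp ∪ Γ) : ‖fderiv ℝ Fp x‖ ≤ M := by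
  have hp : ∀ y ∈ Ωp, ‖fderiv ℝ Fp y‖ ≤ M := fun y hy => by
    rw [← (h.eventually_plus hΩ hy).fderiv_eq]; exact hM y (Or.inl hy)
  rcases hx with hx | hx
  · exact hp x hx
  · have hc : ContinuousAt (fderiv ℝ Fp) x :=
      (hFp.continuousOn_fderiv_of_isOpen hΩ.isOpen_domain le_rfl).continuousAt
        (hΩ.isOpen_domain.mem_nhds (hΩ.mem_domain hx))
    refine le_of_tendsto (hc.norm.tendsto.comp (tendsto_add_smul x (n x))) ?_
    filter_upwards [hΩ.normal_direction_plus hx] with δ hδ using hp _ hδ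

lemma IsGlued.norm_fderiv_minus_le (h : IsGlued Ωp Ωm Γ f Fp Fm)
    (hΩ : IsTwoPhaseComposite Ω Ωp Ωm Γ n) (hFm : ContDiffOn ℝ 1 Fm Ω) {M : ℝ}
    (hM : ∀ x ∈ Ωp ∪ Ωm, ‖fderiv ℝ f x‖ ≤ M) {x : E3} (hx : x ∈ Ωm ∪ Γ) : ‖fderiv ℝ Fm x‖ ≤ M := by
  have hm : ∀ y ∈ Ωm, ‖fderiv ℝ Fm y‖ ≤ M := fun y hy => by
    rw [← (h.eventually_minus hΩ hy).fderiv_eq]; exact hM y (Or.inr hy)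
  rcases hx with hx | hx
  · exact hm x hx
  · have hc : ContinuousAt (fderiv ℝ Fm) x :=
      (hFm.continuousOn_fderiv_of_isOpen hΩ.isOpen_domain le_rfl).continuousAt
        (hΩ.isOpen_domain.mem_nhds (hΩ.mem_domain hx))
    refine le_of_tendsto (hc.norm.tendsto.comp (tendsto_add_smul x (-n x))) ?_
    filter_upwards [hΩ.normal_direction_minus hx] with δ hδ using hm _ hδ

lemma hasFDerivAt_of_contDiffOn {G : E3 → F} (ho : IsOpen Ω) (hG : ContDiffOn ℝ 1 G Ω) {x : E3}
    (hx : x ∈ Ω) : HasFDerivAt G (fderiv ℝ G x) x :=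
  ((hG.contDiffAt (ho.mem_nhds hx)).differentiableAt one_ne_zero).hasFDerivAt

/-- The derivative bound extends by continuity to both one-sided derivatives on `Γ`. A point of `Γ`
therefore satisfies the local estimate of `lipOn_of_local` on either side, although `f` need not be
differentiable there. -/
lemma IsGlued.lipOn (h : IsGlued Ωp Ωm Γ f Fp Fm)
    (hΩ : IsTwoPhaseComposite Ω Ωp Ωm Γ n) (hFp : ContDiffOn ℝ 1 Fp Ω) (hFm : ContDiffOn ℝ 1 Fm Ω)
    {M : ℝ} (hM : ∀ x ∈ Ωp ∪ Ωm, ‖fderiv ℝ f x‖ ≤ M) {s : Set E3} (hs : Convex ℝ s) (hsΩ : s ⊆ Ω) :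
    LipOn M f s := by
  have ho := hΩ.isOpen_domain
  refine lipOn_of_local hs fun x hx ε hε => ?_
  have hxΩ := hsΩ hx
  have ep := fun hx' => eventually_norm_sub_le (hasFDerivAt_of_contDiffOn ho hFp hxΩ)
    (h.norm_fderiv_plus_le hΩ hFp hM hx') hε
  have em := fun hx' => eventually_norm_sub_le (hasFDerivAt_of_contDiffOn ho hFm hxΩ)
    (h.norm_fderiv_minus_le hΩ hFm hM hx') hε
  rcases hΩ.mem_cases hxΩ with hx' | hx' | hx'
  · filter_upwards [ep (Or.inl hx'), hΩ.isOpen_plus.mem_nhds hx'] with y h1 h2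
    rwa [h.plus (Or.inl h2), h.plus (Or.inl hx')]
  · filter_upwards [em (Or.inl hx'), hΩ.isOpen_minus.mem_nhds hx'] with y h1 h2
    rwa [h.minus (Or.inl h2), h.minus (Or.inl hx')]
  · filter_upwards [ep (Or.inr hx'), em (Or.inr hx'), ho.mem_nhds hxΩ] with y h1 h2 h3
    rcases hΩ.mem_cases h3 with hy | hy | hy
    · rwa [h.plus (Or.inl hy), h.plus (Or.inr hx')]
    · rwa [h.minus (Or.inl hy), h.minus (Or.inr hx')]
    · rwa [h.plus (Or.inr hy), h.plus (Or.inr hx')]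

/-- Every point near `x` is governed by one of the two first-order expansions, and these have the
same linear part. -/
lemma IsGlued.hasFDerivAt (h : IsGlued Ωp Ωm Γ f Fp Fm)
    (hΩ : IsTwoPhaseComposite Ω Ωp Ωm Γ n) (hFp : ContDiffOn ℝ 1 Fp Ω) (hFm : ContDiffOn ℝ 1 Fm Ω)
    {x : E3} (hx : x ∈ Γ) (he : fderiv ℝ Fp x = fderiv ℝ Fm x) :
    HasFDerivAt f (fderiv ℝ Fp x) x := by
  have ho := hΩ.isOpen_domain
  have hxΩ := hΩ.mem_domain hx
  have h1 := hasFDerivAt_of_contDiffOn ho hFp hxΩ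
  have h2 := hasFDerivAt_of_contDiffOn ho hFm hxΩ
  rw [← he] at h2
  rw [hasFDerivAt_iff_isLittleO] at *
  rw [Asymptotics.isLittleO_iff] at *
  intro c hc
  filter_upwards [h1 hc, h2 hc, ho.mem_nhds hxΩ] with y h1 h2 h3
  rcases hΩ.mem_cases h3 with hy | hy | hy
  · rwa [h.plus (Or.inl hy), h.plus (Or.inr hx)]
  · rwa [h.minus (Or.inl hy), h.minus (Or.inr hx)]
  · rwa [h.plus (Or.inr hy), h.plus (Or.inr hx)]

lemma IsGlued.fderiv_glued (h : IsGlued Ωp Ωm Γ f Fp Fm)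
    (hΩ : IsTwoPhaseComposite Ω Ωp Ωm Γ n) (hFp : ContDiffOn ℝ 1 Fp Ω) (hFm : ContDiffOn ℝ 1 Fm Ω)
    (he : ∀ x ∈ Γ, fderiv ℝ Fp x = fderiv ℝ Fm x) :
    IsGlued Ωp Ωm Γ (fderiv ℝ f) (fderiv ℝ Fp) (fderiv ℝ Fm) := by
  constructor
  · rintro x (hx | hx)
    · exact (h.eventually_plus hΩ hx).fderiv_eq
    · exact (h.hasFDerivAt hΩ hFp hFm hx (he x hx)).fderiv
  · rintro x (hx | hx)
    · exact (h.eventually_minus hΩ hx).fderiv_eq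
    · rw [(h.hasFDerivAt hΩ hFp hFm hx (he x hx)).fderiv, he x hx]

end glued

/-! ### Gradient jump and blow-up at an interface point -/

section jump
variable {Ω Ωp Ωm Γ : Set E3} {n : E3 → E3} {u Up Um : E3 → E3}

/-- The gradient of a glued map jumps by a rank one map in the direction of the normal. -/
lemma IsGlued.fderiv_jump (h : IsGlued Ωp Ωm Γ u Up Um)
    (hΩ : IsTwoPhaseComposite Ω Ωp Ωm Γ n) (hUp : ContDiffOn ℝ 1 Up Ω) (hUm : ContDiffOn ℝ 1 Um Ω)
    {x : E3} (hx : x ∈ Γ) (y : E3) :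
    fderiv ℝ Up x y = fderiv ℝ Um x y +
      inner ℝ (n x) y • (fderiv ℝ Up x (n x) - fderiv ℝ Um x (n x)) := by
  have ho := hΩ.isOpen_domain
  have hxΩ := hΩ.mem_domain hx
  have hn := hΩ.norm_normal hx
  obtain ⟨V, hVo, hxV, g, hg, hg0, hV, hgn⟩ := hΩ.interface x hx
  have hgx : g x = 0 := (hV x hxV).1.1 hx
  have hgs : HasStrictFDerivAt g (fderiv ℝ g x) x :=
    (hg.contDiffAt (hVo.mem_nhds hxV)).hasStrictFDerivAt one_ne_zero
  have hnorm : 0 < ‖gradient g x‖ := norm_pos_iff.2 hg0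
  have hgd : ∀ y, fderiv ℝ g x y = ‖gradient g x‖ * inner ℝ (n x) y := by
    intro y
    rw [hgn, inner_smul_left, inner_gradient_left]
    simp only [map_inv₀, conj_trivial]
    field_simp
  have hsp := (hUp.contDiffAt (ho.mem_nhds hxΩ)).hasStrictFDerivAt one_ne_zero
  have hsm := (hUm.contDiffAt (ho.mem_nhds hxΩ)).hasStrictFDerivAt one_ne_zero
  have hnn : inner ℝ (n x) (n x) = (1 : ℝ) := by
    rw [real_inner_self_eq_norm_sq, hn]; norm_num
  ext i
  have hφ : HasStrictFDerivAt (fun z => (EuclideanSpace.proj i : E3 →L[ℝ] ℝ) (Up z - Um z))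
      ((EuclideanSpace.proj i : E3 →L[ℝ] ℝ).comp (fderiv ℝ Up x - fderiv ℝ Um x)) x :=
    (EuclideanSpace.proj i : E3 →L[ℝ] ℝ).hasStrictFDerivAt.comp x (hsp.sub hsm)
  -- Since `Up - Um` vanishes on `Γ`, each of its components is constant on the level set of `g`,
  -- hence trivially extremal there. The Lagrange multiplier rule then makes its derivative
  -- proportional to that of `g`.
  have hext : IsLocalExtrOn (fun z => (EuclideanSpace.proj i : E3 →L[ℝ] ℝ) (Up z - Um z))
      {z | g z = g x} x := by
    refine Or.inl ?_
    have hz : ∀ z ∈ Γ, Up z - Um z = 0 := fun z hz => by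
      rw [← h.plus (Or.inr hz), ← h.minus (Or.inr hz), sub_self]
    filter_upwards [self_mem_nhdsWithin, mem_nhdsWithin_of_mem_nhds (hVo.mem_nhds hxV)] with z h1 h2
    have : z ∈ Γ := (hV z h2).1.2 (by rw [← hgx]; exact h1)
    rw [hz z this, hz x hx]
  obtain ⟨a, b, hab, he⟩ := hext.exists_multipliers_of_hasStrictFDerivAt_1d hgs hφ
  have he' : ∀ y, a * (‖gradient g x‖ * inner ℝ (n x) y) +
      b * (fderiv ℝ Up x y i - fderiv ℝ Um x y i) = 0 := by
    intro y
    have := DFunLike.congr_fun he y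
    simpa [hgd] using this
  have h1 := he' y
  have h2 := he' (n x)
  rw [hnn, mul_one] at h2
  -- Otherwise the multiplier relation would force `∇g x = 0`.
  have hb : b ≠ 0 := by
    rintro rfl
    have : a * ‖gradient g x‖ = 0 := by simpa using h2
    rcases mul_eq_zero.1 this with h0 | h0
    · exact hab (by simp [h0])
    · exact hnorm.ne' h0
  simp only [PiLp.add_apply, PiLp.smul_apply, PiLp.sub_apply, smul_eq_mul]
  have h3 : b * (fderiv ℝ Up x y i - (fderiv ℝ Um x y i +
      inner ℝ (n x) y * (fderiv ℝ Up x (n x) i - fderiv ℝ Um x (n x) i))) = 0 := by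
    linear_combination h1 - inner ℝ (n x) y * h2
  exact sub_eq_zero.1 ((mul_eq_zero.1 h3).resolve_left hb)

/-- The piecewise linear map with gradient `A` where `⟪ν, q⟫ ≤ 0` and `A + a ⊗ ν` elsewhere. -/
noncomputable def kinked (A : E3 →L[ℝ] E3) (a ν q : E3) : E3 := A q + max (inner ℝ ν q) 0 • a

lemma IsGlued.blow_tendsto (h : IsGlued Ωp Ωm Γ u Up Um)
    (hΩ : IsTwoPhaseComposite Ω Ωp Ωm Γ n) (hUp : ContDiffOn ℝ 1 Up Ω) (hUm : ContDiffOn ℝ 1 Um Ω)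
    {x : E3} (hx : x ∈ Γ) (q : E3) :
    Tendsto (fun δ => blow u x δ q) (𝓝[>] 0)
      (𝓝 (kinked (fderiv ℝ Um x) (fderiv ℝ Up x (n x) - fderiv ℝ Um x (n x)) (n x) q)) := by
  have ho := hΩ.isOpen_domain
  have hxΩ := hΩ.mem_domain hx
  have hp := tendsto_slope_line (hasFDerivAt_of_contDiffOn ho hUp hxΩ) q
  have hm := tendsto_slope_line (hasFDerivAt_of_contDiffOn ho hUm hxΩ) q
  have hj := h.fderiv_jump hΩ hUp hUm hx q
  have hblow_p : ∀ δ : ℝ, x + δ • q ∈ Ωp ∪ Γ →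
      blow u x δ q = δ⁻¹ • (Up (x + δ • q) - Up x) := fun δ hδ => by
    rw [blow, h.plus hδ, h.plus (Or.inr hx)]
  have hblow_m : ∀ δ : ℝ, x + δ • q ∈ Ωm ∪ Γ →
      blow u x δ q = δ⁻¹ • (Um (x + δ • q) - Um x) := fun δ hδ => by
    rw [blow, h.minus hδ, h.minus (Or.inr hx)]
  rcases lt_trichotomy (inner ℝ (n x) q) 0 with hq | hq | hq
  · rw [kinked, max_eq_right hq.le, zero_smul, add_zero]
    refine hm.congr' ?_
    filter_upwards [hΩ.eventually_minus hx hq] with δ hδ using (hblow_m δ (Or.inl hδ)).symm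
  -- In a tangential direction nothing tells in which phase `x + δ • q` lies. It does not matter,
  -- since both difference quotients have the same limit.
  · rw [hq, zero_smul, add_zero] at hj
    rw [kinked, hq, max_self, zero_smul, add_zero]
    rw [hj] at hp
    rw [Metric.tendsto_nhds] at *
    intro ε hε
    filter_upwards [hp ε hε, hm ε hε, (tendsto_add_smul x q).eventually (ho.mem_nhds hxΩ)]
      with δ h1 h2 h3
    rcases hΩ.mem_cases h3 with hy | hy | hy
    · rwa [hblow_p δ (Or.inl hy)]
    · rwa [hblow_m δ (Or.inl hy)]
    · rwa [hblow_m δ (Or.inr hy)]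
  · rw [kinked, max_eq_left hq.le, ← hj]
    refine hp.congr' ?_
    filter_upwards [hΩ.eventually_plus hx hq] with δ hδ using (hblow_p δ (Or.inl hδ)).symm

lemma lipOn_kinked (A : E3 →L[ℝ] E3) (a ν : E3) (s : Set E3) :
    LipOn (‖A‖ + ‖ν‖ * ‖a‖) (kinked A a ν) s := by
  intro x _ y _
  have e : kinked A a ν x - kinked A a ν y =
      A (x - y) + (max (inner ℝ ν x) 0 - max (inner ℝ ν y) 0) • a := by
    rw [kinked, kinked, map_sub, sub_smul]; abel
  rw [e]
  have h1 : |max (inner ℝ ν x) 0 - max (inner ℝ ν y) 0| ≤ ‖ν‖ * ‖x - y‖ := by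
    refine (abs_max_sub_max_le_abs _ _ _).trans ?_
    rw [← inner_sub_right]
    exact abs_real_inner_le_norm _ _
  calc _ ≤ ‖A (x - y)‖ + ‖(max (inner ℝ ν x) 0 - max (inner ℝ ν y) 0) • a‖ := norm_add_le _ _
    _ ≤ ‖A‖ * ‖x - y‖ + (‖ν‖ * ‖x - y‖) * ‖a‖ := by
        rw [norm_smul]
        gcongr
        · exact A.le_opNorm _
        · exact h1
    _ = _ := by ring

end jump

/-! ### Second differences of integrals over slabs -/

/-- The centred second difference of `Q` at `t` with increment `s`. -/
def secondDiff (Q : ℝ → ℝ) (s t : ℝ) : ℝ := Q (s + t) + Q (-s + t) - 2 * Q t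

lemma abs_secondDiff_posPart_le {s : ℝ} (hs : 0 < s) (t : ℝ) :
    |secondDiff (fun t => max t 0) s t| ≤ 2 * s := by
  have h1 := abs_max_sub_max_le_abs (s + t) t 0
  have h2 := abs_max_sub_max_le_abs (-s + t) t 0
  rw [add_sub_cancel_right, abs_of_pos hs] at h1
  rw [add_sub_cancel_right, abs_neg, abs_of_pos hs] at h2
  have e : secondDiff (fun t => max t 0) s t =
      (max (s + t) 0 - max t 0) + (max (-s + t) 0 - max t 0) := by
    simp only [secondDiff]; ring
  rw [e]
  exact (abs_add_le _ _).trans (by linarith)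

lemma eventually_small {t : ℝ} (ht : t ≠ 0) : ∀ᶠ s in 𝓝[>] (0 : ℝ), 0 < s ∧ s < |t| := by
  filter_upwards [Ioo_mem_nhdsGT (abs_pos.2 ht)] with s hs using hs

lemma secondDiff_posPart_eq_zero {s t : ℝ} (h : s < |t|) (hs : 0 < s) :
    secondDiff (fun t => max t 0) s t = 0 := by
  simp only [secondDiff]
  rcases lt_abs.1 h with h | h
  · rw [max_eq_left (by linarith), max_eq_left (by linarith), max_eq_left (by linarith)]; ring
  · rw [max_eq_right (by linarith), max_eq_right (by linarith), max_eq_right (by linarith)]; ring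

/-- Functions on the line that are smooth enough away from a jump at the origin for the second
differences of their averages against kernels vanishing on the jump to be `o(s)`. -/
structure IsNiceJump (Q : ℝ → ℝ) (C : ℝ) : Prop where
  measurable : Measurable Q
  bound : ∀ t, |t| ≤ 2 → |Q t| ≤ C
  secondDiff_le : ∀ s t, 0 < s → s < |t| → |t| ≤ 1 → |secondDiff Q s t| ≤ C * s
  tendsto : ∀ t, t ≠ 0 → Tendsto (fun s => s⁻¹ * secondDiff Q s t) (𝓝[>] 0) (𝓝 0)

lemma IsNiceJump.nonneg {Q : ℝ → ℝ} {C : ℝ} (h : IsNiceJump Q C) : 0 ≤ C :=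
  (abs_nonneg _).trans (h.bound 0 (by norm_num))

/-- Integral over the unit ball of a kernel against a function of the normal coordinate. -/
noncomputable def slabInt (ν : E3) (Q : ℝ → ℝ) (k : E3 → E3) (s : ℝ) : E3 :=
  ∫ w in ball (0 : E3) 1, Q (s + inner ℝ ν w) • k w

section slab
variable {ν : E3} {Q : ℝ → ℝ} {k : E3 → E3} {C D : ℝ}

lemma abs_inner_unit_le (hν : ‖ν‖ = 1) (w : E3) : |inner ℝ ν w| ≤ ‖w‖ := by
  simpa [hν] using abs_real_inner_le_norm ν w

lemma integrableOn_slabInt (hν : ‖ν‖ = 1) (hQ : Measurable Q) (hb : ∀ t, |t| ≤ 2 → |Q t| ≤ C)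
    (hk : Measurable k) (hkD : ∀ w ∈ ball (0 : E3) 1, ‖k w‖ ≤ D * (‖w‖ ^ 2)⁻¹) {s : ℝ} (hs : |s| ≤ 1) :
    IntegrableOn (fun w => Q (s + inner ℝ ν w) • k w) (ball 0 1) := by
  have hC : 0 ≤ C := (abs_nonneg _).trans (hb 0 (by norm_num))
  refine integrableOn_ball_of_le_inv_sq (C := C * D)
    (Measurable.aestronglyMeasurable (by fun_prop)) fun w hw => ?_
  have h1 : ‖w‖ < 1 := by simpa using hw
  rw [norm_smul, mul_assoc]
  refine mul_le_mul (hb _ ?_) (hkD w hw) (norm_nonneg _) hC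
  exact (abs_add_le _ _).trans (by linarith [abs_inner_unit_le hν w])

lemma integral_add_sub_two_smul {F : Type*} [NormedAddCommGroup F] [NormedSpace ℝ F]
    {μ : Measure E3} {f g h : E3 → F} (hf : Integrable f μ) (hg : Integrable g μ)
    (hh : Integrable h μ) : ∫ w, f w ∂μ + ∫ w, g w ∂μ - (2 : ℝ) • ∫ w, h w ∂μ =
      ∫ w, (f w + g w - (2 : ℝ) • h w) ∂μ := by
  have hfg : Integrable (fun w => f w + g w) μ := hf.add hg
  have hh2 : Integrable (fun w => (2 : ℝ) • h w) μ := hh.smul 2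
  rw [integral_sub hfg hh2, integral_add hf hg, integral_smul]

lemma slabInt_secondDiff (hν : ‖ν‖ = 1) (hQ : Measurable Q) (hb : ∀ t, |t| ≤ 2 → |Q t| ≤ C)
    (hk : Measurable k) (hkD : ∀ w ∈ ball (0 : E3) 1, ‖k w‖ ≤ D * (‖w‖ ^ 2)⁻¹) {s : ℝ} (hs : |s| ≤ 1) :
    slabInt ν Q k s + slabInt ν Q k (-s) - (2 : ℝ) • slabInt ν Q k 0 =
      ∫ w in ball (0 : E3) 1, secondDiff Q s (inner ℝ ν w) • k w := by
  have h1 := integrableOn_slabInt hν hQ hb hk hkD hs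
  have h2 := integrableOn_slabInt hν hQ hb hk hkD (s := -s) (by rwa [abs_neg])
  have h3 := integrableOn_slabInt hν hQ hb hk hkD (s := 0) (by simp)
  rw [slabInt, slabInt, slabInt, integral_add_sub_two_smul h1 h2 h3]
  congr 1; ext1 w
  simp only [secondDiff, sub_smul, add_smul, mul_smul, zero_add]

/-- Dominated convergence: `hb` carries exactly the factor `s` that the division removes, and
pointwise convergence can fail only on the plane orthogonal to `ν`, a null set. -/
lemma tendsto_integral_secondDiff (hQ : Measurable Q) (hk : Measurable k)
    (hb : ∀ s w, 0 < s → s < 1 → w ∈ ball (0 : E3) 1 → w ≠ 0 →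
      |secondDiff Q s (inner ℝ ν w)| * ‖k w‖ ≤ s * (C * (‖w‖ ^ 2)⁻¹)) (hν : ν ≠ 0)
    (ht : ∀ t, t ≠ 0 → Tendsto (fun s => s⁻¹ * secondDiff Q s t) (𝓝[>] 0) (𝓝 0)) :
    Tendsto (fun s => s⁻¹ • ∫ w in ball (0 : E3) 1, secondDiff Q s (inner ℝ ν w) • k w) (𝓝[>] 0)
      (𝓝 0) := by
  simp only [← integral_smul]
  suffices h : Tendsto (fun s : ℝ => ∫ w in ball (0 : E3) 1,
      s⁻¹ • secondDiff Q s (inner ℝ ν w) • k w) (𝓝[>] 0) (𝓝 (∫ w in ball (0 : E3) 1, (0 : E3))) by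
    simpa using h
  refine tendsto_setIntegral_ball (C := C) (.of_forall fun s => ?_) ?_ ?_
  · simp only [secondDiff]
    exact Measurable.aestronglyMeasurable (by fun_prop)
  · filter_upwards [Ioo_mem_nhdsGT one_pos] with s hs w hw h0
    rw [norm_smul, norm_smul, norm_inv, Real.norm_eq_abs, abs_of_pos hs.1, Real.norm_eq_abs,
      inv_mul_le_iff₀ hs.1]
    exact hb s w hs.1 hs.2 hw h0
  · filter_upwards [ae_inner_add_ne_zero hν 0] with w hw _
    rw [zero_add] at hw
    have := (ht _ hw).smul_const (k w)
    simpa only [smul_smul, zero_smul] using this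

/-- The second difference of the positive part is at most `2s` and vanishes once `s < |t|`, so it is
of order `s` on a slab that shrinks to a plane. No symmetry of the kernel is needed. -/
lemma slabInt_secondDiff_posPart (hν : ‖ν‖ = 1) (hk : Measurable k)
    (hkD : ∀ w ∈ ball (0 : E3) 1, ‖k w‖ ≤ D * (‖w‖ ^ 2)⁻¹) :
    Tendsto (fun s => s⁻¹ • (slabInt ν (fun t => max t 0) k s + slabInt ν (fun t => max t 0) k (-s)
      - (2 : ℝ) • slabInt ν (fun t => max t 0) k 0)) (𝓝[>] 0) (𝓝 0) := by
  have hm : Measurable fun t : ℝ => max t 0 := by fun_prop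
  have hb : ∀ t : ℝ, |t| ≤ 2 → |max t 0| ≤ 2 := fun t ht => by
    rw [abs_of_nonneg (le_max_right _ _)]
    exact max_le ((le_abs_self t).trans ht) (by norm_num)
  have := tendsto_integral_secondDiff (ν := ν) (k := k) (C := 2 * D) hm hk ?_
    (norm_ne_zero_iff.1 (by rw [hν]; exact one_ne_zero)) ?_
  · refine this.congr' ?_
    filter_upwards [Ioo_mem_nhdsGT one_pos] with s hs
    rw [slabInt_secondDiff hν hm hb hk hkD (by rw [abs_of_pos hs.1]; exact hs.2.le)]
  · intro s w hs _ hw _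
    calc _ ≤ (2 * s) * (D * (‖w‖ ^ 2)⁻¹) :=
          mul_le_mul (abs_secondDiff_posPart_le hs _) (hkD w hw) (norm_nonneg _) (by positivity)
      _ = _ := by ring
  · intro t ht
    refine tendsto_const_nhds.congr' ?_
    filter_upwards [eventually_small ht] with s hs
    rw [secondDiff_posPart_eq_zero hs.2 hs.1, mul_zero]

/-- The rotation by `π` about the axis `ν`. -/
noncomputable def axisRotation (ν : E3) : E3 ≃ₗᵢ[ℝ] E3 := Submodule.reflection (ℝ ∙ ν)

lemma axisRotation_apply (hν : ‖ν‖ = 1) (w : E3) :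
    axisRotation ν w = -w + (2 * inner ℝ ν w) • ν := by
  rw [axisRotation, Submodule.reflection_singleton_apply, hν]
  simp only [RCLike.ofReal_real_eq_id, id, one_pow, div_one, mul_smul, two_smul]
  abel

lemma inner_axisRotation (hν : ‖ν‖ = 1) (w : E3) :
    inner ℝ ν (axisRotation ν w) = inner ℝ ν w := by
  rw [axisRotation_apply hν, inner_add_right, inner_neg_right, inner_smul_right,
    real_inner_self_eq_norm_sq, hν]
  ring

/-- A jump of `Q` would by itself allow second differences of order one in a slab of width `s`,
hence a contribution of order `s`. What makes it `o(s)` is `hsym`: the half-turn about `ν` preserves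
`⟪ν, w⟫`, so only the symmetrised kernel counts, and that one vanishes on the plane of the jump. -/
lemma slabInt_secondDiff_niceJump (hν : ‖ν‖ = 1) (hQ : IsNiceJump Q C) (hk : Measurable k)
    (hkD : ∀ w ∈ ball (0 : E3) 1, ‖k w‖ ≤ D * (‖w‖ ^ 2)⁻¹)
    (hsym : ∀ w ∈ ball (0 : E3) 1, ‖k w + k (axisRotation ν w)‖ ≤ D * |inner ℝ ν w| * (‖w‖ ^ 2)⁻¹) :
    Tendsto (fun s => s⁻¹ • (slabInt ν Q k s + slabInt ν Q k (-s)
      - (2 : ℝ) • slabInt ν Q k 0)) (𝓝[>] 0) (𝓝 0) := by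
  set k' : E3 → E3 := fun w => k w + k (axisRotation ν w) with hk'
  have hC := hQ.nonneg
  have hkR : Measurable fun w => k (axisRotation ν w) :=
    hk.comp (axisRotation ν).continuous.measurable
  have hkRD : ∀ w ∈ ball (0 : E3) 1, ‖k (axisRotation ν w)‖ ≤ D * (‖w‖ ^ 2)⁻¹ := fun w hw => by
    simpa using hkD (axisRotation ν w) (by simpa using hw)
  have hkm' : Measurable k' := hk.add hkR
  have hk'D : ∀ w ∈ ball (0 : E3) 1, ‖k' w‖ ≤ (D + D) * (‖w‖ ^ 2)⁻¹ := fun w hw => by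
    rw [add_mul]
    exact (norm_add_le _ _).trans (add_le_add (hkD w hw) (hkRD w hw))
  have hI : ∀ s, |s| ≤ 1 → slabInt ν Q k s = (2 : ℝ)⁻¹ • slabInt ν Q k' s := by
    intro s hs
    have e : slabInt ν Q (fun w => k (axisRotation ν w)) s = slabInt ν Q k s := by
      rw [slabInt, slabInt, ← setIntegral_ball_comp_isometry (axisRotation ν)
        (fun w => Q (s + inner ℝ ν w) • k w)]
      simp only [inner_axisRotation hν]
    have e2 : slabInt ν Q k' s = slabInt ν Q k s + slabInt ν Q (fun w => k (axisRotation ν w)) s := by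
      rw [slabInt, slabInt, slabInt, ← integral_add
        (integrableOn_slabInt hν hQ.measurable hQ.bound hk hkD hs)
        (integrableOn_slabInt hν hQ.measurable hQ.bound hkR hkRD hs)]
      simp only [hk', smul_add]
    rw [e2, e, ← two_smul ℝ, smul_smul, inv_mul_cancel₀ two_ne_zero, one_smul]
  have := tendsto_integral_secondDiff (ν := ν) (k := k') (C := 4 * C * D) hQ.measurable hkm' ?_
    (norm_ne_zero_iff.1 (by rw [hν]; exact one_ne_zero)) hQ.tendsto
  · have h2 := this.const_smul ((2 : ℝ)⁻¹)
    rw [smul_zero] at h2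
    refine h2.congr' ?_
    filter_upwards [Ioo_mem_nhdsGT one_pos] with s hs
    have hs1 : |s| ≤ 1 := by rw [abs_of_pos hs.1]; exact hs.2.le
    rw [← slabInt_secondDiff hν hQ.measurable hQ.bound hkm' hk'D hs1,
      hI s hs1, hI (-s) (by rwa [abs_neg]), hI 0 (by simp)]
    module
  · intro s w hs hs1 hw h0
    have hw1 : ‖w‖ < 1 := by simpa using hw
    have ht := (abs_inner_unit_le hν w)
    have hD : 0 ≤ D * (‖w‖ ^ 2)⁻¹ := (norm_nonneg _).trans (hkD w hw)
    rcases lt_or_ge s |inner ℝ ν w| with h | h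
    · calc _ ≤ (C * s) * (D * |inner ℝ ν w| * (‖w‖ ^ 2)⁻¹) :=
            mul_le_mul (hQ.secondDiff_le s _ hs h (by linarith)) (hsym w hw) (norm_nonneg _)
              (by positivity)
        _ = |inner ℝ ν w| * (s * (C * (D * (‖w‖ ^ 2)⁻¹))) := by ring
        _ ≤ 4 * (s * (C * (D * (‖w‖ ^ 2)⁻¹))) := by
            refine mul_le_mul_of_nonneg_right (by linarith) (by positivity)
        _ = _ := by ring
    -- Within distance `s` of the jump only the crude bound by `4C` holds, and the factor `|⟪ν, w⟫|
    -- ≤ s` of the symmetrised kernel supplies the missing order.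
    · have h1 : |secondDiff Q s (inner ℝ ν w)| ≤ 4 * C := by
        have b1 := hQ.bound (s + inner ℝ ν w) ((abs_add_le _ _).trans (by
          rw [abs_of_pos hs]; linarith))
        have b2 := hQ.bound (-s + inner ℝ ν w) ((abs_add_le _ _).trans (by
          rw [abs_neg, abs_of_pos hs]; linarith))
        have b3 := hQ.bound (inner ℝ ν w) (by linarith)
        rw [abs_le] at *
        simp only [secondDiff]
        constructor <;> linarith
      calc _ ≤ (4 * C) * (D * |inner ℝ ν w| * (‖w‖ ^ 2)⁻¹) :=
            mul_le_mul h1 (hsym w hw) (norm_nonneg _) (by positivity)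
        _ = |inner ℝ ν w| * (4 * C * (D * (‖w‖ ^ 2)⁻¹)) := by ring
        _ ≤ s * (4 * C * (D * (‖w‖ ^ 2)⁻¹)) :=
            mul_le_mul_of_nonneg_right h (by positivity)
        _ = _ := by ring

end slab

/-! ### The averaged kink -/

section averaged
variable {ν : E3}

/-- The normal component of the nonlocal gradient of the positive part of the normal coordinate. -/
noncomputable def kinkGrad (ν : E3) (t : ℝ) : ℝ :=
  ∫ v in ball (0 : E3) 1, ((‖v‖ ^ 2)⁻¹ * inner ℝ ν v) * max (t + inner ℝ ν v) 0

lemma abs_kinkGrad_kernel_le (hν : ‖ν‖ = 1) {v : E3} (hv : v ∈ ball (0 : E3) 1) :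
    |(‖v‖ ^ 2)⁻¹ * inner ℝ ν v| ≤ (‖v‖ ^ 2)⁻¹ := by
  have h1 : ‖v‖ < 1 := by simpa using hv
  rw [abs_mul, abs_of_nonneg (by positivity)]
  exact mul_le_of_le_one_right (by positivity) ((abs_inner_unit_le hν v).trans h1.le)

lemma integrableOn_kinkGrad (hν : ‖ν‖ = 1) (t : ℝ) : IntegrableOn (fun v : E3 =>
    ((‖v‖ ^ 2)⁻¹ * inner ℝ ν v) * max (t + inner ℝ ν v) 0) (ball 0 1) := by
  refine integrableOn_ball_of_le_inv_sq (C := |t| + 1)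
    (Measurable.aestronglyMeasurable (by fun_prop)) fun v hv => ?_
  have h1 : ‖v‖ < 1 := by simpa using hv
  rw [norm_mul, mul_comm (|t| + 1)]
  refine mul_le_mul (abs_kinkGrad_kernel_le hν hv) ?_ (norm_nonneg _) (by positivity)
  rw [Real.norm_eq_abs, abs_of_nonneg (le_max_right _ _)]
  refine max_le ?_ (by positivity)
  linarith [le_abs_self t, le_abs_self (inner ℝ ν v), abs_inner_unit_le hν v]

lemma abs_kinkGrad_sub_le (hν : ‖ν‖ = 1) (t t' : ℝ) :
    |kinkGrad ν t - kinkGrad ν t'| ≤ |t - t'| * invSqMass := by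
  rw [kinkGrad, kinkGrad, ← integral_sub (integrableOn_kinkGrad hν t) (integrableOn_kinkGrad hν t'),
    ← Real.norm_eq_abs]
  refine norm_setIntegral_ball_le fun v hv _ => ?_
  rw [← mul_sub, norm_mul, mul_comm |t - t'|]
  refine mul_le_mul (abs_kinkGrad_kernel_le hν hv) ?_ (norm_nonneg _) (by positivity)
  refine (abs_max_sub_max_le_abs _ _ _).trans (le_of_eq ?_)
  rw [add_sub_add_right_eq_sub]

/-- Averaging smooths the corner: the second difference of the positive part is of order `s` and
nonzero only for `v` with `|t + ⟪ν, v⟫| ≤ s`, which shrinks to a plane. Hence `o(s)` at every `t`,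
including `t = 0`. -/
lemma kinkGrad_secondDiff (hν : ‖ν‖ = 1) (t : ℝ) :
    Tendsto (fun s => s⁻¹ * secondDiff (kinkGrad ν) s t) (𝓝[>] 0) (𝓝 0) := by
  have e : ∀ s, s⁻¹ * secondDiff (kinkGrad ν) s t = ∫ v in ball (0 : E3) 1,
      s⁻¹ * (((‖v‖ ^ 2)⁻¹ * inner ℝ ν v) * secondDiff (fun t => max t 0) s (t + inner ℝ ν v)) := by
    intro s
    have h := integral_add_sub_two_smul (integrableOn_kinkGrad hν (s + t))
      (integrableOn_kinkGrad hν (-s + t)) (integrableOn_kinkGrad hν t)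
    rw [smul_eq_mul] at h
    rw [integral_const_mul, secondDiff, kinkGrad, kinkGrad, kinkGrad, h]
    congr 2; ext1 v
    simp only [secondDiff, add_assoc, smul_eq_mul]; ring
  simp only [e]
  suffices h : Tendsto (fun s : ℝ => ∫ v in ball (0 : E3) 1,
      s⁻¹ * (((‖v‖ ^ 2)⁻¹ * inner ℝ ν v) * secondDiff (fun t => max t 0) s (t + inner ℝ ν v)))
      (𝓝[>] 0) (𝓝 (∫ v in ball (0 : E3) 1, (0 : ℝ))) by
    simpa using h
  refine tendsto_setIntegral_ball (C := 2) (.of_forall fun s => ?_) ?_ ?_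
  · simp only [secondDiff]
    exact Measurable.aestronglyMeasurable (by fun_prop)
  · filter_upwards [self_mem_nhdsWithin] with s hs v hv _
    have hs : 0 < s := hs
    rw [norm_mul, norm_inv, Real.norm_eq_abs, abs_of_pos hs, inv_mul_le_iff₀ hs, norm_mul]
    calc _ ≤ (‖v‖ ^ 2)⁻¹ * (2 * s) := mul_le_mul (abs_kinkGrad_kernel_le hν hv)
          (abs_secondDiff_posPart_le hs _) (abs_nonneg _) (by positivity)
      _ = _ := by ring
  · have hν0 : ν ≠ 0 := norm_ne_zero_iff.1 (by rw [hν]; exact one_ne_zero)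
    filter_upwards [ae_inner_add_ne_zero hν0 (t • ν)] with v hv _
    rw [inner_add_right, inner_smul_right, real_inner_self_eq_norm_sq, hν, one_pow, mul_one] at hv
    refine tendsto_const_nhds.congr' ?_
    filter_upwards [eventually_small hv] with s hs
    rw [secondDiff_posPart_eq_zero hs.2 hs.1, mul_zero, mul_zero]

/-- When `s < |t|` the points `t - s`, `t`, `t + s` lie on the same side of the jump, so the step
factors out of the second difference. -/
lemma isNiceJump_step_mul {q : ℝ → ℝ} {L B : ℝ} (hL : ∀ t t', |q t - q t'| ≤ L * |t - t'|)
    (hB : ∀ t, |t| ≤ 2 → |q t| ≤ B)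
    (hq : ∀ t, Tendsto (fun s => s⁻¹ * secondDiff q s t) (𝓝[>] 0) (𝓝 0)) (c d : ℝ) :
    IsNiceJump (fun t => step c d t * q t) ((|c| + |d|) * (B + 2 * L)) := by
  have hB0 : 0 ≤ B := (abs_nonneg _).trans (hB 0 (by norm_num))
  have hL0 : 0 ≤ L := by simpa using (abs_nonneg _).trans (hL 1 0)
  have hcont : Continuous q := by
    have : LipschitzWith L.toNNReal q := LipschitzWith.of_dist_le_mul fun x y => by
      rw [Real.dist_eq, Real.dist_eq, Real.coe_toNNReal _ hL0]; exact hL x y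
    exact this.continuous
  have hsd : ∀ s t, 0 < s → s < |t| →
      secondDiff (fun t => step c d t * q t) s t = step c d t * secondDiff q s t := by
    intro s t hs hst
    rcases lt_abs.1 hst with h | h
    · have h1 : 0 < s + t := by linarith
      have h2 : 0 < -s + t := by linarith
      have h3 : 0 < t := by linarith
      simp only [secondDiff, step, h1, h2, h3, if_true]; ring
    · have h1 : ¬ 0 < s + t := by linarith
      have h2 : ¬ 0 < -s + t := by linarith
      have h3 : ¬ 0 < t := by linarith
      simp only [secondDiff, step, h1, h2, h3, if_false]; ring
  refine ⟨(measurable_step c d).mul hcont.measurable, fun t ht => ?_, fun s t hs hst _ => ?_,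
    fun t ht => ?_⟩
  · rw [abs_mul]
    exact mul_le_mul (abs_step_le c d t) ((hB t ht).trans (by linarith)) (abs_nonneg _)
      (by positivity)
  · rw [hsd s t hs hst, abs_mul, mul_assoc]
    refine mul_le_mul (abs_step_le c d t) ?_ (abs_nonneg _) (by positivity)
    have h1 := hL (s + t) t
    have h2 := hL (-s + t) t
    rw [add_sub_cancel_right, abs_of_pos hs] at h1
    rw [add_sub_cancel_right, abs_neg, abs_of_pos hs] at h2
    have e : secondDiff q s t = (q (s + t) - q t) + (q (-s + t) - q t) := by
      simp only [secondDiff]; ring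
    rw [e]
    refine (abs_add_le _ _).trans ?_
    nlinarith
  · have := (hq t).const_mul (step c d t)
    rw [mul_zero] at this
    refine this.congr' ?_
    filter_upwards [eventually_small ht] with s hs
    rw [hsd s t hs.1 hs.2]; ring

lemma exists_isNiceJump_kinkGrad (hν : ‖ν‖ = 1) (c d α γ : ℝ) :
    ∃ C, IsNiceJump (fun t => step c d t * (α + γ * kinkGrad ν t)) C := by
  refine ⟨_, isNiceJump_step_mul (L := |γ| * invSqMass)
    (B := |α| + |γ| * (2 * invSqMass + |kinkGrad ν 0|)) ?_ ?_ ?_ c d⟩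
  · intro t t'
    rw [add_sub_add_left_eq_sub, ← mul_sub, abs_mul, mul_assoc, mul_comm invSqMass]
    gcongr
    exact abs_kinkGrad_sub_le hν t t'
  · intro t ht
    have h1 := abs_kinkGrad_sub_le hν t 0
    rw [sub_zero] at h1
    have h2 : |kinkGrad ν t| ≤ 2 * invSqMass + |kinkGrad ν 0| := by
      have e : kinkGrad ν t = (kinkGrad ν t - kinkGrad ν 0) + kinkGrad ν 0 := by ring
      rw [e]
      refine (abs_add_le _ _).trans (add_le_add_left (h1.trans ?_) _)
      exact mul_le_mul_of_nonneg_right ht invSqMass_nonneg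
    refine (abs_add_le _ _).trans ?_
    rw [abs_mul]
    gcongr
  · intro t
    have := (kinkGrad_secondDiff hν t).const_mul γ
    rw [mul_zero] at this
    refine this.congr fun s => ?_
    simp only [secondDiff]; ring

end averaged

/-! ### Nonlocal gradient of a kinked map -/

section kinked
variable {ν a : E3} {A : E3 →L[ℝ] E3}

lemma integrableOn_posPart_kernel (hν : ‖ν‖ = 1) (t : ℝ) :
    IntegrableOn (fun v : E3 => ((‖v‖ ^ 2)⁻¹ * max (t + inner ℝ ν v) 0) • v) (ball 0 1) := by
  refine integrableOn_ball_of_le_inv_sq (C := |t| + 1)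
    (Measurable.aestronglyMeasurable (by fun_prop)) fun v hv => ?_
  have h1 : ‖v‖ < 1 := by simpa using hv
  rw [norm_smul, norm_mul, norm_inv, norm_pow, norm_norm, Real.norm_eq_abs,
    abs_of_nonneg (le_max_right _ _)]
  have h2 : max (t + inner ℝ ν v) 0 ≤ |t| + 1 :=
    max_le (by linarith [le_abs_self t, le_abs_self (inner ℝ ν v), abs_inner_unit_le hν v])
      (by positivity)
  calc _ ≤ (‖v‖ ^ 2)⁻¹ * (|t| + 1) * 1 := by gcongr
    _ = _ := by ring

/-- The half-turn about `ν` fixes the weight and reverses tangential components, so only the normal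
one survives. -/
lemma integral_posPart_kernel (hν : ‖ν‖ = 1) (t : ℝ) :
    ∫ v in ball (0 : E3) 1, ((‖v‖ ^ 2)⁻¹ * max (t + inner ℝ ν v) 0) • v = kinkGrad ν t • ν := by
  set f : E3 → E3 := fun v => ((‖v‖ ^ 2)⁻¹ * max (t + inner ℝ ν v) 0) • v with hf
  have hi : IntegrableOn f (ball 0 1) := integrableOn_posPart_kernel hν t
  have hR : ∫ v in ball (0 : E3) 1, f (axisRotation ν v) = ∫ v in ball (0 : E3) 1, f v :=
    setIntegral_ball_comp_isometry _ f 1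
  have hiR : IntegrableOn (fun v => f (axisRotation ν v)) (ball 0 1) := by
    have := ((axisRotation ν).measurePreserving.integrableOn_comp_preimage
      (axisRotation ν).toHomeomorph.measurableEmbedding (f := f) (s := ball 0 1)).2 hi
    convert! this using 1
    ext v; simp
  have hsum : ∀ v, f v + f (axisRotation ν v) =
      (2 * (((‖v‖ ^ 2)⁻¹ * inner ℝ ν v) * max (t + inner ℝ ν v) 0)) • ν := by
    intro v
    simp only [hf, inner_axisRotation hν, LinearIsometryEquiv.norm_map]
    rw [axisRotation_apply hν]
    module
  have h2 : (2 : ℝ) • ∫ v in ball (0 : E3) 1, f v = (2 : ℝ) • (kinkGrad ν t • ν) := by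
    rw [two_smul]
    nth_rewrite 2 [← hR]
    rw [← integral_add hi hiR]
    simp only [hsum]
    rw [integral_smul_const, integral_const_mul, kinkGrad, mul_smul]
  exact smul_right_injective _ two_ne_zero h2

/-- The linear part is reproduced up to the factor `|B₁|/3` of the second moment, and the kink
contributes a rank-one term depending on the normal coordinate alone. This is why the two nonlocal
terms of `unitStar` become slab integrals. -/
lemma nlGrad_kinked (hν : ‖ν‖ = 1) (A : E3 →L[ℝ] E3) (a y : E3) :
    nlGrad (kinked A a ν) y = (ballVol 1 / 3) • A +
      kinkGrad ν (inner ℝ ν y) • (innerSL ℝ ν).smulRight a := by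
  have hL : LipOn (‖A‖ + ‖ν‖ * ‖a‖) (kinked A a ν) (ball y 1) := lipOn_kinked A a ν _
  have hLA : LipOn (‖A‖ + ‖ν‖ * ‖(0 : E3)‖) (kinked A 0 ν) (ball y 1) := lipOn_kinked A 0 ν _
  have hA : nlGrad (kinked A 0 ν) y = (ballVol 1 / 3) • A := by
    rw [← nlGrad_sub_const hLA (A y), nlGrad, ← setIntegral_inv_sq_smulRight A]
    simp [kinked]
  have hdiff : ∀ v, (‖v‖ ^ 2)⁻¹ • (innerSL ℝ v).smulRight (kinked A a ν (y + v)) -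
      (‖v‖ ^ 2)⁻¹ • (innerSL ℝ v).smulRight (kinked A 0 ν (y + v)) =
      (‖v‖ ^ 2)⁻¹ • (innerSL ℝ v).smulRight (max (inner ℝ ν y + inner ℝ ν v) 0 • a) := by
    intro v
    ext
    simp [kinked, inner_add_right]
  have hsub : nlGrad (kinked A a ν) y - nlGrad (kinked A 0 ν) y =
      kinkGrad ν (inner ℝ ν y) • (innerSL ℝ ν).smulRight a := by
    have hi := (integrableOn_nlGrad hL).sub (integrableOn_nlGrad hLA)
    rw [nlGrad, nlGrad, ← integral_sub (integrableOn_nlGrad hL) (integrableOn_nlGrad hLA)]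
    have hi' : IntegrableOn (fun v => (‖v‖ ^ 2)⁻¹ • (innerSL ℝ v).smulRight
        (max (inner ℝ ν y + inner ℝ ν v) 0 • a)) (ball 0 1) := by
      refine hi.congr (.of_forall fun v => ?_)
      exact hdiff v
    simp only [hdiff]
    ext1 e
    rw [ContinuousLinearMap.integral_apply hi']
    have := congrArg (fun z : E3 => inner ℝ e z • a) (integral_posPart_kernel hν (inner ℝ ν y))
    simp only [inner_smul_right] at this
    rw [← integral_inner (integrableOn_posPart_kernel hν _), ← integral_smul_const] at this
    simp only [smul_apply, ContinuousLinearMap.smulRight_apply, innerSL_apply_apply]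
    rw [smul_smul, real_inner_comm e ν]
    rw [← this]
    congr 1; ext1 v
    rw [inner_smul_right, smul_smul, smul_smul, real_inner_comm]
    congr 1; ring
  rw [← hA, ← hsub]; abel

end kinked

/-! ### The modified operator detects kinks -/

section kink
variable {ν a : E3} {A : E3 →L[ℝ] E3}

lemma inv_pow_mul_norm_le {w : E3} (hw : w ∈ ball (0 : E3) 1) {L : ℝ} (hL : 0 ≤ L) :
    (‖w‖ ^ 4)⁻¹ * (L * ‖w‖ ^ 3) ≤ L * (‖w‖ ^ 2)⁻¹ := by
  have h1 : ‖w‖ < 1 := by simpa using hw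
  rcases eq_or_ne ‖w‖ 0 with h0 | h0
  · rw [h0]; simp
  · have : 0 < ‖w‖ := lt_of_le_of_ne (norm_nonneg _) h0.symm
    calc _ = L * (‖w‖ ^ 2)⁻¹ * ‖w‖ := by field_simp
      _ ≤ L * (‖w‖ ^ 2)⁻¹ * 1 := by gcongr
      _ = _ := by ring

lemma norm_cubic_sub_le (A : E3 →L[ℝ] E3) {x y : E3} {r : ℝ} (hx : ‖x‖ ≤ r) (hy : ‖y‖ ≤ r) :
    ‖(inner ℝ x (A x) : ℝ) • x - (inner ℝ y (A y) : ℝ) • y‖ ≤ 3 * ‖A‖ * r ^ 2 * ‖x - y‖ := by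
  have hr : 0 ≤ r := (norm_nonneg _).trans hx
  have e : (inner ℝ x (A x) : ℝ) • x - (inner ℝ y (A y) : ℝ) • y =
      (inner ℝ (x - y) (A x) : ℝ) • x + (inner ℝ y (A (x - y)) : ℝ) • x +
        (inner ℝ y (A y) : ℝ) • (x - y) := by
    rw [map_sub, inner_sub_left, inner_sub_right]; module
  have hA : ∀ z, ‖A z‖ ≤ ‖A‖ * ‖z‖ := A.le_opNorm
  have h1 : ‖(inner ℝ (x - y) (A x) : ℝ) • x‖ ≤ ‖x - y‖ * (‖A‖ * r) * r := by
    rw [norm_smul]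
    gcongr
    exact (norm_inner_le_norm _ _).trans (by gcongr; exact (hA x).trans (by gcongr))
  have h2 : ‖(inner ℝ y (A (x - y)) : ℝ) • x‖ ≤ r * (‖A‖ * ‖x - y‖) * r := by
    rw [norm_smul]
    gcongr
    exact (norm_inner_le_norm _ _).trans (by gcongr; exact hA _)
  have h3 : ‖(inner ℝ y (A y) : ℝ) • (x - y)‖ ≤ r * (‖A‖ * r) * ‖x - y‖ := by
    rw [norm_smul]
    gcongr
    exact (norm_inner_le_norm _ _).trans (by gcongr; exact (hA y).trans (by gcongr))
  rw [e]
  refine (norm_add₃_le).trans ((add_le_add (add_le_add h1 h2) h3).trans (le_of_eq ?_))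
  ring

/-- The kernel `‖w‖⁻⁴ ⟪w, A w⟫ w`. -/
noncomputable def cubicKernel (A : E3 →L[ℝ] E3) (w : E3) : E3 :=
  (‖w‖ ^ 4)⁻¹ • (inner ℝ w (A w) : ℝ) • w

lemma norm_cubicKernel_le (A : E3 →L[ℝ] E3) {w : E3} (hw : w ∈ ball (0 : E3) 1) :
    ‖cubicKernel A w‖ ≤ 6 * ‖A‖ * (‖w‖ ^ 2)⁻¹ := by
  have h : ‖(inner ℝ w (A w) : ℝ) • w‖ ≤ (3 * ‖A‖) * ‖w‖ ^ 3 := by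
    have := norm_cubic_sub_le A (x := w) (y := 0) le_rfl (by simp)
    simp only [inner_zero_left, zero_smul, sub_zero] at this
    exact this.trans (le_of_eq (by ring))
  rw [cubicKernel, norm_smul, norm_inv, norm_pow, norm_norm]
  calc _ ≤ (‖w‖ ^ 4)⁻¹ * ((3 * ‖A‖) * ‖w‖ ^ 3) := by gcongr
    _ ≤ 3 * ‖A‖ * (‖w‖ ^ 2)⁻¹ := inv_pow_mul_norm_le hw (by positivity)
    _ ≤ _ := by gcongr; norm_num

/-- The kernel is odd, so the sum is its difference between `w` and `-axisRotation ν w`. These are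
mirror images in the plane orthogonal to `ν`, at distance `2 |⟪ν, w⟫|`. -/
lemma norm_cubicKernel_add_le (hν : ‖ν‖ = 1) (A : E3 →L[ℝ] E3) (w : E3) :
    ‖cubicKernel A w + cubicKernel A (axisRotation ν w)‖ ≤
      6 * ‖A‖ * |inner ℝ ν w| * (‖w‖ ^ 2)⁻¹ := by
  have h := norm_cubic_sub_le A (x := w) (y := -axisRotation ν w) le_rfl (by simp)
  have e : w - -axisRotation ν w = (2 * inner ℝ ν w) • ν := by
    rw [axisRotation_apply hν]; module
  rw [e, norm_smul, hν, mul_one, norm_mul, Real.norm_two, Real.norm_eq_abs, map_neg,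
    inner_neg_neg, smul_neg, sub_neg_eq_add] at h
  rw [cubicKernel, cubicKernel, LinearIsometryEquiv.norm_map, ← smul_add, norm_smul, norm_inv,
    norm_pow, norm_norm]
  rcases eq_or_ne ‖w‖ 0 with h0 | h0
  · rw [h0]; simp
  · calc _ ≤ (‖w‖ ^ 4)⁻¹ * (3 * ‖A‖ * ‖w‖ ^ 2 * (2 * |inner ℝ ν w|)) := by gcongr
      _ = _ := by field_simp; ring

/-- The kernel `‖w‖⁻² A w`. -/
noncomputable def linearKernel (A : E3 →L[ℝ] E3) (w : E3) : E3 := (‖w‖ ^ 2)⁻¹ • A w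

lemma norm_linearKernel_le (A : E3 →L[ℝ] E3) {w : E3} (hw : w ∈ ball (0 : E3) 1) :
    ‖linearKernel A w‖ ≤ 2 * ‖A‖ * (‖w‖ ^ 2)⁻¹ := by
  have h1 : ‖w‖ < 1 := by simpa using hw
  have h2 : ‖A w‖ ≤ ‖A‖ := (A.le_opNorm w).trans (mul_le_of_le_one_right (norm_nonneg _) h1.le)
  rw [linearKernel, norm_smul, norm_inv, norm_pow, norm_norm, mul_comm]
  gcongr
  linarith [norm_nonneg A]

lemma norm_linearKernel_add_le (hν : ‖ν‖ = 1) (A : E3 →L[ℝ] E3) (w : E3) :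
    ‖linearKernel A w + linearKernel A (axisRotation ν w)‖ ≤
      2 * ‖A‖ * |inner ℝ ν w| * (‖w‖ ^ 2)⁻¹ := by
  have e : w + axisRotation ν w = (2 * inner ℝ ν w) • ν := by
    rw [axisRotation_apply hν]; module
  have h2 : ‖A ν‖ ≤ ‖A‖ := by simpa [hν] using A.le_opNorm ν
  rw [linearKernel, linearKernel, LinearIsometryEquiv.norm_map, ← smul_add, ← map_add, e, map_smul,
    norm_smul, norm_inv, norm_pow, norm_norm, norm_smul, norm_mul, Real.norm_two, Real.norm_eq_abs]
  calc _ ≤ (‖w‖ ^ 2)⁻¹ * (2 * |inner ℝ ν w| * ‖A‖) := by gcongr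
    _ = _ := by ring

/-- The kernel `‖w‖⁻⁴ ⟪w, a⟫ w`. -/
noncomputable def kinkKernel (a w : E3) : E3 := (‖w‖ ^ 4)⁻¹ • (inner ℝ w a : ℝ) • w

lemma norm_kinkKernel_le (a w : E3) : ‖kinkKernel a w‖ ≤ ‖a‖ * (‖w‖ ^ 2)⁻¹ := by
  rw [kinkKernel, norm_smul, norm_inv, norm_pow, norm_norm, norm_smul]
  have := norm_inner_le_norm (𝕜 := ℝ) w a
  rcases eq_or_ne ‖w‖ 0 with h0 | h0
  · rw [h0]; simp
  · calc _ ≤ (‖w‖ ^ 4)⁻¹ * ((‖w‖ * ‖a‖) * ‖w‖) := by gcongr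
      _ = _ := by field_simp

lemma measurable_cubicKernel (A : E3 →L[ℝ] E3) : Measurable (cubicKernel A) := by
  unfold cubicKernel; fun_prop

lemma measurable_linearKernel (A : E3 →L[ℝ] E3) : Measurable (linearKernel A) := by
  unfold linearKernel; fun_prop

lemma measurable_kinkKernel (a : E3) : Measurable (kinkKernel a) := by
  unfold kinkKernel; fun_prop

lemma inner_add_smul_unit (hν : ‖ν‖ = 1) (s : ℝ) (w : E3) :
    inner ℝ ν (s • ν + w) = s + inner ℝ ν w := by
  rw [inner_add_right, inner_smul_right, real_inner_self_eq_norm_sq, hν]; ring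

lemma step_mul_max (p q t : ℝ) : step p q t * max t 0 = p * max t 0 := by
  rcases lt_or_ge 0 t with h | h
  · rw [step, if_pos h]
  · rw [max_eq_right h]; ring

/-- Separates the kink at the integration point from the kink at the evaluation point. In the former
the step collapses to the constant `mp`, as the positive part lives on the plus side; the latter
leaves the prefactor `max s 0`, the one non-smooth dependence on `s` that survives. -/
lemma bondS_kinked (hν : ‖ν‖ = 1) (A : E3 →L[ℝ] E3) (a : E3) (mp mm : ℝ) {s : ℝ} (hs : |s| ≤ 1) :
    bondS (fun q => step mp mm (inner ℝ ν q)) (kinked A a ν) (s • ν) =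
      slabInt ν (step mp mm) (cubicKernel A) s +
      mp • slabInt ν (fun t => max t 0) (kinkKernel a) s -
      max s 0 • slabInt ν (step mp mm) (kinkKernel a) s := by
  have hb : ∀ t : ℝ, |t| ≤ 2 → |max t 0| ≤ 2 := fun t ht => by
    rw [abs_of_nonneg (le_max_right _ _)]
    exact max_le ((le_abs_self t).trans ht) (by norm_num)
  have i1 := integrableOn_slabInt hν (measurable_step mp mm) (fun t _ => abs_step_le mp mm t)
    (measurable_cubicKernel A) (fun w hw => norm_cubicKernel_le A hw) hs
  have i2 := integrableOn_slabInt hν (Q := fun t => max t 0) (by fun_prop) hb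
    (measurable_kinkKernel a) (fun w _ => norm_kinkKernel_le a w) hs
  have i3 := integrableOn_slabInt hν (measurable_step mp mm) (fun t _ => abs_step_le mp mm t)
    (measurable_kinkKernel a) (fun w _ => norm_kinkKernel_le a w) hs
  have i2' : IntegrableOn (fun w => mp • max (s + inner ℝ ν w) 0 • kinkKernel a w) (ball 0 1) :=
    i2.smul mp
  have i3' : IntegrableOn (fun w => max s 0 • step mp mm (s + inner ℝ ν w) • kinkKernel a w)
    (ball 0 1) := i3.smul (max s 0)
  have i4 : IntegrableOn (fun w => step mp mm (s + inner ℝ ν w) • cubicKernel A w +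
    mp • max (s + inner ℝ ν w) 0 • kinkKernel a w) (ball 0 1) := i1.add i2'
  rw [slabInt, slabInt, slabInt, ← integral_smul, ← integral_smul, ← integral_add i1 i2',
    ← integral_sub i4 i3', bondS]
  congr 1; ext1 w
  have e : kinked A a ν (s • ν + w) - kinked A a ν (s • ν) =
      A w + (max (s + inner ℝ ν w) 0 - max s 0) • a := by
    have h0 : (inner ℝ ν (s • ν) : ℝ) = s := by simpa using inner_add_smul_unit hν s 0
    rw [kinked, kinked, inner_add_smul_unit hν, h0, map_add]
    module
  rw [e, inner_add_smul_unit hν, inner_add_right, inner_smul_right]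
  have h := step_mul_max mp mm (s + inner ℝ ν w)
  simp only [cubicKernel, kinkKernel, smul_smul]
  rw [← add_smul, ← sub_smul]
  congr 1
  linear_combination (‖w‖ ^ 4)⁻¹ * inner ℝ w a * h

lemma dilT_kinked (hν : ‖ν‖ = 1) (A : E3 →L[ℝ] E3) (a : E3) (dp dm s : ℝ) :
    dilT (fun q => step dp dm (inner ℝ ν q)) (kinked A a ν) (s • ν) =
      slabInt ν (fun t => step dp dm t * (ballVol 1 / 3 * traceCLM A + inner ℝ ν a * kinkGrad ν t))
        (linearKernel (.id ℝ E3)) s := by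
  rw [slabInt, dilT]
  congr 1; ext1 w
  rw [nlGrad_kinked hν, inner_add_smul_unit hν, map_add, map_smul, map_smul, traceCLM_smulRight,
    linearKernel, ContinuousLinearMap.id_apply, smul_comm]
  simp only [smul_eq_mul]
  rw [mul_comm (kinkGrad ν _)]

lemma gradT_kinked (hν : ‖ν‖ = 1) (A : E3 →L[ℝ] E3) (a : E3) (mp mm : ℝ) {s : ℝ} (hs : |s| ≤ 1) :
    gradT (fun q => step mp mm (inner ℝ ν q)) (kinked A a ν) (s • ν) =
      slabInt ν (fun t => step mp mm t * (ballVol 1 / 3 + 0 * kinkGrad ν t)) (linearKernel A) s +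
      slabInt ν (fun t => step mp mm t * (0 + 1 * kinkGrad ν t))
        (linearKernel ((innerSL ℝ ν).smulRight a)) s := by
  obtain ⟨C1, h1⟩ := exists_isNiceJump_kinkGrad hν mp mm (ballVol 1 / 3) 0
  obtain ⟨C2, h2⟩ := exists_isNiceJump_kinkGrad hν mp mm 0 1
  rw [slabInt, slabInt, ← integral_add
    (integrableOn_slabInt hν h1.measurable h1.bound (measurable_linearKernel A)
      (fun w hw => norm_linearKernel_le A hw) hs)
    (integrableOn_slabInt hν h2.measurable h2.bound (measurable_linearKernel _)
      (fun w hw => norm_linearKernel_le _ hw) hs), gradT]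
  congr 1; ext1 w
  rw [nlGrad_kinked hν, inner_add_smul_unit hν, linearKernel, linearKernel]
  simp only [add_apply, smul_apply, ContinuousLinearMap.smulRight_apply, innerSL_apply_apply]
  module

/-- Over the points `s`, `-s`, `0`, the second difference of `max r 0 • N r` is exactly `s • N s`.
Moving it to the right and dividing by `s` leaves on the left only second-difference quotients. -/
lemma kink_combination {mp s : ℝ} (hs : 0 < s) {β γ : ℝ}
    {C K N D G₁ G₂ : ℝ → E3} {ν : E3}
    (h : ∀ r, |r| ≤ s → β • (C r + mp • K r - max r 0 • N r) +
      γ • (D r + inner ℝ (G₁ r + G₂ r) ν • ν) = 0) :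
    β • (s⁻¹ • (C s + C (-s) - (2 : ℝ) • C 0) + mp • s⁻¹ • (K s + K (-s) - (2 : ℝ) • K 0)) +
      γ • (s⁻¹ • (D s + D (-s) - (2 : ℝ) • D 0) +
        inner ℝ (s⁻¹ • (G₁ s + G₁ (-s) - (2 : ℝ) • G₁ 0) +
          s⁻¹ • (G₂ s + G₂ (-s) - (2 : ℝ) • G₂ 0)) ν • ν) = β • N s := by
  have h1 := h s (by rw [abs_of_pos hs])
  have h2 := h (-s) (by rw [abs_neg, abs_of_pos hs])
  have h3 := h 0 (by simpa using hs.le)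
  rw [max_eq_left hs.le] at h1
  rw [max_eq_right (by linarith)] at h2
  rw [max_self] at h3
  have h4 := congrArg (fun z => s⁻¹ • z) (congrArg₂ (· - ·) (congrArg₂ (· + ·) h1 h2)
    (congrArg (fun z => (2 : ℝ) • z) h3))
  simp only [smul_zero, add_zero, sub_zero] at h4
  rw [← sub_eq_zero, ← h4]
  simp only [inner_add_left, inner_sub_left, real_inner_smul_left]
  match_scalars <;> field_simp <;> ring

lemma tendsto_slabInt_step (hν : ‖ν‖ = 1) (mp mm : ℝ) (a : E3) :
    Tendsto (slabInt ν (step mp mm) (kinkKernel a)) (𝓝[>] 0)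
      (𝓝 (slabInt ν (step mp mm) (kinkKernel a) 0)) := by
  have hν0 : ν ≠ 0 := norm_ne_zero_iff.1 (by rw [hν]; exact one_ne_zero)
  refine tendsto_setIntegral_ball (C := (|mp| + |mm|) * ‖a‖) (.of_forall fun s => ?_)
    (.of_forall fun s w _ _ => ?_) ?_
  · have := measurable_step mp mm
    have := measurable_kinkKernel a
    exact Measurable.aestronglyMeasurable (by fun_prop)
  · rw [norm_smul, mul_assoc]
    exact mul_le_mul (abs_step_le mp mm _) (norm_kinkKernel_le a w) (norm_nonneg _) (by positivity)
  · filter_upwards [ae_inner_add_ne_zero hν0 0] with w hw _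
    rw [zero_add] at hw
    refine tendsto_const_nhds.congr' ?_
    filter_upwards [eventually_small hw] with s hs
    rcases lt_abs.1 hs.2 with h | h
    · simp only [step, zero_add]
      rw [if_pos (by linarith), if_pos (by linarith [hs.1])]
    · simp only [step, zero_add]
      rw [if_neg (by linarith [hs.1]), if_neg (by linarith)]

/-- Tested against `a`, the integrand is a positive modulus times `‖w‖⁻⁴ ⟪a, w⟫²`, positive almost
everywhere unless `a = 0`. This is where positivity of both shear moduli enters. -/
lemma eq_zero_of_slabInt_kinkKernel_eq_zero (hν : ‖ν‖ = 1) {mp mm : ℝ} (hmp : 0 < mp)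
    (hmm : 0 < mm) (h : slabInt ν (step mp mm) (kinkKernel a) 0 = 0) : a = 0 := by
  by_contra ha
  have hi := integrableOn_slabInt hν (measurable_step mp mm) (fun t _ => abs_step_le mp mm t)
    (measurable_kinkKernel a) (fun w _ => norm_kinkKernel_le a w) (s := 0) (by simp)
  have h1 : ∫ w in ball (0 : E3) 1,
      inner ℝ a (step mp mm (0 + inner ℝ ν w) • kinkKernel a w) = 0 := by
    rw [integral_inner hi]
    rw [slabInt] at h
    rw [h, inner_zero_right]
  have hpos : ∀ t, 0 < step mp mm t := fun t => by
    rw [step]; split_ifs <;> assumption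
  have e : ∀ w, inner ℝ a (step mp mm (0 + inner ℝ ν w) • kinkKernel a w) =
      step mp mm (0 + inner ℝ ν w) * ((‖w‖ ^ 4)⁻¹ * (inner ℝ a w : ℝ) ^ 2) := fun w => by
    rw [kinkKernel]
    simp only [inner_smul_right, real_inner_comm a w]; ring
  rw [setIntegral_eq_zero_iff_of_nonneg_ae] at h1
  · have h2 : ∀ᵐ w ∂(volume.restrict (ball (0 : E3) 1)), False := by
      filter_upwards [h1, ae_restrict_of_ae (ae_inner_add_ne_zero ha 0)] with w hw hw2
      rw [e w] at hw
      rw [zero_add] at hw2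
      have hw0 : w ≠ 0 := by rintro rfl; simp at hw2
      have := norm_pos_iff.2 hw0
      have h3 := hpos (0 + inner ℝ ν w)
      have : 0 < step mp mm (0 + inner ℝ ν w) * ((‖w‖ ^ 4)⁻¹ * (inner ℝ a w : ℝ) ^ 2) := by
        positivity
      exact this.ne' hw
    rw [ae_iff] at h2
    simp only [not_false_eq_true, Set.ofPred_true, Measure.restrict_apply_univ] at h2
    exact (measure_ball_pos volume (0 : E3) one_pos).ne' h2
  · refine .of_forall fun w => ?_
    simp only [Pi.zero_apply]
    rw [e w]
    have := (hpos (0 + inner ℝ ν w)).le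
    positivity
  · exact hi.const_inner a

/-- The operator at unit scale detects kinks: it can vanish on a piecewise linear map near the
interface only if the gradient of this map does not jump. -/
theorem eq_zero_of_unitStar_kinked_eq_zero (hν : ‖ν‖ = 1) {mp mm : ℝ} (hmp : 0 < mp)
    (hmm : 0 < mm) {dp dm : ℝ}
    (h : ∀ s ∈ Ioo (-1 : ℝ) 1, unitStar (fun q => step mp mm (inner ℝ ν q))
      (fun q => step dp dm (inner ℝ ν q)) (kinked A a ν) ν (s • ν) = 0) : a = 0 := by
  refine eq_zero_of_slabInt_kinkKernel_eq_zero hν hmp hmm ?_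
  obtain ⟨C₁, h₁⟩ := exists_isNiceJump_kinkGrad hν mp mm 1 0
  have hstep : (fun t => step mp mm t * (1 + 0 * kinkGrad ν t)) = step mp mm := by
    ext t; ring
  rw [hstep] at h₁
  obtain ⟨C₂, h₂⟩ := exists_isNiceJump_kinkGrad hν dp dm (ballVol 1 / 3 * traceCLM A) (inner ℝ ν a)
  obtain ⟨C₃, h₃⟩ := exists_isNiceJump_kinkGrad hν mp mm (ballVol 1 / 3) 0
  obtain ⟨C₄, h₄⟩ := exists_isNiceJump_kinkGrad hν mp mm 0 1
  have t₁ := slabInt_secondDiff_niceJump hν h₁ (measurable_cubicKernel A)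
    (fun w hw => norm_cubicKernel_le A hw) (fun w _ => norm_cubicKernel_add_le hν A w)
  have t₂ := slabInt_secondDiff_posPart hν (measurable_kinkKernel a)
    (fun w _ => norm_kinkKernel_le a w)
  have t₃ := slabInt_secondDiff_niceJump hν h₂ (measurable_linearKernel (.id ℝ E3))
    (fun w hw => norm_linearKernel_le _ hw) (fun w _ => norm_linearKernel_add_le hν _ w)
  have t₄ := slabInt_secondDiff_niceJump hν h₃ (measurable_linearKernel A)
    (fun w hw => norm_linearKernel_le _ hw) (fun w _ => norm_linearKernel_add_le hν _ w)
  have t₅ := slabInt_secondDiff_niceJump hν h₄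
    (measurable_linearKernel ((innerSL ℝ ν).smulRight a))
    (fun w hw => norm_linearKernel_le _ hw) (fun w _ => norm_linearKernel_add_le hν _ w)
  have hβ : (15 / ballVol 1 : ℝ) ≠ 0 := by
    have := ballVol_pos one_pos
    positivity
  have t₆ := Filter.Tendsto.inner (𝕜 := ℝ) (t₄.add t₅) (tendsto_const_nhds (x := ν))
  have key := ((t₁.add (t₂.const_smul mp)).const_smul (15 / ballVol 1)).add
    ((t₃.add (t₆.smul_const ν)).const_smul
      (45 / (4 * ballVol 1 ^ 2)))
  have lim := (tendsto_slabInt_step hν mp mm a).const_smul (15 / ballVol 1)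
  -- The left side of the combined identity tends to zero, the right side to a nonzero multiple of
  -- the slab integral at `0`.
  have h0 := tendsto_nhds_unique_of_eventuallyEq key lim ?_
  · simp only [smul_zero, add_zero, inner_zero_left, zero_smul] at h0
    exact (smul_eq_zero.1 h0.symm).resolve_left hβ
  · filter_upwards [Ioo_mem_nhdsGT one_pos] with s hs
    refine kink_combination (mp := mp) hs.1 (fun r hr => ?_)
    have hr1 : |r| < 1 := hr.trans_lt hs.2
    rw [← bondS_kinked hν A a mp mm hr1.le, ← dilT_kinked hν A a dp dm,
      ← gradT_kinked hν A a mp mm hr1.le]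
    exact h r (abs_lt.1 hr1)

end kink

/-! ### Blow-up limit and absence of a gradient jump -/

section blow_up
variable {Ω Ωp Ωm Γ : Set E3} {n u Up Um : E3 → E3} {lamp lamm mup mum M : ℝ}

lemma eventually_ball_subset {x : E3} (ho : IsOpen Ω) (hx : x ∈ Ω) (R : ℝ) :
    ∀ᶠ δ in 𝓝[>] (0 : ℝ), 0 < δ ∧ ball x (δ * R) ⊆ Ω := by
  obtain ⟨r, hr, hrΩ⟩ := Metric.isOpen_iff.1 ho x hx
  have h : Tendsto (fun δ : ℝ => δ * R) (𝓝[>] 0) (𝓝 0) := by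
    have : Continuous fun δ : ℝ => δ * R := by fun_prop
    have := this.tendsto 0
    rw [zero_mul] at this
    exact this.mono_left nhdsWithin_le_nhds
  filter_upwards [self_mem_nhdsWithin, h.eventually_lt_const hr] with δ h1 h2
  exact ⟨h1, (ball_subset_ball h2.le).trans hrΩ⟩

lemma add_smul_mem_ball {x q : E3} {δ R : ℝ} (hδ : 0 < δ) (hq : ‖q‖ < R) :
    x + δ • q ∈ ball x (δ * R) := by
  rw [mem_ball_iff_norm, add_sub_cancel_left, norm_smul, Real.norm_eq_abs, abs_of_pos hδ]
  gcongr

lemma IsTwoPhaseComposite.eventually_mem_extendedInterface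
    (hΩ : IsTwoPhaseComposite Ω Ωp Ωm Γ n) {x p : E3} (hx : x ∈ Γ) (hp : ‖p‖ < 1) :
    ∀ᶠ δ in 𝓝[>] (0 : ℝ), x + δ • p ∈ extendedInterface Ω Γ δ ∩ innerPart Ω (2 * δ) := by
  filter_upwards [eventually_ball_subset hΩ.isOpen_domain (hΩ.mem_domain hx) 3] with δ hδ
  have h1 := add_smul_mem_ball (x := x) hδ.1 hp
  rw [mul_one] at h1
  refine ⟨⟨hδ.2 (ball_subset_ball (by linarith [hδ.1]) h1),
    mem_thickening_iff.2 ⟨x, hx, h1⟩⟩, ?_⟩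
  refine (ball_subset_ball' ?_).trans hδ.2
  have := mem_ball.1 h1
  linarith

/-- For small `δ` the left side is exactly `unitStar` of the rescaled moduli and increments. The
increments inherit the gradient bound as a common Lipschitz constant, so each of the three
unit-scale operators passes to the limit. -/
lemma IsGlued.opStar_tendsto (h : IsGlued Ωp Ωm Γ u Up Um)
    (hΩ : IsTwoPhaseComposite Ω Ωp Ωm Γ n) (hUp : ContDiffOn ℝ 1 Up Ω) (hUm : ContDiffOn ℝ 1 Um Ω)
    (hM : ∀ x ∈ Ωp ∪ Ωm, ‖fderiv ℝ u x‖ ≤ M) {x p : E3} (hx : x ∈ Γ) (hp : ‖p‖ < 1) :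
    Tendsto (fun δ : ℝ => δ • opStar δ Ω Γ (twoPhase Ωm lamp lamm) (twoPhase Ωm mup mum) n u
        (x + δ • p)) (𝓝[>] 0)
      (𝓝 (unitStar (fun q => step mup mum (inner ℝ (n x) q))
        (fun q => step (lamp - mup) (lamm - mum) (inner ℝ (n x) q))
        (kinked (fderiv ℝ Um x) (fderiv ℝ Up x (n x) - fderiv ℝ Um x (n x)) (n x)) (n x) p)) := by
  set A := fderiv ℝ Um x
  set a := fderiv ℝ Up x (n x) - fderiv ℝ Um x (n x)
  have hn := hΩ.normal_ne_zero hx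
  set M' := max M (‖A‖ + ‖n x‖ * ‖a‖) with hM'
  have hM'0 : 0 ≤ M' := le_max_of_le_right (by positivity)
  have hkink : LipOn M' (kinked A a (n x)) (ball p 2) := fun y hy z hz =>
    (lipOn_kinked A a (n x) _ y hy z hz).trans (by gcongr; exact le_max_right _ _)
  -- The factor `3` below comes from `‖p‖ < 1` and the reach `2` of the iterated integrals.
  have hlip : ∀ᶠ δ in 𝓝[>] (0 : ℝ), LipOn M' (blow u x δ) (ball p 2) := by
    filter_upwards [eventually_ball_subset hΩ.isOpen_domain (hΩ.mem_domain hx) 3] with δ hδ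
    have hl := h.lipOn hΩ hUp hUm hM (convex_ball x (δ * 3)) hδ.2
    refine lipOn_blow hδ.1 (t := ball x (δ * 3)) (fun y hy z hz => (hl y hy z hz).trans
      (by gcongr; exact le_max_left _ _)) fun q hq => add_smul_mem_ball hδ.1 ?_
    have : q ∈ ball (0 : E3) (2 + 1) := ball_subset_ball' (by simpa using hp.le) hq
    rw [mem_ball_zero_iff] at this
    linarith
  have hmeas : ∀ cp cm δ : ℝ, Measurable fun q : E3 => twoPhase Ωm cp cm (x + δ • q) :=
    fun cp cm δ => (measurable_twoPhase hΩ.isOpen_minus cp cm).comp (by fun_prop)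
  have hbd : ∀ cp cm δ : ℝ, ∀ q : E3, |twoPhase Ωm cp cm (x + δ • q)| ≤ |cp| + |cm| :=
    fun cp cm δ q => abs_twoPhase_le cp cm _
  have hlim : ∀ cp cm : ℝ, ∀ᵐ w : E3, w ∈ ball (0 : E3) 1 →
      Tendsto (fun δ : ℝ => twoPhase Ωm cp cm (x + δ • (p + w))) (𝓝[>] 0)
        (𝓝 (step cp cm (inner ℝ (n x) (p + w)))) := fun cp cm => by
    filter_upwards [ae_inner_add_ne_zero hn p] with w hw _
    exact hΩ.tendsto_twoPhase hx hw cp cm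
  have hdiff : ∀ y, twoPhase Ωm lamp lamm y - twoPhase Ωm mup mum y =
      twoPhase Ωm (lamp - mup) (lamm - mum) y := fun y => by
    unfold twoPhase; split_ifs <;> rfl
  have hG : ∀ q, Tendsto (fun δ => blow u x δ q) (𝓝[>] 0) (𝓝 (kinked A a (n x) q)) :=
    h.blow_tendsto hΩ hUp hUm hx
  have h12 : ball p 1 ⊆ ball p 2 := ball_subset_ball (by norm_num)
  have t1 := bondS_tendsto (l := 𝓝[>] (0 : ℝ)) (p := p) hM'0 (hbd mup mum) (hmeas mup mum)
    (hlip.mono fun δ hδ => hδ.mono h12) (c := fun q => step mup mum (inner ℝ (n x) q))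
    (hlim mup mum) fun q _ => hG q
  have t2 := dilT_tendsto (l := 𝓝[>] (0 : ℝ)) (p := p) hM'0 (hbd _ _) (hmeas _ _)
    hlip hkink (c := fun q => step (lamp - mup) (lamm - mum) (inner ℝ (n x) q))
    (hlim _ _) fun q _ => hG q
  have t3 := gradT_tendsto (l := 𝓝[>] (0 : ℝ)) (p := p) hM'0 (hbd mup mum) (hmeas mup mum)
    hlip hkink (c := fun q => step mup mum (inner ℝ (n x) q)) (hlim mup mum) fun q _ => hG q
  -- Continuity at `x` of the extended normal is needed because the operator evaluates `n` at `x + δ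
  -- • p`, off `Γ` in general.
  have tn : Tendsto (fun δ : ℝ => n (x + δ • p)) (𝓝[>] 0) (𝓝 (n x)) :=
    (hΩ.normal_continuousAt x hx).tendsto.comp (tendsto_add_smul x p)
  have key := (t1.const_smul (15 / ballVol 1)).add ((t2.add
    ((Filter.Tendsto.inner (𝕜 := ℝ) t3 tn).smul tn)).const_smul (45 / (4 * ballVol 1 ^ 2)))
  refine key.congr' ?_
  filter_upwards [hlip, self_mem_nhdsWithin, hΩ.eventually_mem_extendedInterface hx hp]
    with δ h1 h2 h3
  rw [opStar_scale h2 hM'0 (measurable_twoPhase hΩ.isOpen_minus mup mum)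
    (abs_twoPhase_le mup mum) h3.1 h1]
  simp only [hdiff, unitStar]

/-- If the modified operator annihilates `u` near the interface, the gradient of `u` does not
jump. -/
lemma IsGlued.fderiv_eq_of_opStar_eq_zero (h : IsGlued Ωp Ωm Γ u Up Um)
    (hΩ : IsTwoPhaseComposite Ω Ωp Ωm Γ n) (hUp : ContDiffOn ℝ 1 Up Ω) (hUm : ContDiffOn ℝ 1 Um Ω)
    (hM : ∀ x ∈ Ωp ∪ Ωm, ‖fderiv ℝ u x‖ ≤ M) (hmup : 0 < mup) (hmum : 0 < mum)
    (hcond : ∀ᶠ δ in 𝓝[>] (0 : ℝ), ∀ x ∈ extendedInterface Ω Γ δ ∩ innerPart Ω (2 * δ),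
      opStar δ Ω Γ (twoPhase Ωm lamp lamm) (twoPhase Ωm mup mum) n u x = 0) {x : E3} (hx : x ∈ Γ) :
    fderiv ℝ Up x = fderiv ℝ Um x := by
  have ha : fderiv ℝ Up x (n x) - fderiv ℝ Um x (n x) = 0 := by
    -- Only evaluation points on the normal line are used. The condition `|s| < 1` keeps `x + δ • s
    -- • n x` in `Γ_δ`, where the hypothesis applies.
    refine eq_zero_of_unitStar_kinked_eq_zero (A := fderiv ℝ Um x) (dp := lamp - mup)
      (dm := lamm - mum) (hΩ.norm_normal hx) hmup hmum fun s hs => ?_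
    have hp : ‖s • n x‖ < 1 := by
      rw [norm_smul, hΩ.norm_normal hx, mul_one]; exact abs_lt.2 hs
    refine tendsto_nhds_unique_of_eventuallyEq (h.opStar_tendsto hΩ hUp hUm hM hx hp)
      tendsto_const_nhds ?_
    filter_upwards [hcond, hΩ.eventually_mem_extendedInterface hx hp] with δ h1 h2
    rw [h1 _ h2, smul_zero]
  ext1 y
  rw [h.fderiv_jump hΩ hUp hUm hx y, ha, smul_zero, add_zero]

end blow_up

/-! ### The limit on linear maps and the traction -/

section traction
variable {ν : E3}

/-- With `|B₁| = 4π/3`, the bond coefficient is `(15/|B₁|)(π/8) = 45/32`, and the other two are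
`(45/(4|B₁|²))(|B₁|/3)(π/2) = 45/32`. With equal weights, the `λ - μ` term and the trace in the bond
term combine to `λ`, and the full-gradient term cancels the purely normal part of the bond term. -/
lemma unitStar_linear (hν : ‖ν‖ = 1) (A : E3 →L[ℝ] E3) (lp lm mp mm : ℝ) :
    unitStar (fun q => step mp mm (inner ℝ ν q)) (fun q => step (lp - mp) (lm - mm) (inner ℝ ν q))
      (kinked A 0 ν) ν 0 = (45 / 32 : ℝ) •
        (((lp - lm) * traceCLM A) • ν + (mp - mm) • (A ν + A.adjoint ν)) := by
  have hk : kinked A 0 ν = A := by ext1 q; simp [kinked]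
  have hG : ∀ y, nlGrad (kinked A 0 ν) y = (ballVol 1 / 3) • A := fun y => by
    rw [nlGrad_kinked hν]; ext; simp
  have h1 : bondS (fun q => step mp mm (inner ℝ ν q)) (kinked A 0 ν) 0 =
      ((mp - mm) * (Real.pi / 8)) • (traceCLM A • ν + A ν + A.adjoint ν - inner ℝ ν (A ν) • ν) := by
    rw [← setIntegral_step_quartic mp mm ν hν A, bondS]
    simp only [zero_add, hk, map_zero, sub_zero]
  have h2 : dilT (fun q => step (lp - mp) (lm - mm) (inner ℝ ν q)) (kinked A 0 ν) 0 =
      (ballVol 1 / 3 * traceCLM A * (((lp - mp) - (lm - mm)) * (Real.pi / 2))) • ν := by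
    rw [mul_smul, ← setIntegral_step_inv_sq_smul (lp - mp) (lm - mm) ν hν, dilT, ← integral_smul]
    congr 1; ext1 w
    rw [hG, zero_add, map_smul, smul_eq_mul]; module
  have h3 : gradT (fun q => step mp mm (inner ℝ ν q)) (kinked A 0 ν) 0 =
      (ballVol 1 / 3 * ((mp - mm) * (Real.pi / 2))) • A ν := by
    have hi : IntegrableOn (fun w : E3 => (‖w‖ ^ 2)⁻¹ • step mp mm (inner ℝ ν w) • w)
        (ball 0 1) := by
      have := measurable_step mp mm
      refine integrableOn_ball_of_le_inv_sq (C := |mp| + |mm|)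
        (Measurable.aestronglyMeasurable (by fun_prop)) fun w hw => ?_
      have hw1 : ‖w‖ < 1 := by simpa using hw
      rw [norm_smul, norm_smul, norm_inv, norm_pow, norm_norm, Real.norm_eq_abs, mul_comm]
      have := abs_step_le mp mm (inner ℝ ν w)
      gcongr
      exact (mul_le_of_le_one_right (abs_nonneg _) hw1.le).trans this
    rw [mul_smul, ← map_smul, ← setIntegral_step_inv_sq_smul mp mm ν hν,
      ← ContinuousLinearMap.integral_comp_comm A hi, gradT, ← integral_smul]
    congr 1; ext1 w
    rw [hG, zero_add, smul_apply, map_smul, map_smul]; module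
  rw [unitStar, h1, h2, h3, ballVol_one, real_inner_smul_left, real_inner_comm (A ν) ν]
  have := Real.pi_ne_zero
  match_scalars <;> field_simp <;> ring

/-- The matrix of a linear map in the standard basis. -/
noncomputable def matrixOf (A : E3 →L[ℝ] E3) : Matrix (Fin 3) (Fin 3) ℝ :=
  Matrix.of fun i j => A (EuclideanSpace.single j 1) i

/-- The stress associated with the displacement gradient `A` and the moduli `l` and `m`. -/
noncomputable def stressOf (l m : ℝ) (A : E3 →L[ℝ] E3) : Matrix (Fin 3) (Fin 3) ℝ :=
  (l * (matrixOf A).trace) • (1 : Matrix (Fin 3) (Fin 3) ℝ) +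
    m • (matrixOf A + (matrixOf A).transpose)

lemma inner_single_left (i : Fin 3) (x : E3) :
    inner ℝ (EuclideanSpace.single i (1 : ℝ)) x = x i := by
  simp [EuclideanSpace.inner_single_left]

lemma trace_matrixOf (A : E3 →L[ℝ] E3) : (matrixOf A).trace = traceCLM A := by
  rw [traceCLM_apply (EuclideanSpace.basisFun (Fin 3) ℝ), Matrix.trace]
  refine Finset.sum_congr rfl fun i _ => ?_
  rw [EuclideanSpace.basisFun_apply, inner_single_left]
  rfl

lemma matrixOf_mulVec (A : E3 →L[ℝ] E3) (x : E3) : (matrixOf A).mulVec x = A x := by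
  ext i
  have h : A x = ∑ j, x j • A (EuclideanSpace.single j 1) := by
    conv_lhs => rw [← (EuclideanSpace.basisFun (Fin 3) ℝ).sum_repr' x]
    simp [inner_single_left]
  rw [h]
  simp [Matrix.mulVec, dotProduct, matrixOf, mul_comm]

lemma transpose_matrixOf (A : E3 →L[ℝ] E3) : (matrixOf A).transpose = matrixOf A.adjoint := by
  ext i j
  simp only [matrixOf, Matrix.transpose_apply, Matrix.of_apply]
  rw [← inner_single_left, ← inner_single_left, ContinuousLinearMap.adjoint_inner_right,
    real_inner_comm]

lemma toLp_stressOf_mulVec (l m : ℝ) (A : E3 →L[ℝ] E3) (x : E3) :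
    WithLp.toLp 2 ((stressOf l m A).mulVec x) =
      (l * traceCLM A) • x + m • (A x + A.adjoint x) := by
  ext i
  simp [stressOf, Matrix.add_mulVec, Matrix.smul_mulVec, transpose_matrixOf, matrixOf_mulVec,
    trace_matrixOf]

lemma stress_eq_stressOf (lam mu : E3 → ℝ) {u : E3 → E3} {x : E3} (hu : DifferentiableAt ℝ u x) :
    stress lam mu u x = stressOf (lam x) (mu x) (fderiv ℝ u x) := by
  have : grad u x = matrixOf (fderiv ℝ u x) := by
    ext i j
    have h : HasFDerivAt (fun y => u y i)
        ((EuclideanSpace.proj i : E3 →L[ℝ] ℝ).comp (fderiv ℝ u x)) x :=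
      (EuclideanSpace.proj i : E3 →L[ℝ] ℝ).hasFDerivAt.comp x hu.hasFDerivAt
    simp only [grad, pderiv, matrixOf, Matrix.of_apply]
    rw [h.fderiv]; rfl
  rw [stress, this, stressOf]

lemma continuous_stressOf (l m : ℝ) : Continuous (stressOf l m) := by
  have h : Continuous matrixOf := by
    refine continuous_matrix fun i j => ?_
    simp only [matrixOf, Matrix.of_apply]
    fun_prop
  have ht : Continuous fun A => (matrixOf A).trace := h.matrix_trace
  unfold stressOf
  fun_prop

end traction

/-! ### One-sided stresses and the interface condition -/

section interface
variable {Ω Ωp Ωm Γ : Set E3} {n u Up Um : E3 → E3} {lamp lamm mup mum M : ℝ}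

lemma twoPhase_plus (hΩ : IsTwoPhaseComposite Ω Ωp Ωm Γ n) (cp cm : ℝ) {y : E3} (hy : y ∈ Ωp) :
    twoPhase Ωm cp cm y = cp := if_neg fun h => hΩ.disjoint_phases.notMem_of_mem_left hy h

lemma twoPhase_minus (cp cm : ℝ) {y : E3} (hy : y ∈ Ωm) : twoPhase Ωm cp cm y = cm := if_pos hy

lemma IsGlued.tendsto_stress_plus (h : IsGlued Ωp Ωm Γ u Up Um)
    (hΩ : IsTwoPhaseComposite Ω Ωp Ωm Γ n) (hUp : ContDiffOn ℝ 1 Up Ω) {x : E3} (hx : x ∈ Ω) :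
    Tendsto (stress (twoPhase Ωm lamp lamm) (twoPhase Ωm mup mum) u) (𝓝[Ωp] x)
      (𝓝 (stressOf lamp mup (fderiv ℝ Up x))) := by
  have ho := hΩ.isOpen_domain
  have hc : ContinuousAt (fderiv ℝ Up) x :=
    (hUp.continuousOn_fderiv_of_isOpen ho le_rfl).continuousAt (ho.mem_nhds hx)
  refine (((continuous_stressOf lamp mup).tendsto _).comp
    (hc.tendsto.mono_left nhdsWithin_le_nhds)).congr' ?_
  filter_upwards [self_mem_nhdsWithin] with y hy
  have he := h.eventually_plus hΩ hy
  have hd := he.differentiableAt_iff.2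
    (hasFDerivAt_of_contDiffOn ho hUp (hΩ.plus_subset hy)).differentiableAt
  rw [stress_eq_stressOf _ _ hd, he.fderiv_eq, twoPhase_plus hΩ _ _ hy, twoPhase_plus hΩ _ _ hy]
  rfl

lemma IsGlued.tendsto_stress_minus (h : IsGlued Ωp Ωm Γ u Up Um)
    (hΩ : IsTwoPhaseComposite Ω Ωp Ωm Γ n) (hUm : ContDiffOn ℝ 1 Um Ω) {x : E3} (hx : x ∈ Ω) :
    Tendsto (stress (twoPhase Ωm lamp lamm) (twoPhase Ωm mup mum) u) (𝓝[Ωm] x)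
      (𝓝 (stressOf lamm mum (fderiv ℝ Um x))) := by
  have ho := hΩ.isOpen_domain
  have hc : ContinuousAt (fderiv ℝ Um) x :=
    (hUm.continuousOn_fderiv_of_isOpen ho le_rfl).continuousAt (ho.mem_nhds hx)
  refine (((continuous_stressOf lamm mum).tendsto _).comp
    (hc.tendsto.mono_left nhdsWithin_le_nhds)).congr' ?_
  filter_upwards [self_mem_nhdsWithin] with y hy
  have he := h.eventually_minus hΩ hy
  have hd := he.differentiableAt_iff.2
    (hasFDerivAt_of_contDiffOn ho hUm (hΩ.minus_subset hy)).differentiableAt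
  rw [stress_eq_stressOf _ _ hd, he.fderiv_eq, twoPhase_minus _ _ hy, twoPhase_minus _ _ hy]
  rfl

/-- The behaviour of the modified operator at the interface. -/
theorem IsGlued.interface_condition (h : IsGlued Ωp Ωm Γ u Up Um)
    (hΩ : IsTwoPhaseComposite Ω Ωp Ωm Γ n) (hUp : ContDiffOn ℝ 1 Up Ω) (hUm : ContDiffOn ℝ 1 Um Ω)
    (hM : ∀ x ∈ Ωp ∪ Ωm, ‖fderiv ℝ u x‖ ≤ M)
    (hcond : ∀ᶠ δ in 𝓝[>] (0 : ℝ), ∀ x ∈ extendedInterface Ω Γ δ ∩ innerPart Ω (2 * δ),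
      opStar δ Ω Γ (twoPhase Ωm lamp lamm) (twoPhase Ωm mup mum) n u x = 0)
    {x : E3} (hx : x ∈ Γ) (he : fderiv ℝ Up x = fderiv ℝ Um x) :
    ∃ Sp Sm : Matrix (Fin 3) (Fin 3) ℝ,
      Tendsto (stress (twoPhase Ωm lamp lamm) (twoPhase Ωm mup mum) u) (𝓝[Ωp] x) (𝓝 Sp) ∧
      Tendsto (stress (twoPhase Ωm lamp lamm) (twoPhase Ωm mup mum) u) (𝓝[Ωm] x) (𝓝 Sm) ∧
      Tendsto (fun δ : ℝ => δ • opStar δ Ω Γ (twoPhase Ωm lamp lamm) (twoPhase Ωm mup mum) n u x)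
        (𝓝[>] (0 : ℝ)) (𝓝 ((45 / 32 : ℝ) • WithLp.toLp 2 ((Sp - Sm).mulVec (n x)))) ∧
      (Sp - Sm).mulVec (n x) = 0 := by
  have hxΩ := hΩ.mem_domain hx
  have hlim := h.opStar_tendsto (lamp := lamp) (lamm := lamm) (mup := mup) (mum := mum) hΩ hUp hUm
    hM hx (p := 0) (by simp)
  -- Equal one-sided gradients remove the kink, so the blow-up limit is a linear map.
  simp only [he, sub_self, smul_zero, add_zero] at hlim
  have hval : (45 / 32 : ℝ) • WithLp.toLp 2 ((stressOf lamp mup (fderiv ℝ Up x) -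
      stressOf lamm mum (fderiv ℝ Um x)).mulVec (n x)) = unitStar
        (fun q => step mup mum (inner ℝ (n x) q))
        (fun q => step (lamp - mup) (lamm - mum) (inner ℝ (n x) q))
        (kinked (fderiv ℝ Um x) 0 (n x)) (n x) 0 := by
    rw [unitStar_linear (hΩ.norm_normal hx), Matrix.sub_mulVec, WithLp.toLp_sub,
      toLp_stressOf_mulVec, toLp_stressOf_mulVec, he]
    module
  rw [← hval] at hlim
  refine ⟨_, _, h.tendsto_stress_plus hΩ hUp hxΩ, h.tendsto_stress_minus hΩ hUm hxΩ, hlim, ?_⟩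
  have h0 := tendsto_nhds_unique_of_eventuallyEq hlim tendsto_const_nhds (b := 0) ?_
  · have h1 := (smul_eq_zero.1 h0).resolve_left (by norm_num)
    simpa using congrArg WithLp.ofLp h1
  · filter_upwards [hcond, hΩ.eventually_mem_extendedInterface hx (p := 0) (by simp)] with δ h1 h2
    rw [smul_zero, add_zero] at h2
    rw [h1 _ h2, smul_zero]

end interface

/-! ### Constant moduli and Taylor remainders -/

/-- The rescaled remainder of the first-order Taylor expansion of `u` at `x`. -/
noncomputable def taylorRem (u : E3 → E3) (x : E3) (δ : ℝ) (q : E3) : E3 :=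
  (δ ^ 2)⁻¹ • (u (x + δ • q) - u x - δ • fderiv ℝ u x q)

/-- The operator `ℒ^δ` with constant coefficients at unit scale. -/
noncomputable def unitL (l m : ℝ) (f : E3 → E3) : E3 :=
  (15 / ballVol 1) • bondS (fun _ => 2 * m) f 0 + (9 / ballVol 1 ^ 2) • dilT (fun _ => l - m) f 0

section affine
variable {f : E3 → E3} {M : ℝ}

lemma lipOn_clm (A : E3 →L[ℝ] E3) (s : Set E3) : LipOn ‖A‖ A s := fun x _ y _ => by
  rw [← map_sub]; exact A.le_opNorm _

lemma LipOn.smul_add_clm {s : Set E3} (hf : LipOn M f s) {r : ℝ} (hr : 0 ≤ r)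
    (A : E3 →L[ℝ] E3) : LipOn (r * M + ‖A‖) (fun q => r • f q + A q) s := fun x hx y hy => by
  have e : r • f x + A x - (r • f y + A y) = r • (f x - f y) + A (x - y) := by
    rw [map_sub]; module
  rw [e]
  refine (norm_add_le _ _).trans ?_
  rw [norm_smul, Real.norm_eq_abs, abs_of_nonneg hr, add_mul, mul_assoc]
  gcongr
  · exact hf x hx y hy
  · exact A.le_opNorm _

/-- For a constant coefficient the linear part gives an odd integrand. This absorbs the singular
factor `δ⁻¹` in the rescaled operator. -/
lemma bondS_const_smul_add_clm (hM : 0 ≤ M) (hf : LipOn M f (ball 0 1)) (c r : ℝ)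
    (A : E3 →L[ℝ] E3) :
    bondS (fun _ => c) (fun q => r • f q + A q) 0 = r • bondS (fun _ => c) f 0 := by
  have i1 := integrableOn_bondS (c := fun _ => c) hM (fun _ => le_rfl) aestronglyMeasurable_const hf
  have i2 := integrableOn_bondS (c := fun _ => c) (norm_nonneg A) (fun _ => le_rfl)
    aestronglyMeasurable_const (lipOn_clm A (ball 0 1))
  have hz : ∫ w in ball (0 : E3) 1, (‖w‖ ^ 4)⁻¹ • (c * inner ℝ w (A (0 + w) - A 0)) • w = 0 :=
    setIntegral_ball_odd _ (fun w => by simp) 1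
  have i1' : IntegrableOn (fun w : E3 => r • (‖w‖ ^ 4)⁻¹ •
    (c * inner ℝ w (f (0 + w) - f 0)) • w) (ball 0 1) := i1.smul r
  have h := integral_add i1' i2
  rw [integral_smul, hz, add_zero] at h
  rw [bondS, bondS, ← h]
  congr 1; ext1 w
  have e : r • f (0 + w) + A (0 + w) - (r • f 0 + A 0) =
      r • (f (0 + w) - f 0) + (A (0 + w) - A 0) := by module
  rw [e, inner_add_right, inner_smul_right]
  module

lemma nlGrad_clm (A : E3 →L[ℝ] E3) (y : E3) : nlGrad A y = (ballVol 1 / 3) • A := by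
  rw [← nlGrad_sub_const (lipOn_clm A _) (A y), nlGrad, ← setIntegral_inv_sq_smulRight A]
  simp

lemma nlGrad_smul_add_clm {y : E3} (hf : LipOn M f (ball y 1)) (r : ℝ) (A : E3 →L[ℝ] E3) :
    nlGrad (fun q => r • f q + A q) y = r • nlGrad f y + (ballVol 1 / 3) • A := by
  have i1 : IntegrableOn (fun v : E3 => r • (‖v‖ ^ 2)⁻¹ • (innerSL ℝ v).smulRight (f (y + v)))
    (ball 0 1) := (integrableOn_nlGrad hf).smul r
  have h := integral_add i1 (integrableOn_nlGrad (y := y) (lipOn_clm A _))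
  rw [integral_smul] at h
  rw [← nlGrad_clm A y, nlGrad, nlGrad, nlGrad, ← h]
  congr 1; ext1 v
  ext1 e
  simp only [smul_apply, add_apply, ContinuousLinearMap.smulRight_apply]
  module

lemma dilT_const_smul_add_clm (hM : 0 ≤ M) (hf : LipOn M f (ball 0 2)) (c r : ℝ)
    (A : E3 →L[ℝ] E3) :
    dilT (fun _ => c) (fun q => r • f q + A q) 0 = r • dilT (fun _ => c) f 0 := by
  have hz : ∫ w in ball (0 : E3) 1,
      (‖w‖ ^ 2)⁻¹ • (c * (ballVol 1 / 3 * traceCLM A)) • w = 0 :=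
    setIntegral_ball_odd _ (fun w => by simp) 1
  have i0 : IntegrableOn (fun w : E3 => (‖w‖ ^ 2)⁻¹ • (c * traceCLM (nlGrad f (0 + w))) • w)
      (ball 0 1) :=
    integrableOn_ball_of_le_inv_sq
      (aestronglyMeasurable_dilT (c := fun _ => c) aestronglyMeasurable_const hf)
      fun w hw => norm_dilT_kernel_le (c := fun _ => c) hM (fun _ => le_rfl) hf hw
  have i1 : IntegrableOn (fun w : E3 => r • (‖w‖ ^ 2)⁻¹ • (c * traceCLM (nlGrad f (0 + w))) • w)
    (ball 0 1) := i0.smul r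
  have i2 : IntegrableOn (fun w : E3 => (‖w‖ ^ 2)⁻¹ • (c * (ballVol 1 / 3 * traceCLM A)) • w)
      (ball 0 1) := by
    refine integrableOn_ball_of_le_inv_sq (C := |c * (ballVol 1 / 3 * traceCLM A)|)
      (Measurable.aestronglyMeasurable (by fun_prop)) fun w hw => ?_
    have hw1 : ‖w‖ < 1 := by simpa using hw
    rw [norm_smul, norm_smul, norm_inv, norm_pow, norm_norm, mul_comm]
    gcongr
    exact mul_le_of_le_one_right (norm_nonneg _) hw1.le
  have h := integral_add i1 i2
  rw [integral_smul, hz, add_zero] at h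
  rw [dilT, dilT, ← h]
  refine setIntegral_congr_fun measurableSet_ball fun w hw => ?_
  rw [nlGrad_smul_add_clm (hf.mono (ball_add_subset hw)), map_add, map_smul, map_smul]
  simp only [smul_eq_mul]
  module

lemma norm_unitL_le (l m : ℝ) (hM : 0 ≤ M) (hf : LipOn M f (ball 0 2)) :
    ‖unitL l m f‖ ≤ (15 / ballVol 1 * (|2 * m| * M * invSqMass)) +
      9 / ballVol 1 ^ 2 * (|l - m| * (‖traceCLM‖ * (M * invSqMass)) * invSqMass) := by
  have hβ := ballVol_pos one_pos
  have h1 : LipOn M f (ball 0 1) := hf.mono (ball_subset_ball (by norm_num))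
  refine (norm_add_le _ _).trans ?_
  rw [norm_smul, norm_smul, Real.norm_of_nonneg (by positivity), Real.norm_of_nonneg (by positivity)]
  gcongr
  · exact norm_setIntegral_ball_le fun w hw h0 =>
      norm_bondS_kernel_le (c := fun _ => 2 * m) hM (fun _ => le_rfl) h1 hw h0
  · exact norm_setIntegral_ball_le fun w hw _ =>
      norm_dilT_kernel_le (c := fun _ => l - m) hM (fun _ => le_rfl) hf hw

end affine

section taylor
variable {u : E3 → E3} {x : E3} {δ M : ℝ}

lemma blow_eq_taylorRem (hδ : 0 < δ) (q : E3) :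
    blow u x δ q = δ • taylorRem u x δ q + fderiv ℝ u x q := by
  rw [blow, taylorRem]
  match_scalars <;> field_simp
  ring

/-- The derivative at `q` is `δ⁻¹ (Du(x + δq) - Du(x))`, of norm at most `M ‖q‖ ≤ 2M`. Only a
Lipschitz gradient is used, so the ball may cross `Γ`. -/
lemma lipOn_taylorRem (hδ : 0 < δ) (hd : ∀ y ∈ ball x (2 * δ), DifferentiableAt ℝ u y)
    (hL : LipOn M (fderiv ℝ u) (ball x (2 * δ))) (hM : 0 ≤ M) :
    LipOn (2 * M) (taylorRem u x δ) (ball 0 2) := by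
  have hmem : ∀ q ∈ ball (0 : E3) 2, x + δ • q ∈ ball x (2 * δ) := fun q hq => by
    rw [mul_comm]; exact add_smul_mem_ball hδ (by simpa using hq)
  have hder : ∀ q ∈ ball (0 : E3) 2, HasFDerivWithinAt (taylorRem u x δ)
      (δ⁻¹ • (fderiv ℝ u (x + δ • q) - fderiv ℝ u x)) (ball 0 2) q := fun q hq => by
    have h1 : HasFDerivAt (fun q : E3 => x + δ • q) (δ • ContinuousLinearMap.id ℝ E3) q :=
      ((hasFDerivAt_id q).const_smul δ).const_add x
    have h2 := ((hd _ (hmem q hq)).hasFDerivAt.comp q h1).sub_const (u x)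
    have h3 := ((h2.sub ((fderiv ℝ u x).hasFDerivAt.const_smul δ)).const_smul (δ ^ 2)⁻¹)
    refine (h3.congr_fderiv ?_).hasFDerivWithinAt
    ext1 v
    simp only [smul_apply, sub_apply, ContinuousLinearMap.comp_apply, ContinuousLinearMap.id_apply,
      map_smul]
    match_scalars <;> field_simp
  intro y hy z hz
  refine (convex_ball (0 : E3) 2).norm_image_sub_le_of_norm_hasFDerivWithin_le hder
    (fun q hq => ?_) hz hy
  have h := hL _ (hmem q hq) x (mem_ball_self (by positivity))
  rw [add_sub_cancel_left, norm_smul, Real.norm_eq_abs, abs_of_pos hδ] at h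
  have hq2 : ‖q‖ < 2 := by simpa using hq
  rw [norm_smul, norm_inv, Real.norm_eq_abs, abs_of_pos hδ, inv_mul_le_iff₀ hδ]
  calc _ ≤ M * (δ * ‖q‖) := h
    _ ≤ M * (δ * 2) := by gcongr
    _ = _ := by ring

/-- Away from the interface, `ℒ^δ` only sees the second-order part of `u`. -/
lemma opL_eq_unitL (hδ : 0 < δ) (hd : ∀ y ∈ ball x (2 * δ), DifferentiableAt ℝ u y)
    (hL : LipOn M (fderiv ℝ u) (ball x (2 * δ))) (hM : 0 ≤ M) {lam mu : E3 → ℝ} {l m : ℝ}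
    (hlam : ∀ y ∈ ball x δ, lam y = l) (hmu : ∀ y ∈ ball x δ, mu y = m) :
    opL δ lam mu u x = unitL l m (taylorRem u x δ) := by
  have ht := lipOn_taylorRem hδ hd hL hM
  have ht1 : LipOn (2 * M) (taylorRem u x δ) (ball 0 1) := ht.mono (ball_subset_ball (by norm_num))
  have hb : blow u x δ = fun q => δ • taylorRem u x δ q + fderiv ℝ u x q :=
    funext fun q => blow_eq_taylorRem hδ q
  have hbl : LipOn (δ * (2 * M) + ‖fderiv ℝ u x‖) (blow u x δ) (ball 0 2) := by
    rw [hb]; exact ht.smul_add_clm hδ.le _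
  -- The moduli are sampled only within `δ` of `x`, while `u` is sampled within `2δ`. Hence avoiding
  -- `Γ_δ` suffices for constant moduli, even when `u` is sampled across `Γ`.
  have hmem : ∀ w ∈ ball (0 : E3) 1, x + δ • (0 + w) ∈ ball x δ := fun w hw => by
    have := add_smul_mem_ball (x := x) hδ (R := 1) (q := w) (by simpa using hw)
    rwa [mul_one, ← zero_add w] at this
  have hS := opS_scale (u := u) (x₀ := x) (p := 0) hδ mu
  have hD := opD_scale (x₀ := x) (p := 0) hδ lam mu hbl
  rw [smul_zero, add_zero] at hS hD
  have eS : bondS (fun q => mu x + mu (x + δ • q)) (blow u x δ) 0 =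
      bondS (fun _ => 2 * m) (blow u x δ) 0 := by
    refine setIntegral_congr_fun measurableSet_ball fun w hw => ?_
    simp only
    rw [hmu _ (hmem w hw), hmu x (mem_ball_self hδ), two_mul]
  have eD : dilT (fun q => lam (x + δ • q) - mu (x + δ • q)) (blow u x δ) 0 =
      dilT (fun _ => l - m) (blow u x δ) 0 := by
    refine setIntegral_congr_fun measurableSet_ball fun w hw => ?_
    simp only
    rw [hmu _ (hmem w hw), hlam _ (hmem w hw)]
  rw [opL, unitL, hS, hD, eS, eD, hb, bondS_const_smul_add_clm (by positivity) ht1,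
    dilT_const_smul_add_clm (by positivity) ht, smul_smul, smul_smul]
  congr 2 <;> field_simp

/-- The second-order Taylor formula with only one derivative of `Du` at `x`: subtract the quadratic
polynomial along the ray and apply the mean value inequality to the difference. -/
lemma tendsto_taylorRem {H : E3 →L[ℝ] E3 →L[ℝ] E3} (hd : ∀ᶠ y in 𝓝 x, DifferentiableAt ℝ u y)
    (hH : HasFDerivAt (fderiv ℝ u) H x) (q : E3) :
    Tendsto (fun δ => taylorRem u x δ q) (𝓝[>] 0) (𝓝 ((2 : ℝ)⁻¹ • H q q)) := by
  rw [Metric.tendsto_nhds]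
  intro ε hε
  have hline : Tendsto (fun h : ℝ => x + h • q) (𝓝 0) (𝓝 x) := by
    have : Continuous fun h : ℝ => x + h • q := by fun_prop
    simpa using this.tendsto 0
  -- Two factors `‖q‖` occur below, one from the increment and one from applying the derivative to
  -- `q`; the `+ 1` covers `q = 0`.
  have hlin := hline.eventually (hH.isLittleO.def (c := ε / 2 / (‖q‖ + 1) ^ 2) (by positivity))
  obtain ⟨r, hr, hball⟩ := Metric.eventually_nhds_iff.1 (hlin.and (hline.eventually hd))
  filter_upwards [Ioo_mem_nhdsGT hr] with δ hδ
  set g : ℝ → E3 := fun h => u (x + h • q) - h • fderiv ℝ u x q - (h ^ 2 / 2) • H q q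
  have hg : ∀ h ∈ Icc 0 δ, HasDerivWithinAt g
      ((fderiv ℝ u (x + h • q) - fderiv ℝ u x - H (h • q)) q) (Icc 0 δ) h := fun h hh => by
    have hdist : dist h 0 < r := by
      rw [Real.dist_0_eq_abs, abs_of_nonneg hh.1]; exact hh.2.trans_lt hδ.2
    have h1 : HasDerivAt (fun h : ℝ => x + h • q) q h := by
      simpa using ((hasDerivAt_id h).smul_const q).const_add x
    have h2 := (hball hdist).2.hasFDerivAt.comp_hasDerivAt h h1
    have h3 : HasDerivAt (fun h : ℝ => h • fderiv ℝ u x q) (fderiv ℝ u x q) h := by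
      simpa using (hasDerivAt_id h).smul_const (fderiv ℝ u x q)
    have h4 : HasDerivAt (fun h : ℝ => (h ^ 2 / 2) • H q q) (h • H q q) h := by
      have := (((hasDerivAt_id h).pow 2).div_const 2).smul_const (H q q)
      simpa using this
    refine ((h2.sub h3).sub h4).hasDerivWithinAt.congr_deriv ?_
    simp
  have hbd : ∀ h ∈ Ico 0 δ, ‖(fderiv ℝ u (x + h • q) - fderiv ℝ u x - H (h • q)) q‖ ≤
      ε / 2 * δ := fun h hh => by
    have hdist : dist h 0 < r := by
      rw [Real.dist_0_eq_abs, abs_of_nonneg hh.1]; exact hh.2.trans hδ.2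
    have h1 := (hball hdist).1
    rw [add_sub_cancel_left, norm_smul, Real.norm_eq_abs, abs_of_nonneg hh.1] at h1
    calc _ ≤ ‖fderiv ℝ u (x + h • q) - fderiv ℝ u x - H (h • q)‖ * ‖q‖ :=
          ContinuousLinearMap.le_opNorm _ _
      _ ≤ ε / 2 / (‖q‖ + 1) ^ 2 * (δ * (‖q‖ + 1)) * (‖q‖ + 1) := by
          have := hh.2.le
          have := hδ.1
          gcongr
          · refine h1.trans ?_
            gcongr
            linarith
          · linarith
      _ = _ := by field_simp
  have key := norm_image_sub_le_of_norm_deriv_le_segment' hg hbd δ (right_mem_Icc.2 hδ.1.le)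
  have hδ0 := hδ.1
  have e : taylorRem u x δ q - (2 : ℝ)⁻¹ • H q q = (δ ^ 2)⁻¹ • (g δ - g 0) := by
    simp only [taylorRem, g, zero_smul, add_zero, sub_zero]
    match_scalars <;> field_simp
    ring
  rw [dist_eq_norm, e, norm_smul, norm_inv, norm_pow, Real.norm_eq_abs, abs_of_pos hδ0,
    inv_mul_lt_iff₀ (by positivity)]
  calc _ ≤ ε / 2 * δ * (δ - 0) := key
    _ = δ ^ 2 * (ε / 2) := by ring
    _ < δ ^ 2 * ε := by gcongr; linarith

end taylor

/-! ### The constant-coefficient operator on quadratic maps -/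

/-- The divergence of the stress for the displacement with second derivative `H`. -/
noncomputable def navierOf (l m : ℝ) (H : E3 →L[ℝ] E3 →L[ℝ] E3) : E3 :=
  WithLp.toLp 2 fun i => ∑ j, stressOf l m (H (EuclideanSpace.single j 1)) i j

section quadratic
variable {H : E3 →L[ℝ] E3 →L[ℝ] E3} {M : ℝ}

/-- Expanding at `y + v`, the terms `H y y` and `H v v` are even in `v` and die against the odd
kernel. The cross term `H y v` is linear in `v`, and the second moment reproduces it. -/
lemma nlGrad_quadratic (hH : ∀ v w, H v w = H w v)
    {y : E3} (hL : LipOn M (fun q => (2 : ℝ)⁻¹ • H q q) (ball y 1)) :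
    nlGrad (fun q => (2 : ℝ)⁻¹ • H q q) y = (ballVol 1 / 3) • H y := by
  have i1 := integrableOn_nlGrad hL
  have i2 : IntegrableOn (fun v => (‖v‖ ^ 2)⁻¹ • (innerSL ℝ v).smulRight (H y v)) (ball 0 1) := by
    simpa using integrableOn_nlGrad (y := 0) (lipOn_clm (H y) _)
  have h := integral_sub i1 i2
  have e : ∀ v : E3, (‖v‖ ^ 2)⁻¹ • (innerSL ℝ v).smulRight ((2 : ℝ)⁻¹ • H (y + v) (y + v)) -
      (‖v‖ ^ 2)⁻¹ • (innerSL ℝ v).smulRight (H y v) =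
      (‖v‖ ^ 2)⁻¹ • (innerSL ℝ v).smulRight ((2 : ℝ)⁻¹ • (H y y + H v v)) := by
    intro v
    have hq : H (y + v) (y + v) = H y y + H v v + (2 : ℝ) • H y v := by
      rw [map_add H, map_add, add_apply, add_apply, hH v y]; module
    rw [← smul_sub, hq]
    ext1 z
    simp only [smul_apply, sub_apply, ContinuousLinearMap.smulRight_apply]
    module
  simp only [e] at h
  rw [setIntegral_ball_odd _ (fun v => by ext; simp; ring) 1, setIntegral_inv_sq_smulRight] at h
  exact sub_eq_zero.1 h.symm

lemma dilT_quadratic (hH : ∀ v w, H v w = H w v)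
    (hL : LipOn M (fun q => (2 : ℝ)⁻¹ • H q q) (ball 0 2)) (c : ℝ) (i : Fin 3) :
    dilT (fun _ => c) (fun q => (2 : ℝ)⁻¹ • H q q) 0 i =
      c * (ballVol 1 / 3) ^ 2 * traceCLM (H (EuclideanSpace.single i 1)) := by
  set T : E3 →L[ℝ] ℝ := traceCLM.comp H
  -- The Riesz vector of `w ↦ tr (H w)`, the gradient of the divergence; it reduces the integral to
  -- the second moment.
  set e : E3 := (InnerProductSpace.toDual ℝ E3).symm T
  have hT : ∀ w, traceCLM (H w) = inner ℝ e w := fun w => by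
    rw [InnerProductSpace.toDual_symm_apply]; rfl
  have h : dilT (fun _ => c) (fun q => (2 : ℝ)⁻¹ • H q q) 0 = (c * (ballVol 1 / 3) ^ 2) • e := by
    have h1 : (c * (ballVol 1 / 3) ^ 2) • e = (c * (ballVol 1 / 3)) • ((ballVol 1 / 3) • e) := by
      module
    rw [h1, ← setIntegral_inv_sq_inner_smul e, dilT, ← integral_smul]
    refine setIntegral_congr_fun measurableSet_ball fun w hw => ?_
    rw [nlGrad_quadratic hH (hL.mono (ball_add_subset hw)), zero_add, map_smul, hT, smul_eq_mul]
    module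
  rw [h, hT, real_inner_comm, inner_single_left]
  rfl

lemma bondS_quadratic (H : E3 →L[ℝ] E3 →L[ℝ] E3) (c : ℝ) (i : Fin 3) :
    bondS (fun _ => c) (fun q => (2 : ℝ)⁻¹ • H q q) 0 i =
      c / 2 * (ballVol 1 / 15 * ∑ j, (H (EuclideanSpace.single j 1) (EuclideanSpace.single j 1) i
        + H (EuclideanSpace.single i 1) (EuclideanSpace.single j 1) j
        + H (EuclideanSpace.single j 1) (EuclideanSpace.single i 1) j)) := by
  have h := inner_setIntegral_quartic (EuclideanSpace.basisFun (Fin 3) ℝ) H i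
  simp only [EuclideanSpace.basisFun_apply, inner_single_left] at h
  have hs : bondS (fun _ => c) (fun q => (2 : ℝ)⁻¹ • H q q) 0 =
      (c / 2) • ∫ w in ball (0 : E3) 1, (‖w‖ ^ 4)⁻¹ • inner ℝ w (H w w) • w := by
    rw [bondS, ← integral_smul]
    congr 1; ext1 w
    simp only [zero_add, map_zero, smul_zero, sub_zero, inner_smul_right]
    module
  rw [hs, ← h]
  rfl

/-- The normalisations `15` and `9` cancel the moments `|B₁|/15` and `(|B₁|/3)²`. The bond term
gives `m (Δ + 2∇div)` and the dilatation term `(l - m) ∇div`, with sum `m Δ + (l + m) ∇div`. -/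
lemma unitL_quadratic (hH : ∀ v w, H v w = H w v)
    (hL : LipOn M (fun q => (2 : ℝ)⁻¹ • H q q) (ball 0 2)) (l m : ℝ) :
    unitL l m (fun q => (2 : ℝ)⁻¹ • H q q) = navierOf l m H := by
  have hβ := (ballVol_pos one_pos).ne'
  ext i
  have htr : traceCLM (H (EuclideanSpace.single i 1)) =
      ∑ j, H (EuclideanSpace.single i 1) (EuclideanSpace.single j 1) j := by
    rw [traceCLM_apply (EuclideanSpace.basisFun (Fin 3) ℝ)]
    simp only [EuclideanSpace.basisFun_apply, inner_single_left]
  have hN : navierOf l m H i = l * traceCLM (H (EuclideanSpace.single i 1)) +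
      m * ∑ j, (H (EuclideanSpace.single j 1) (EuclideanSpace.single j 1) i +
        H (EuclideanSpace.single i 1) (EuclideanSpace.single j 1) j) := by
    simp only [navierOf, stressOf, trace_matrixOf]
    simp only [Matrix.add_apply, Matrix.smul_apply, smul_eq_mul,
      Finset.sum_add_distrib, Matrix.one_apply, Matrix.transpose_apply, matrixOf,
      Matrix.of_apply, mul_ite, mul_one, mul_zero, Finset.sum_ite_eq, Finset.mem_univ, if_true,
      Finset.mul_sum, mul_add]
    simp only [hH (EuclideanSpace.single i 1)]
  have hu : unitL l m (fun q => (2 : ℝ)⁻¹ • H q q) i =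
      15 / ballVol 1 * bondS (fun _ => 2 * m) (fun q => (2 : ℝ)⁻¹ • H q q) 0 i +
      9 / ballVol 1 ^ 2 * dilT (fun _ => l - m) (fun q => (2 : ℝ)⁻¹ • H q q) 0 i := rfl
  rw [hu, bondS_quadratic, dilT_quadratic hH hL, hN, htr]
  simp only [Finset.sum_add_distrib, hH _ (EuclideanSpace.single i 1)]
  field_simp
  ring

end quadratic

/-! ### Pointwise consistency with the Navier operator -/

section navier
variable {lam mu : E3 → ℝ} {u : E3 → E3} {x : E3} {l m : ℝ}

lemma hasFDerivAt_stressOf (l m : ℝ) (i j : Fin 3) {D : E3 → E3 →L[ℝ] E3}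
    {H : E3 →L[ℝ] E3 →L[ℝ] E3} (hD : HasFDerivAt D H x) :
    ∃ L : E3 →L[ℝ] ℝ, (∀ v, L v = stressOf l m (H v) i j) ∧
      HasFDerivAt (fun y => stressOf l m (D y) i j) L x := by
  have hlin : IsLinearMap ℝ fun A : E3 →L[ℝ] E3 => stressOf l m A i j := by
    constructor
    · intro A B
      simp only [stressOf, trace_matrixOf, map_add]
      simp only [matrixOf, Matrix.add_apply, Matrix.smul_apply,
        Matrix.transpose_apply, Matrix.of_apply, add_apply, PiLp.add_apply, smul_eq_mul]
      ring
    · intro c A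
      simp only [stressOf, trace_matrixOf, map_smul]
      simp only [matrixOf, Matrix.add_apply, Matrix.smul_apply,
        Matrix.transpose_apply, Matrix.of_apply, smul_apply, PiLp.smul_apply, smul_eq_mul]
      ring
  set S : (E3 →L[ℝ] E3) →L[ℝ] ℝ := LinearMap.toContinuousLinearMap hlin.mk'
  exact ⟨S.comp H, fun v => rfl, S.hasFDerivAt.comp x hD⟩

lemma navier_eq_navierOf (hlam : lam =ᶠ[𝓝 x] fun _ => l) (hmu : mu =ᶠ[𝓝 x] fun _ => m)
    (hu : ∀ᶠ y in 𝓝 x, DifferentiableAt ℝ u y) {H : E3 →L[ℝ] E3 →L[ℝ] E3}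
    (hH : HasFDerivAt (fderiv ℝ u) H x) : navier lam mu u x = navierOf l m H := by
  ext i
  simp only [navier, navierOf]
  refine Finset.sum_congr rfl fun j _ => ?_
  obtain ⟨L, hL, hd⟩ := hasFDerivAt_stressOf l m i j hH
  have e : (fun y => stress lam mu u y i j) =ᶠ[𝓝 x] fun y => stressOf l m (fderiv ℝ u y) i j := by
    filter_upwards [hlam, hmu, hu] with y h1 h2 h3
    rw [stress_eq_stressOf lam mu h3, h1, h2]
  rw [pderiv, e.fderiv_eq, hd.fderiv, hL]

lemma unitL_tendsto {f : ℝ → E3 → E3} {g : E3 → E3} {M : ℝ} (hM : 0 ≤ M)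
    (hf : ∀ᶠ δ in 𝓝[>] (0 : ℝ), LipOn M (f δ) (ball 0 2)) (hg : LipOn M g (ball 0 2))
    (h : ∀ q, Tendsto (fun δ => f δ q) (𝓝[>] 0) (𝓝 (g q))) (l m : ℝ) :
    Tendsto (fun δ => unitL l m (f δ)) (𝓝[>] 0) (𝓝 (unitL l m g)) := by
  have h12 : ball (0 : E3) 1 ⊆ ball 0 2 := ball_subset_ball (by norm_num)
  have t1 := bondS_tendsto (l := 𝓝[>] (0 : ℝ)) (p := 0) (k := fun _ _ => 2 * m)
    (c := fun _ => 2 * m) hM (fun _ _ => le_rfl) (fun _ => measurable_const)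
    (hf.mono fun δ hδ => hδ.mono h12)
    (.of_forall fun _ _ => tendsto_const_nhds) fun q _ => h q
  have t2 := dilT_tendsto (l := 𝓝[>] (0 : ℝ)) (p := 0) (k := fun _ _ => l - m)
    (c := fun _ => l - m) hM (fun _ _ => le_rfl) (fun _ => measurable_const) hf hg
    (.of_forall fun _ _ => tendsto_const_nhds) fun q _ => h q
  exact (t1.const_smul _).add (t2.const_smul _)

lemma LipOn.of_tendsto {f : ℝ → E3 → E3} {g : E3 → E3} {M : ℝ} {s : Set E3}
    (hf : ∀ᶠ δ in 𝓝[>] (0 : ℝ), LipOn M (f δ) s)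
    (h : ∀ q, Tendsto (fun δ => f δ q) (𝓝[>] 0) (𝓝 (g q))) : LipOn M g s :=
  fun x hx y hy => le_of_tendsto ((h x).sub (h y)).norm (hf.mono fun _ hδ => hδ x hx y hy)

/-- Consistency of the peridynamic operator with the Navier operator at points where the moduli
are locally constant. -/
lemma unitL_taylorRem_tendsto {M : ℝ} (hM : 0 ≤ M) (hu : ContDiffAt ℝ 2 u x)
    (hL : ∀ᶠ δ in 𝓝[>] (0 : ℝ), LipOn M (taylorRem u x δ) (ball 0 2))
    (hlam : lam =ᶠ[𝓝 x] fun _ => l) (hmu : mu =ᶠ[𝓝 x] fun _ => m) :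
    Tendsto (fun δ => unitL l m (taylorRem u x δ)) (𝓝[>] 0) (𝓝 (navier lam mu u x)) := by
  have hd : ∀ᶠ y in 𝓝 x, DifferentiableAt ℝ u y := by
    filter_upwards [hu.eventually (by simp)] with y hy using hy.differentiableAt (by simp)
  have hH : HasFDerivAt (fderiv ℝ u) (fderiv ℝ (fderiv ℝ u) x) x :=
    ((hu.fderiv_right (m := 1) (by norm_num)).differentiableAt one_ne_zero).hasFDerivAt
  have hsymm := hu.isSymmSndFDerivAt (by simp)
  have ht := tendsto_taylorRem hd hH
  have hg := LipOn.of_tendsto hL ht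
  rw [navier_eq_navierOf hlam hmu hd hH, ← unitL_quadratic (fun v w => hsymm v w) hg]
  exact unitL_tendsto hM hL hg ht l m

end navier

/-! ### Measurability -/

section measurability
variable {Ω Γ : Set E3} {u : E3 → E3} {lam mu : E3 → ℝ} {δ : ℝ}

lemma measurable_setIntegral_ball {α : Type*} [MeasurableSpace α] {F : α → E3 → E3} {c : α → E3}
    (hδ : 0 < δ) (hc : Measurable c) (hF : Measurable fun p : α × E3 => F p.1 p.2) :
    Measurable fun x => ∫ y in ball (c x) δ, F x y := by
  simp only [setIntegral_ball_scale _ _ hδ]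
  have h : Measurable fun p : α × E3 => F p.1 (c p.1 + δ • p.2) :=
    hF.comp (measurable_fst.prodMk ((hc.comp measurable_fst).add (measurable_snd.const_smul δ)))
  have h2 := (h.stronglyMeasurable.integral_prod_right' (ν := volume.restrict (ball 0 1))).measurable
  exact h2.const_smul (δ ^ 3)

lemma measurable_opL (hδ : 0 < δ) (hlam : Measurable lam) (hmu : Measurable mu)
    (hu : Measurable u) : Measurable (opL δ lam mu u) := by
  have h1 : Measurable (opS δ mu u) := by
    have := measurable_setIntegral_ball (F := fun x y => ((mu x + mu y) *
      inner ℝ (y - x) (u y - u x) / ‖y - x‖ ^ 4) • (y - x)) hδ measurable_id (by fun_prop)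
    exact this.const_smul (15 / ballVol δ)
  have h2 : Measurable (opD δ lam mu u) := by
    have h3 := measurable_setIntegral_ball (α := E3 × E3) hδ measurable_snd
      (F := fun p z => ((lam p.2 - mu p.2) * inner ℝ (z - p.2) (u z) /
        (‖p.2 - p.1‖ ^ 2 * ‖z - p.2‖ ^ 2)) • (p.2 - p.1)) (by fun_prop)
    have := measurable_setIntegral_ball hδ measurable_id
      (F := fun x y => ∫ z in ball y δ, ((lam y - mu y) * inner ℝ (z - y) (u z) /
        (‖y - x‖ ^ 2 * ‖z - y‖ ^ 2)) • (y - x)) h3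
    exact this.const_smul (9 / ballVol δ ^ 2)
  exact h1.add h2

lemma opL_congr {v : E3 → E3} {x : E3} (hδ : 0 < δ) (h : EqOn u v (ball x (2 * δ))) :
    opL δ lam mu u x = opL δ lam mu v x := by
  have hsub : ball x δ ⊆ ball x (2 * δ) := ball_subset_ball (by linarith)
  have h1 : opS δ mu u x = opS δ mu v x := by
    rw [opS, opS]
    congr 1
    refine setIntegral_congr_fun measurableSet_ball fun y hy => ?_
    rw [h (hsub hy), h (mem_ball_self (by positivity))]
  have h2 : opD δ lam mu u x = opD δ lam mu v x := by
    rw [opD, opD]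
    congr 1
    refine setIntegral_congr_fun measurableSet_ball fun y hy => ?_
    refine setIntegral_congr_fun measurableSet_ball fun z hz => ?_
    have : z ∈ ball x (2 * δ) := by
      refine ball_subset_ball' ?_ hz
      have := (mem_ball.1 hy).le
      linarith
    rw [h this]
  rw [opL, opL, h1, h2]

lemma innerPart_eq (Ω : Set E3) (r : ℝ) : innerPart Ω r = (thickening r Ωᶜ)ᶜ := by
  ext x
  simp only [innerPart, mem_ofPred_eq, mem_compl_iff, mem_thickening_iff, not_exists, not_and,
    subset_def, mem_ball]
  refine forall_congr' fun y => ?_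
  rw [dist_comm x y]
  tauto

lemma measurableSet_innerPart (Ω : Set E3) (r : ℝ) : MeasurableSet (innerPart Ω r) := by
  rw [innerPart_eq]
  exact isOpen_thickening.measurableSet.compl

/-- Nothing is known of `u` outside `Ω`. On the inner part the operator samples `u` only inside `Ω`,
so `u` may be cut off there and becomes measurable. -/
lemma measurable_indicator_opL (ho : IsOpen Ω) (hδ : 0 < δ) (hlam : Measurable lam)
    (hmu : Measurable mu) (hu : ContinuousOn u Ω) :
    Measurable ((innerPart Ω (2 * δ) \ thickening δ Γ).indicator (opL δ lam mu u)) := by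
  classical
  have hm : Measurable (Ω.indicator u) := by
    rw [← piecewise_eq_indicator]
    exact hu.measurable_piecewise continuousOn_const ho.measurableSet
  have e : (innerPart Ω (2 * δ) \ thickening δ Γ).indicator (opL δ lam mu u) =
      (innerPart Ω (2 * δ) \ thickening δ Γ).indicator (opL δ lam mu (Ω.indicator u)) := by
    refine indicator_congr fun x hx => opL_congr hδ fun y hy => ?_
    rw [indicator_of_mem (hx.1 hy)]
  rw [e]
  exact (measurable_opL hδ hlam hmu hm).indicator
    ((measurableSet_innerPart Ω _).diff isOpen_thickening.measurableSet)

end measurability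

/-! ### Convergence in `Lᵖ` -/

lemma tendsto_eLpNorm_sub_of_bounded {α E : Type*} [MeasurableSpace α] [NormedAddCommGroup E]
    {μ : Measure α} [IsFiniteMeasure μ] {l : Filter ℝ} [l.IsCountablyGenerated]
    {f : ℝ → α → E} {g : α → E} {C : ℝ} {p : ENNReal} (hp : 1 ≤ p) (hp' : p ≠ ⊤)
    (hf : ∀ᶠ s in l, AEStronglyMeasurable (f s) μ) (hg : AEStronglyMeasurable g μ)
    (hb : ∀ᶠ s in l, ∀ᵐ x ∂μ, ‖f s x - g x‖ ≤ C)
    (hlim : ∀ᵐ x ∂μ, Tendsto (fun s => f s x) l (𝓝 (g x))) :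
    Tendsto (fun s => eLpNorm (f s - g) p μ) l (𝓝 0) := by
  have hp0 : p ≠ 0 := (zero_lt_one.trans_le hp).ne'
  have hpr : 0 < p.toReal := ENNReal.toReal_pos hp0 hp'
  simp only [eLpNorm_eq_lintegral_rpow_enorm_toReal hp0 hp']
  have h : Tendsto (fun s => ∫⁻ x, ‖(f s - g) x‖ₑ ^ p.toReal ∂μ) l (𝓝 (∫⁻ _, 0 ∂μ)) := by
    refine tendsto_lintegral_filter_of_dominated_convergence'
      (fun _ => (ENNReal.ofReal C) ^ p.toReal) ?_ ?_ ?_ ?_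
    · filter_upwards [hf] with s hs
      exact (hs.sub hg).enorm.pow_const _
    · filter_upwards [hb] with s hs
      filter_upwards [hs] with x hx
      gcongr
      rw [← ofReal_norm]
      exact ENNReal.ofReal_le_ofReal hx
    · rw [lintegral_const]
      exact ENNReal.mul_ne_top (ENNReal.rpow_ne_top_of_nonneg hpr.le ENNReal.ofReal_ne_top)
        (measure_ne_top _ _)
    · filter_upwards [hlim] with x hx
      have h1 : Tendsto (fun s => f s x - g x) l (𝓝 0) := by
        simpa using hx.sub_const (g x)
      have h2 := (h1.enorm).ennrpow_const p.toReal
      simpa [ENNReal.zero_rpow_of_pos hpr] using h2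
  have h3 := h.ennrpow_const (1 / p.toReal)
  simpa [ENNReal.zero_rpow_of_pos (inv_pos.2 hpr)] using h3

section convergence
variable {Ω Ωp Ωm Γ : Set E3} {n u Up Um : E3 → E3} {lamp lamm mup mum M : ℝ}

/-- The ball misses `Γ` and is connected, so it cannot meet both of the disjoint open phases. -/
lemma IsTwoPhaseComposite.ball_subset_phase (hΩ : IsTwoPhaseComposite Ω Ωp Ωm Γ n) {x : E3} {r : ℝ}
    (hb : ball x r ⊆ Ω) (hx : x ∉ thickening r Γ) : ball x r ⊆ Ωp ∨ ball x r ⊆ Ωm := by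
  have hsub : ball x r ⊆ Ωp ∪ Ωm := fun y hy => by
    rcases hΩ.mem_cases (hb hy) with h | h | h
    · exact Or.inl h
    · exact Or.inr h
    · exact absurd (mem_thickening_iff.2 ⟨y, h, by rw [dist_comm]; exact hy⟩) hx
  exact (isPreconnected_ball (x := x) (r := r)).subset_or_subset hΩ.isOpen_plus hΩ.isOpen_minus
    hΩ.disjoint_phases hsub

lemma IsTwoPhaseComposite.eventually_far (hΩ : IsTwoPhaseComposite Ω Ωp Ωm Γ n) {x : E3}
    (hx : x ∈ Ωp ∪ Ωm) :
    ∀ᶠ δ in 𝓝[>] (0 : ℝ), x ∈ innerPart Ω (2 * δ) \ thickening δ Γ := by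
  filter_upwards [eventually_ball_subset (hΩ.isOpen_plus.union hΩ.isOpen_minus) hx 2] with δ hδ
  rw [mul_comm] at hδ
  refine ⟨hδ.2.trans (union_subset hΩ.plus_subset hΩ.minus_subset), fun h => ?_⟩
  obtain ⟨y, hy, hd⟩ := mem_thickening_iff.1 h
  rw [dist_comm] at hd
  rcases hδ.2 (ball_subset_ball (by linarith [hδ.1]) (mem_ball.2 hd)) with h' | h'
  · exact hΩ.notMem_plus hy h'
  · exact hΩ.notMem_minus hy h'

lemma IsGlued.differentiableAt (h : IsGlued Ωp Ωm Γ u Up Um)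
    (hΩ : IsTwoPhaseComposite Ω Ωp Ωm Γ n) (hUp : ContDiffOn ℝ 1 Up Ω) (hUm : ContDiffOn ℝ 1 Um Ω)
    (he : ∀ x ∈ Γ, fderiv ℝ Up x = fderiv ℝ Um x) {x : E3} (hx : x ∈ Ω) :
    DifferentiableAt ℝ u x := by
  have ho := hΩ.isOpen_domain
  rcases hΩ.mem_cases hx with h' | h' | h'
  · exact (h.eventually_plus hΩ h').differentiableAt_iff.2
      (hasFDerivAt_of_contDiffOn ho hUp hx).differentiableAt
  · exact (h.eventually_minus hΩ h').differentiableAt_iff.2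
      (hasFDerivAt_of_contDiffOn ho hUm hx).differentiableAt
  · exact (h.hasFDerivAt hΩ hUp hUm h' (he x h')).differentiableAt

/-- A map glued from two `C²` maps with matching gradients, with bounded second derivative. -/
structure IsGluedC2 (Ω Ωp Ωm Γ : Set E3) (u Up Um : E3 → E3) (M : ℝ) : Prop where
  isGlued : IsGlued Ωp Ωm Γ u Up Um
  contDiffOn_plus : ContDiffOn ℝ 2 Up Ω
  contDiffOn_minus : ContDiffOn ℝ 2 Um Ω
  fderiv_eq : ∀ x ∈ Γ, fderiv ℝ Up x = fderiv ℝ Um x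
  nonneg : 0 ≤ M
  bound : ∀ x ∈ Ωp ∪ Ωm, ‖fderiv ℝ (fderiv ℝ u) x‖ ≤ M

namespace IsGluedC2

lemma differentiableAt (h : IsGluedC2 Ω Ωp Ωm Γ u Up Um M)
    (hΩ : IsTwoPhaseComposite Ω Ωp Ωm Γ n) {x : E3} (hx : x ∈ Ω) : DifferentiableAt ℝ u x :=
  h.isGlued.differentiableAt hΩ (h.contDiffOn_plus.of_le (by norm_num))
    (h.contDiffOn_minus.of_le (by norm_num)) h.fderiv_eq hx

/-- Matching gradients make `fderiv ℝ u` itself a glued map with `C¹` pieces, so the Lipschitz bound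
for glued maps applies to it. -/
lemma lipOn_fderiv (h : IsGluedC2 Ω Ωp Ωm Γ u Up Um M)
    (hΩ : IsTwoPhaseComposite Ω Ωp Ωm Γ n) {s : Set E3} (hs : Convex ℝ s) (hsΩ : s ⊆ Ω) :
    LipOn M (fderiv ℝ u) s :=
  (h.isGlued.fderiv_glued hΩ (h.contDiffOn_plus.of_le (by norm_num))
    (h.contDiffOn_minus.of_le (by norm_num)) h.fderiv_eq).lipOn hΩ
    (h.contDiffOn_plus.fderiv_of_isOpen hΩ.isOpen_domain (by norm_num))
    (h.contDiffOn_minus.fderiv_of_isOpen hΩ.isOpen_domain (by norm_num)) h.bound hs hsΩ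

lemma lipOn_taylorRem (h : IsGluedC2 Ω Ωp Ωm Γ u Up Um M)
    (hΩ : IsTwoPhaseComposite Ω Ωp Ωm Γ n) {δ : ℝ} (hδ : 0 < δ) {x : E3}
    (hx : x ∈ innerPart Ω (2 * δ)) : LipOn (2 * M) (taylorRem u x δ) (ball 0 2) :=
  Peridynamics.lipOn_taylorRem hδ (fun _ hy => h.differentiableAt hΩ (hx hy))
    (h.lipOn_fderiv hΩ (convex_ball _ _) hx) h.nonneg

lemma opL_eq_unitL (h : IsGluedC2 Ω Ωp Ωm Γ u Up Um M)
    (hΩ : IsTwoPhaseComposite Ω Ωp Ωm Γ n) {δ : ℝ} (hδ : 0 < δ) {x : E3}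
    (hx : x ∈ innerPart Ω (2 * δ)) {lam mu : E3 → ℝ} {l m : ℝ}
    (hlam : ∀ y ∈ ball x δ, lam y = l) (hmu : ∀ y ∈ ball x δ, mu y = m) :
    opL δ lam mu u x = unitL l m (taylorRem u x δ) :=
  Peridynamics.opL_eq_unitL hδ (fun _ hy => h.differentiableAt hΩ (hx hy))
    (h.lipOn_fderiv hΩ (convex_ball _ _) hx) h.nonneg hlam hmu

/-- Uniformity in `δ` up to `Γ_δ` is the majorant for the `Lᵖ` limit. It rests on the gradient being
Lipschitz across `Γ`, since the `2δ`-ball around such a point may meet both phases. -/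
lemma exists_norm_opL_le (h : IsGluedC2 Ω Ωp Ωm Γ u Up Um M)
    (hΩ : IsTwoPhaseComposite Ω Ωp Ωm Γ n) (lamp lamm mup mum : ℝ) :
    ∃ C, 0 ≤ C ∧ ∀ δ > 0, ∀ x ∈ innerPart Ω (2 * δ) \ thickening δ Γ,
      ‖opL δ (twoPhase Ωm lamp lamm) (twoPhase Ωm mup mum) u x‖ ≤ C := by
  have hM : 0 ≤ 2 * M := by linarith [h.nonneg]
  obtain ⟨B, hB⟩ : ∃ B : ℝ → ℝ → ℝ, ∀ l m f, LipOn (2 * M) f (ball 0 2) → ‖unitL l m f‖ ≤ B l m :=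
    ⟨_, fun l m f hf => norm_unitL_le l m hM hf⟩
  refine ⟨max 0 (max (B lamp mup) (B lamm mum)), le_max_left _ _, fun δ hδ x hx => ?_⟩
  have hsub : ball x δ ⊆ Ω := (ball_subset_ball (by linarith)).trans hx.1
  have ht := h.lipOn_taylorRem hΩ hδ hx.1
  rcases hΩ.ball_subset_phase hsub hx.2 with h' | h'
  · rw [h.opL_eq_unitL hΩ hδ hx.1 (fun y hy => twoPhase_plus hΩ _ _ (h' hy))
      (fun y hy => twoPhase_plus hΩ _ _ (h' hy))]
    exact (hB _ _ _ ht).trans ((le_max_left _ _).trans (le_max_right _ _))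
  · rw [h.opL_eq_unitL hΩ hδ hx.1 (fun y hy => twoPhase_minus _ _ (h' hy))
      (fun y hy => twoPhase_minus _ _ (h' hy))]
    exact (hB _ _ _ ht).trans ((le_max_right _ _).trans (le_max_right _ _))

lemma opL_tendsto_aux (h : IsGluedC2 Ω Ωp Ωm Γ u Up Um M)
    (hΩ : IsTwoPhaseComposite Ω Ωp Ωm Γ n) {S : Set E3} (hS : IsOpen S) (hSΩ : S ⊆ Ω)
    {lam mu : E3 → ℝ} {l m : ℝ} (hlam : ∀ y ∈ S, lam y = l) (hmu : ∀ y ∈ S, mu y = m)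
    (hu : ContDiffOn ℝ 2 u S) {x : E3} (hx : x ∈ S) :
    Tendsto (fun δ => opL δ lam mu u x) (𝓝[>] 0) (𝓝 (navier lam mu u x)) := by
  have hev := eventually_ball_subset hS hx 2
  have hin : ∀ {δ : ℝ}, ball x (δ * 2) ⊆ S → x ∈ innerPart Ω (2 * δ) := fun hb => by
    rw [mul_comm] at hb; exact hb.trans hSΩ
  have hnhds := hS.mem_nhds hx
  refine (unitL_taylorRem_tendsto (lam := lam) (mu := mu) (l := l) (m := m) (M := 2 * M)
    (by linarith [h.nonneg]) (hu.contDiffAt hnhds) ?_ ?_ ?_).congr' ?_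
  · filter_upwards [hev] with δ hδ using h.lipOn_taylorRem hΩ hδ.1 (hin hδ.2)
  · filter_upwards [hnhds] with y hy using hlam y hy
  · filter_upwards [hnhds] with y hy using hmu y hy
  · filter_upwards [hev] with δ hδ
    have hb : ball x δ ⊆ S := (ball_subset_ball (by linarith [hδ.1])).trans hδ.2
    exact (h.opL_eq_unitL hΩ hδ.1 (hin hδ.2) (fun y hy => hlam y (hb hy))
      (fun y hy => hmu y (hb hy))).symm

lemma opL_tendsto (h : IsGluedC2 Ω Ωp Ωm Γ u Up Um M)
    (hΩ : IsTwoPhaseComposite Ω Ωp Ωm Γ n) {x : E3} (hx : x ∈ Ωp ∪ Ωm) :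
    Tendsto (fun δ => opL δ (twoPhase Ωm lamp lamm) (twoPhase Ωm mup mum) u x) (𝓝[>] 0)
      (𝓝 (navier (twoPhase Ωm lamp lamm) (twoPhase Ωm mup mum) u x)) := by
  rcases hx with hx | hx
  · exact h.opL_tendsto_aux hΩ hΩ.isOpen_plus hΩ.plus_subset
      (fun y hy => twoPhase_plus hΩ _ _ hy) (fun y hy => twoPhase_plus hΩ _ _ hy)
      ((h.contDiffOn_plus.mono hΩ.plus_subset).congr fun y hy => h.isGlued.plus (Or.inl hy)) hx
  · exact h.opL_tendsto_aux hΩ hΩ.isOpen_minus hΩ.minus_subset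
      (fun y hy => twoPhase_minus _ _ hy) (fun y hy => twoPhase_minus _ _ hy)
      ((h.contDiffOn_minus.mono hΩ.minus_subset).congr fun y hy => h.isGlued.minus (Or.inl hy)) hx

/-- The peridynamic operator off the extended interface converges to the Navier operator. -/
theorem tendsto_navier (h : IsGluedC2 Ω Ωp Ωm Γ u Up Um M)
    (hΩ : IsTwoPhaseComposite Ω Ωp Ωm Γ n) (hvol : volume Ω ≠ ⊤) {lam mu : E3 → ℝ}
    (hlam : lam = twoPhase Ωm lamp lamm) (hmu : mu = twoPhase Ωm mup mum) {p : ENNReal}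
    (hp : 1 ≤ p) (hp' : p ≠ ⊤) :
    MemLp (navier lam mu u) p (volume.restrict Ω) ∧
    (∀ δ > 0, MemLp ((innerPart Ω (2 * δ) \ thickening δ Γ).indicator (opL δ lam mu u)) p
      (volume.restrict Ω)) ∧
    Tendsto (fun δ : ℝ => eLpNorm ((innerPart Ω (2 * δ) \ thickening δ Γ).indicator
      (opL δ lam mu u) - navier lam mu u) p (volume.restrict Ω)) (𝓝[>] (0 : ℝ)) (𝓝 0) := by
  have : IsFiniteMeasure (volume.restrict Ω) := ⟨by
    rw [Measure.restrict_apply_univ]; exact hvol.lt_top⟩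
  subst hlam hmu
  set W : ℝ → E3 → E3 := fun δ => (innerPart Ω (2 * δ) \ thickening δ Γ).indicator
    (opL δ (twoPhase Ωm lamp lamm) (twoPhase Ωm mup mum) u)
  set N := navier (twoPhase Ωm lamp lamm) (twoPhase Ωm mup mum) u
  obtain ⟨C, hC0, hC⟩ := h.exists_norm_opL_le hΩ lamp lamm mup mum
  have hu : ContinuousOn u Ω := fun x hx => (h.differentiableAt hΩ hx).continuousAt.continuousWithinAt
  have hmeas : ∀ δ > 0, Measurable (W δ) := fun δ hδ =>
    measurable_indicator_opL hΩ.isOpen_domain hδ (measurable_twoPhase hΩ.isOpen_minus _ _)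
      (measurable_twoPhase hΩ.isOpen_minus _ _) hu
  have hWC : ∀ δ > 0, ∀ x, ‖W δ x‖ ≤ C := fun δ hδ x => by
    by_cases hx : x ∈ innerPart Ω (2 * δ) \ thickening δ Γ
    · simp only [W, indicator_of_mem hx]; exact hC δ hδ x hx
    · simp only [W, indicator_of_notMem hx, norm_zero]; exact hC0
  -- Pointwise convergence is known only off `Γ`, which is a null set.
  have hae : ∀ᵐ x ∂(volume.restrict Ω), x ∈ Ωp ∪ Ωm := by
    rw [ae_restrict_iff' hΩ.isOpen_domain.measurableSet]
    have : ∀ᵐ x : E3, x ∉ Γ := by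
      rw [ae_iff]; simpa using hΩ.volume_interface
    filter_upwards [this] with x hx hxΩ
    rw [hΩ.domain_eq] at hxΩ
    exact hxΩ.resolve_right hx
  have hlim : ∀ x ∈ Ωp ∪ Ωm, Tendsto (fun δ => W δ x) (𝓝[>] 0) (𝓝 (N x)) := fun x hx => by
    refine (h.opL_tendsto hΩ hx).congr' ?_
    filter_upwards [hΩ.eventually_far hx] with δ hδ
    simp only [W, indicator_of_mem hδ]
  have hNC : ∀ x ∈ Ωp ∪ Ωm, ‖N x‖ ≤ C := fun x hx =>
    le_of_tendsto (hlim x hx).norm (by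
      filter_upwards [self_mem_nhdsWithin] with δ hδ using hWC δ hδ x)
  have hN : AEStronglyMeasurable N (volume.restrict Ω) := by
    -- Measurability of the limit is inherited from the operators along a sequence, rather than read
    -- off the derivatives of `u`.
    have hseq : Tendsto (fun k : ℕ => (1 : ℝ) / (k + 1)) atTop (𝓝[>] 0) :=
      tendsto_nhdsWithin_iff.2 ⟨tendsto_one_div_add_atTop_nhds_zero_nat,
        .of_forall fun k => by rw [mem_Ioi]; positivity⟩
    refine aestronglyMeasurable_of_tendsto_ae atTop (f := fun k : ℕ => W (1 / (k + 1)))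
      (fun k => (hmeas _ (by positivity)).aestronglyMeasurable) ?_
    filter_upwards [hae] with x hx using (hlim x hx).comp hseq
  refine ⟨MemLp.of_bound hN C (hae.mono hNC), fun δ hδ =>
    MemLp.of_bound (hmeas δ hδ).aestronglyMeasurable C (.of_forall (hWC δ hδ)), ?_⟩
  refine tendsto_eLpNorm_sub_of_bounded (C := C + C) hp hp' ?_ hN ?_ (hae.mono hlim)
  · filter_upwards [self_mem_nhdsWithin] with δ hδ using (hmeas δ hδ).aestronglyMeasurable
  · filter_upwards [self_mem_nhdsWithin] with δ hδ
    filter_upwards [hae] with x hx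
    exact (norm_sub_le _ _).trans (add_le_add (hWC δ hδ x) (hNC x hx))

end IsGluedC2

/-- On `Γ_δ` the hypothesis gives zero, and off `Γ_δ` the correction is switched off. The correction
thus disappears from the `Lᵖ` statement. -/
lemma indicator_opStar_eq {δ : ℝ} (hδ : 0 < δ) {lam mu : E3 → ℝ}
    (h : ∀ x ∈ extendedInterface Ω Γ δ ∩ innerPart Ω (2 * δ), opStar δ Ω Γ lam mu n u x = 0) :
    (innerPart Ω (2 * δ)).indicator (opStar δ Ω Γ lam mu n u) =
      (innerPart Ω (2 * δ) \ thickening δ Γ).indicator (opL δ lam mu u) := by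
  ext1 x
  by_cases hx : x ∈ innerPart Ω (2 * δ)
  · have hxΩ : x ∈ Ω := hx (mem_ball_self (by positivity))
    rw [indicator_of_mem hx]
    by_cases hx' : x ∈ thickening δ Γ
    · rw [indicator_of_notMem fun h' => h'.2 hx', h x ⟨⟨hxΩ, hx'⟩, hx⟩]
    · rw [indicator_of_mem (show x ∈ innerPart Ω (2 * δ) \ thickening δ Γ from ⟨hx, hx'⟩), opStar,
        indicator_of_notMem fun h' => hx' h'.2, add_zero]
  · rw [indicator_of_notMem hx, indicator_of_notMem fun h' => hx h'.1]

end convergence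

end Peridynamics

/-! ### The theorem -/

open Peridynamics in
theorem theorem5p1 (Ω Ωp Ωm Γ : Set E3) (n : E3 → E3) (lamp lamm mup mum : ℝ) (u : E3 → E3)
    (hΩ : IsTwoPhaseComposite Ω Ωp Ωm Γ n) (hvol : volume Ω ≠ ⊤)
    (hmup : 0 < mup) (hmum : 0 < mum)
    (lam mu : E3 → ℝ) (hlam : lam = twoPhase Ωm lamp lamm) (hmu : mu = twoPhase Ωm mup mum)
    (hu : IsPiecewiseSmooth Ω Ωp Ωm u)
    (hcond : ∀ᶠ δ in 𝓝[>] (0 : ℝ), ∀ x ∈ extendedInterface Ω Γ δ ∩ innerPart Ω (2 * δ),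
      opStar δ Ω Γ lam mu n u x = 0) :
    (∀ p : ENNReal, 1 ≤ p → p ≠ ⊤ →
      MemLp (navier lam mu u) p (volume.restrict Ω) ∧
      (∀ᶠ δ in 𝓝[>] (0 : ℝ),
        MemLp ((innerPart Ω (2 * δ)).indicator (opStar δ Ω Γ lam mu n u)) p
          (volume.restrict Ω)) ∧
      Tendsto (fun δ : ℝ =>
          eLpNorm ((innerPart Ω (2 * δ)).indicator (opStar δ Ω Γ lam mu n u) - navier lam mu u) p
            (volume.restrict Ω))
        (𝓝[>] (0 : ℝ)) (𝓝 0)) ∧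
    (∀ x ∈ Γ, ∃ Sp Sm : Matrix (Fin 3) (Fin 3) ℝ,
      Tendsto (stress lam mu u) (𝓝[Ωp] x) (𝓝 Sp) ∧
      Tendsto (stress lam mu u) (𝓝[Ωm] x) (𝓝 Sm) ∧
      Tendsto (fun δ : ℝ => δ • opStar δ Ω Γ lam mu n u x) (𝓝[>] (0 : ℝ))
        (𝓝 ((45 / 32 : ℝ) • WithLp.toLp 2 ((Sp - Sm).mulVec (n x)))) ∧
      (Sp - Sm).mulVec (n x) = 0) := by
  have hpl := hu.smooth_plus
  have hmi := hu.smooth_minus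
  obtain ⟨Up, hUp, hup⟩ := hpl
  obtain ⟨Um, hUm, hum⟩ := hmi
  obtain ⟨M₁, hM₁⟩ := hu.bounded 1 (by norm_num)
  obtain ⟨M₂, hM₂⟩ := hu.bounded 2 (by norm_num)
  have hglue : IsGlued Ωp Ωm Γ u Up Um :=
    isGlued_of_continuousOn hΩ hu.continuousOn hUp.continuousOn hUm.continuousOn hup hum
  have hUp1 : ContDiffOn ℝ 1 Up Ω := hUp.of_le (by norm_num)
  have hUm1 : ContDiffOn ℝ 1 Um Ω := hUm.of_le (by norm_num)
  have hb₁ : ∀ x ∈ Ωp ∪ Ωm, ‖fderiv ℝ u x‖ ≤ M₁ := fun x hx => by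
    rw [← norm_iteratedFDeriv_one]; exact hM₁ x hx
  -- The maximum with `0` keeps the bound nonnegative even when both phases are empty.
  have hb₂ : ∀ x ∈ Ωp ∪ Ωm, ‖fderiv ℝ (fderiv ℝ u) x‖ ≤ max M₂ 0 := fun x hx => by
    rw [← norm_iteratedFDeriv_one, norm_iteratedFDeriv_fderiv]
    exact (hM₂ x hx).trans (le_max_left _ _)
  subst hlam hmu
  -- The decisive consequence of the hypothesis: the two one-sided gradients agree, on which both
  -- parts of the conclusion depend.
  have he : ∀ x ∈ Γ, fderiv ℝ Up x = fderiv ℝ Um x := fun x hx =>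
    hglue.fderiv_eq_of_opStar_eq_zero hΩ hUp1 hUm1 hb₁ hmup hmum hcond hx
  have hC2 : IsGluedC2 Ω Ωp Ωm Γ u Up Um (max M₂ 0) :=
    ⟨hglue, hUp.of_le (by norm_num), hUm.of_le (by norm_num), he, le_max_right _ _, hb₂⟩
  have hEq : ∀ᶠ δ in 𝓝[>] (0 : ℝ), (innerPart Ω (2 * δ)).indicator
      (opStar δ Ω Γ (twoPhase Ωm lamp lamm) (twoPhase Ωm mup mum) n u) =
      (innerPart Ω (2 * δ) \ Metric.thickening δ Γ).indicator
        (opL δ (twoPhase Ωm lamp lamm) (twoPhase Ωm mup mum) u) := by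
    filter_upwards [self_mem_nhdsWithin, hcond] with δ hδ h using indicator_opStar_eq hδ h
  refine ⟨fun p hp hp' => ?_, fun x hx =>
    hglue.interface_condition hΩ hUp1 hUm1 hb₁ hcond hx (he x hx)⟩
  obtain ⟨h1, h2, h3⟩ := hC2.tendsto_navier hΩ hvol (lamp := lamp) (lamm := lamm) (mup := mup)
    (mum := mum) rfl rfl hp hp'
  refine ⟨h1, ?_, h3.congr' ?_⟩
  · filter_upwards [hEq, self_mem_nhdsWithin] with δ hδ hpos
    rw [hδ]; exact h2 δ hpos
  · filter_upwards [hEq] with δ hδ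
    rw [hδ]
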